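/- For integers $k,\ell\ge 0$, a finite simple graph $G=(V,E)$ is a $(k,\ell)$-graph if $V$ can be partitioned into $k$ independent sets and $\ell$ cliques, where parts may be empty. Write $n=|V|$, $m=|E|$ and $\overline m=\binom n2-m$ for the numbers of vertices, of edges, and of edges of the complement $\overline G$. **Theorem.** 1. It can be decided in $O(n(n+m))$ time whether a graph $G$ is a $(2,1)$-graph. 2. It can be decided in $O(n(n+\overline m))$ time whether a graph $G$ is a $(1,2)$-graph. Here an algorithm is a fixed program of a word RAM (operations: constants, copying, addition, truncated subtraction, indirect load and store, jumps and comparison, each of unit cost) whose words hold $O(\log n)$ bits. More precisely, for each of the two problems there are a program and constants $c,e$, such that for every $n \ge 0$ and every graph $G$ with vertex set $\{0,\dots,n-1\}$, given by adjacency lists of $G$ with the neighbours in arbitrary order, the program halts with the correct answer after at most $c\,(T+1)$ steps, where $T=n(n+m)$ for the first problem and $T=n(n+\overline m)$ for the second, and all words that it computes are smaller than $(n+2)^e$. -/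

import Mathlib

/-- `G` is a `(k, l)`-graph: its vertices are partitioned into `k` independent sets and `l` cliques.
As usual (a bipartite graph is a `(2, 0)`-graph), parts may be empty. -/
def SimpleGraph.IsKLGraph {V : Type*} (k l : ℕ) (G : SimpleGraph V) : Prop :=
  ∃ part : V → Fin k ⊕ Fin l,
    (∀ i : Fin k, G.IsIndepSet (part ⁻¹' {Sum.inl i})) ∧
    (∀ j : Fin l, G.IsClique (part ⁻¹' {Sum.inr j}))

namespace WordRAM

/-- The instructions of a word RAM, with registers `r 0, r 1, …` (a program mentions finitely many of
them) and an array `mem` of words. All arguments are register names, except the constant `v` in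
`const`, the program lines `target`, and the answer in `halt`. -/
inductive Instr where
  /-- `r d := v` -/
  | const (d v : ℕ)
  /-- `r d := r a` -/
  | copy (d a : ℕ)
  /-- `r d := r a + r b` -/
  | add (d a b : ℕ)
  /-- `r d := max (r a - r b) 0` -/
  | sub (d a b : ℕ)
  /-- `r d := mem[r a]` -/
  | load (d a : ℕ)
  /-- `mem[r a] := r b` -/
  | store (a b : ℕ)
  /-- go to line `target` -/
  | jump (target : ℕ)
  /-- go to line `target` if `r a < r b`, and to the next line otherwise -/
  | jumpLT (a b target : ℕ)
  /-- stop with the given answer -/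
  | halt (answer : Bool)

/-- A program is a finite list of instructions; its lines are numbered from `0`. -/
abbrev Program := List Instr

/-- A configuration: the current line, the registers and the memory. -/
structure Config where
  pc : ℕ
  reg : ℕ → ℕ
  mem : ℕ → ℕ

/-- Write the value `v` to register `d` and go to the next line. A word can only hold the values
`0, …, W - 1`: if `v` is not among them, the machine crashes (`none`). -/
def Config.setReg (W : ℕ) (s : Config) (d v : ℕ) : Option Config :=
  if v < W then some { s with pc := s.pc + 1, reg := Function.update s.reg d v } else none

/-- The effect of one instruction other than `halt`, with words in `{0, …, W - 1}`. -/
def step (W : ℕ) (s : Config) : Instr → Option Config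
  | .const d v => s.setReg W d v
  | .copy d a => s.setReg W d (s.reg a)
  | .add d a b => s.setReg W d (s.reg a + s.reg b)
  | .sub d a b => s.setReg W d (s.reg a - s.reg b)
  | .load d a => s.setReg W d (s.mem (s.reg a))
  | .store a b => some { s with pc := s.pc + 1, mem := Function.update s.mem (s.reg a) (s.reg b) }
  | .jump target => some { s with pc := target }
  | .jumpLT a b target => some { s with pc := if s.reg a < s.reg b then target else s.pc + 1 }
  | .halt _ => none

/-- The answer of the program `P` started in a configuration, if it halts with an answer within `t`
steps (each instruction, `halt` included, is one step); `none` if it does not halt within `t` steps,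
if it crashes, or if it leaves the program text. -/
def exec (W : ℕ) (P : Program) : ℕ → Config → Option Bool
  | 0, _ => none
  | t + 1, s =>
    match P[s.pc]? with
    | none => none
    | some (.halt answer) => some answer
    | some i => (step W s i).bind (exec W P t)

/-- The initial configuration: line `0`, all registers `0`, the input at the beginning of the memory,
and `0` in all other cells. -/
def init (input : List ℕ) : Config where
  pc := 0
  reg := fun _ => 0
  mem := fun i => input.getD i 0

/-- `adj` is an adjacency list representation of `G`: `adj v` lists the neighbours of `v`, in any
order, each of them once. -/
def IsAdjLists {n : ℕ} (G : SimpleGraph (Fin n)) (adj : Fin n → List (Fin n)) : Prop :=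
  ∀ v, (adj v).Nodup ∧ ∀ w, w ∈ adj v ↔ G.Adj v w

/-- The address at which the list of the vertex `v` starts (for `v = n`: the end of the input). -/
def listStart {n : ℕ} (adj : Fin n → List (Fin n)) (v : ℕ) : ℕ :=
  n + 2 + ∑ u : Fin n, if (u : ℕ) < v then (adj u).length else 0

/-- The input words of a graph with vertices `0, …, n - 1` given by adjacency lists: the number `n`,
then the start addresses of the `n` lists and the end address of the last one, then the lists. -/
def encode {n : ℕ} (adj : Fin n → List (Fin n)) : List ℕ :=
  n :: ((List.range (n + 1)).map (listStart adj) ++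
    (List.finRange n).flatMap fun v => (adj v).map Fin.val)

/-- The property `Q` of finite graphs can be decided in time `O(T)` on a word RAM with words of
`O(log n)` bits: there are one program and constants `c`, `e` such that on every `n`-vertex graph `G`,
given by adjacency lists in whatever order, the program halts with the correct answer within
`c * (T G + 1)` steps, all words being smaller than `(n + 2) ^ e` throughout. -/
def DecidableInTime (Q : ∀ {n : ℕ}, SimpleGraph (Fin n) → Prop)
    (T : ∀ {n : ℕ}, SimpleGraph (Fin n) → ℕ) : Prop :=
  ∃ (P : Program) (c e : ℕ), ∀ (n : ℕ) (G : SimpleGraph (Fin n)) (adj : Fin n → List (Fin n)),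
    IsAdjLists G adj →
      ∃ answer : Bool,
        exec ((n + 2) ^ e) P (c * (T G + 1)) (init (encode adj)) = some answer ∧
        (answer = true ↔ Q G)

end WordRAM

/-! A graph is a $(2,1)$-graph exactly if deleting some clique $C$ leaves a bipartite graph. Every
$v \in C$ then has a bipartite non-neighbourhood, because its non-neighbours lie outside $C$. Let
$K$ be a greedily chosen maximal clique among the vertices with bipartite non-neighbourhood; this
costs $n$ breadth-first searches. The set $K \setminus C$ is a clique in a bipartite graph, so it
has at most two vertices. By maximality of $K$, each vertex of $T = C \setminus K$ misses some $p
\in K$, and $p \notin C$. The vertices of $T$ missed by one such $p$ form a clique in the bipartite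
non-neighbourhood of $p$, so there are at most two of them. Hence $|T| \le 4$
(`TwoOne.exists_isExt`). Conversely, for any set $T$ the vertices of $K \cup T$ that are equal or
adjacent to every vertex of $T$ form a clique (`TwoOne.of_bip`). It remains to find a $T$ with at
most four vertices for which the graph outside this core is bipartite; testing one $T$ takes linear
time.

Trying all $T$ would be too slow, so $T$ is grown by branching. If more than two vertices are
missing, they contain a triangle outside the current core, and every triangle there must contain a
missing vertex; so one triangle gives three branches, and a fourth branch adds nothing
(`Completes.exists_index`). Two such levels leave at most two missing vertices. Breadth-first search
outside the core then either proves bipartiteness or finds an edge inside one level. The tree paths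
from its ends to their common root close an odd walk, so they contain a missing vertex $w$
(`BfsResult.exists_mem_chain`). Each $w$ on the paths is tested alone and together with each
neighbour outside the core. A path has at most one vertex per level, and edges join levels at
distance at most one, so a vertex has at most three neighbours on a path (`IsChain.sum_card_le`).
This gives at most $8n$ linear-time tests per leaf. Triangles are found in time $O(n(n+m))$.

The second problem is the first one for the complement, whose representation is built in time
$O(n^2)$. The algorithm is written in a small structured language with a weakest-precondition
calculus; `Runs.reach` compiles it to the word RAM with constant overhead per elementary command. -/

namespace WordRAM

/-! ### Running machine code in pieces -/

section

/-- `code` occurs in the program `P` from line `o` on. -/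
def CodeAt (P : Program) (o : ℕ) (code : List Instr) : Prop :=
  ∀ i (h : i < code.length), P[o + i]? = some code[i]

theorem codeAt_append {P : Program} {o : ℕ} {a b : List Instr} :
    CodeAt P o (a ++ b) ↔ CodeAt P o a ∧ CodeAt P (o + a.length) b := by
  constructor
  · intro h
    refine ⟨fun i hi => ?_, fun i hi => ?_⟩
    · rw [h i (by simp; omega), List.getElem_append_left hi]
    · have := h (a.length + i) (by simp; omega)
      rw [← add_assoc] at this
      rw [this, List.getElem_append_right (by omega)]
      simp
  · rintro ⟨h₁, h₂⟩ i hi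
    by_cases hia : i < a.length
    · rw [h₁ i hia, List.getElem_append_left hia]
    · have := h₂ (i - a.length) (by simp at hi; omega)
      rw [List.getElem_append_right (by omega), ← this]
      congr 1
      omega

theorem codeAt_cons {P : Program} {o : ℕ} {a : Instr} {b : List Instr} :
    CodeAt P o (a :: b) ↔ P[o]? = some a ∧ CodeAt P (o + 1) b := by
  rw [← List.singleton_append, codeAt_append]
  simp [CodeAt]

/-- In `k` steps the program `P` goes from `s` to `s'`. -/
def Reach (W : ℕ) (P : Program) (k : ℕ) (s s' : Config) : Prop :=
  ∀ t, exec W P (k + t) s = exec W P t s'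

theorem Reach.refl {W : ℕ} {P : Program} (s : Config) : Reach W P 0 s s := by
  intro t
  rw [zero_add]

theorem Reach.trans {W : ℕ} {P : Program} {k l : ℕ} {s s' s'' : Config}
    (h₁ : Reach W P k s s') (h₂ : Reach W P l s' s'') : Reach W P (k + l) s s'' := by
  intro t
  rw [add_assoc, h₁, h₂]

theorem Reach.cast {W : ℕ} {P : Program} {k l : ℕ} {s s' t t' : Config}
    (h : Reach W P k s s') (hk : k = l) (hs : s = t) (hs' : s' = t') : Reach W P l t t' := by
  subst hk hs hs'
  exact h

/-- A `halt` line is excluded automatically, since `step` is undefined on it. -/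
theorem Reach.of_step {W : ℕ} {P : Program} {s s' : Config} {i : Instr}
    (hi : P[s.pc]? = some i) (hs : step W s i = some s') : Reach W P 1 s s' := by
  intro t
  rw [add_comm, exec, hi]
  cases i <;> simp_all [step]

variable {W : ℕ} {P : Program} {o : ℕ} {ρ μ : ℕ → ℕ}

theorem reach_const {d v : ℕ} (hi : P[o]? = some (.const d v)) (hv : v < W) :
    Reach W P 1 ⟨o, ρ, μ⟩ ⟨o + 1, Function.update ρ d v, μ⟩ :=
  .of_step hi (by simp [step, Config.setReg, hv])

theorem reach_copy {d a : ℕ} (hi : P[o]? = some (.copy d a)) (hv : ρ a < W) :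
    Reach W P 1 ⟨o, ρ, μ⟩ ⟨o + 1, Function.update ρ d (ρ a), μ⟩ :=
  .of_step hi (by simp [step, Config.setReg, hv])

theorem reach_add {d a b : ℕ} (hi : P[o]? = some (.add d a b)) (hv : ρ a + ρ b < W) :
    Reach W P 1 ⟨o, ρ, μ⟩ ⟨o + 1, Function.update ρ d (ρ a + ρ b), μ⟩ :=
  .of_step hi (by simp [step, Config.setReg, hv])

theorem reach_sub {d a b : ℕ} (hi : P[o]? = some (.sub d a b)) (hv : ρ a - ρ b < W) :
    Reach W P 1 ⟨o, ρ, μ⟩ ⟨o + 1, Function.update ρ d (ρ a - ρ b), μ⟩ :=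
  .of_step hi (by simp [step, Config.setReg, hv])

theorem reach_load {d a : ℕ} (hi : P[o]? = some (.load d a)) (hv : μ (ρ a) < W) :
    Reach W P 1 ⟨o, ρ, μ⟩ ⟨o + 1, Function.update ρ d (μ (ρ a)), μ⟩ :=
  .of_step hi (by simp [step, Config.setReg, hv])

theorem reach_store {a b : ℕ} (hi : P[o]? = some (.store a b)) :
    Reach W P 1 ⟨o, ρ, μ⟩ ⟨o + 1, ρ, Function.update μ (ρ a) (ρ b)⟩ :=
  .of_step hi rfl

theorem reach_jump {l : ℕ} (hi : P[o]? = some (.jump l)) :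
    Reach W P 1 ⟨o, ρ, μ⟩ ⟨l, ρ, μ⟩ :=
  .of_step hi rfl

theorem reach_jumpLT {a b l : ℕ} (hi : P[o]? = some (.jumpLT a b l)) :
    Reach W P 1 ⟨o, ρ, μ⟩ ⟨if ρ a < ρ b then l else o + 1, ρ, μ⟩ :=
  .of_step hi rfl

/-! ### A structured language and its compilation -/

/-- Arithmetic expressions over variables, sixteen unbounded arrays and the input. -/
inductive Exp where
  | const (v : ℕ)
  | var (x : ℕ)
  | add (e f : Exp)
  | sub (e f : Exp)
  | get (k : ℕ) (e : Exp)
  | inp (e : Exp)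

/-- Structured programs. -/
inductive Cmd where
  | skip
  | assign (x : ℕ) (e : Exp)
  | put (k : ℕ) (i e : Exp)
  | seq (c d : Cmd)
  | ite (e f : Exp) (c d : Cmd)
  | loop (e f : Exp) (c : Cmd)

/-- The values of the variables and arrays, and the time spent so far. -/
structure St where
  r : ℕ → ℕ
  a : ℕ → ℕ → ℕ
  time : ℕ

/-- The input, its length, and a strict bound on all values. -/
structure Env where
  inp : ℕ → ℕ
  len : ℕ
  bound : ℕ

/-- The value of an expression. -/
def Exp.val (V : Env) (s : St) : Exp → ℕ
  | .const v => v
  | .var x => s.r x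
  | .add e f => e.val V s + f.val V s
  | .sub e f => e.val V s - f.val V s
  | .get k e => s.a k (e.val V s)
  | .inp e => V.inp (e.val V s)

/-- All intermediate values are below the bound, and the input is read within its length. -/
def Exp.Ok (V : Env) (s : St) : Exp → Prop
  | .const v => v < V.bound
  | .var _ => True
  | .add e f => e.Ok V s ∧ f.Ok V s ∧ e.val V s + f.val V s < V.bound
  | .sub e f => e.Ok V s ∧ f.Ok V s
  | .get _ e => e.Ok V s
  | .inp e => e.Ok V s ∧ e.val V s < V.len

/-- The cost of one elementary command. -/
def St.tick (s : St) : St := { s with time := s.time + 1 }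

/-- The state after an assignment to a variable. -/
def St.assign (s : St) (x v : ℕ) : St :=
  { s with r := Function.update s.r x v, time := s.time + 1 }

/-- The state after an assignment to an array cell. -/
def St.put (s : St) (k i v : ℕ) : St :=
  { s with a := Function.update s.a k (Function.update (s.a k) i v), time := s.time + 1 }

/-- Big-step semantics. -/
inductive Runs (V : Env) : Cmd → St → St → Prop
  | skip (s : St) : Runs V .skip s s
  | assign {s : St} {x : ℕ} {e : Exp} (h : e.Ok V s) :
      Runs V (.assign x e) s (s.assign x (e.val V s))
  | put {s : St} {k : ℕ} {i e : Exp} (hi : i.Ok V s) (he : e.Ok V s) :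
      Runs V (.put k i e) s (s.put k (i.val V s) (e.val V s))
  | seq {s s' s'' : St} {c d : Cmd} (hc : Runs V c s s') (hd : Runs V d s' s'') :
      Runs V (.seq c d) s s''
  | iteTrue {s s' : St} {e f : Exp} {c d : Cmd} (he : e.Ok V s) (hf : f.Ok V s)
      (h : e.val V s < f.val V s) (hc : Runs V c s.tick s') : Runs V (.ite e f c d) s s'
  | iteFalse {s s' : St} {e f : Exp} {c d : Cmd} (he : e.Ok V s) (hf : f.Ok V s)
      (h : ¬ e.val V s < f.val V s) (hd : Runs V d s.tick s') : Runs V (.ite e f c d) s s'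
  | loopTrue {s s' s'' : St} {e f : Exp} {c : Cmd} (he : e.Ok V s) (hf : f.Ok V s)
      (h : e.val V s < f.val V s) (hc : Runs V c s.tick s')
      (hl : Runs V (.loop e f c) s' s'') : Runs V (.loop e f c) s s''
  | loopFalse {s : St} {e f : Exp} {c : Cmd} (he : e.Ok V s) (hf : f.Ok V s)
      (h : ¬ e.val V s < f.val V s) : Runs V (.loop e f c) s s.tick

/-- The code that turns the index in register `2 * k + 2` into the address of the cell of the
array `b`. -/
def addrCode (b k : ℕ) : List Instr :=
  [.add (2 * k + 2) (2 * k + 2) (2 * k + 2), .add (2 * k + 2) (2 * k + 2) (2 * k + 2),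
    .add (2 * k + 2) (2 * k + 2) (2 * k + 2), .add (2 * k + 2) (2 * k + 2) (2 * k + 2),
    .const (2 * (k + 1) + 2) b, .add (2 * k + 2) (2 * k + 2) (2 * (k + 1) + 2),
    .add (2 * k + 2) (2 * k + 2) 0]

/-- The code that evaluates an expression into register `2 * k + 2`; the even registers above it
are scratch space, and the variables live in the odd registers. -/
def Exp.code : Exp → ℕ → List Instr
  | .const v, k => [.const (2 * k + 2) v]
  | .var x, k => [.copy (2 * k + 2) (2 * x + 1)]
  | .add e f, k =>
    e.code k ++ f.code (k + 1) ++ [.add (2 * k + 2) (2 * k + 2) (2 * (k + 1) + 2)]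
  | .sub e f, k =>
    e.code k ++ f.code (k + 1) ++ [.sub (2 * k + 2) (2 * k + 2) (2 * (k + 1) + 2)]
  | .get b e, k => e.code k ++ addrCode b k ++ [.load (2 * k + 2) (2 * k + 2)]
  | .inp e, k => e.code k ++ [.load (2 * k + 2) (2 * k + 2)]

/-- Only the arrays `0, …, 15` are mentioned. -/
def Exp.wf : Exp → Bool
  | .const _ => true
  | .var _ => true
  | .add e f => e.wf && f.wf
  | .sub e f => e.wf && f.wf
  | .get b e => decide (b < 16) && e.wf
  | .inp e => e.wf

/-- Only the arrays `0, …, 15` are mentioned. -/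
def Cmd.wf : Cmd → Bool
  | .skip => true
  | .assign _ e => e.wf
  | .put k i e => decide (k < 16) && i.wf && e.wf
  | .seq c d => c.wf && d.wf
  | .ite e f c d => e.wf && f.wf && c.wf && d.wf
  | .loop e f c => e.wf && f.wf && c.wf

/-- The code of a structured program, to be placed from line `o` on. -/
def Cmd.code : Cmd → ℕ → List Instr
  | .skip, _ => []
  | .assign x e, _ => e.code 0 ++ [.copy (2 * x + 1) 2]
  | .put k i e, _ => e.code 0 ++ i.code 1 ++ addrCode k 1 ++ [.store 4 2]
  | .seq c d, o => c.code o ++ d.code (o + (c.code o).length)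
  | .ite e f c d, o =>
    let t := e.code 0 ++ f.code 1
    let o' := o + t.length + 1
    let d' := d.code o'
    let c' := c.code (o' + d'.length + 1)
    (t ++ [.jumpLT 2 4 (o' + d'.length + 1)]) ++
      ((d' ++ [.jump (o' + d'.length + 1 + c'.length)]) ++ c')
  | .loop e f c, o =>
    let t := e.code 0 ++ f.code 1
    let o' := o + t.length + 2
    let c' := c.code o'
    (t ++ [.jumpLT 2 4 o']) ++ (.jump (o' + c'.length + 1) :: (c' ++ [.jump o]))

/-- The registers and the memory of the machine represent a state of a structured program. -/
structure Represents (V : Env) (ρ μ : ℕ → ℕ) (s : St) : Prop where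
  base : ρ 0 = V.len
  var : ∀ x, ρ (2 * x + 1) = s.r x
  inp : ∀ i < V.len, μ i = V.inp i
  arr : ∀ k < 16, ∀ i, μ (V.len + 16 * i + k) = s.a k i
  var_lt : ∀ x, s.r x < V.bound
  arr_lt : ∀ k < 16, ∀ i, s.a k i < V.bound
  inp_lt : ∀ i < V.len, V.inp i < V.bound

theorem Exp.val_lt {V : Env} {s : St} (h : Represents V ρ μ s) (e : Exp) (hw : e.wf = true)
    (he : e.Ok V s) : e.val V s < V.bound := by
  induction e with
  | const v => exact he
  | var x => exact h.var_lt x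
  | add e f ihe ihf => exact he.2.2
  | sub e f ihe ihf =>
    simp only [Exp.wf, Bool.and_eq_true] at hw
    have := ihe hw.1 he.1
    simp only [Exp.val]
    omega
  | get k e ih =>
    simp only [Exp.wf, Bool.and_eq_true, decide_eq_true_eq] at hw
    exact h.arr_lt k hw.1 _
  | inp e ih => exact h.inp_lt _ he.2

/-- The sixteen arrays are interleaved behind the input: cell `i` of array `b` has address `V.len +
16 * i + b`. Four doublings replace the missing multiplication, and register `0` holds the base
`V.len`. -/
theorem reach_addrCode {V : Env} {b k : ℕ} (hb : b < 16) (hW : V.len + 16 * V.bound + 16 ≤ W)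
    (hP : CodeAt P o (addrCode b k)) (h0 : ρ 0 = V.len) (hk : ρ (2 * k + 2) < V.bound) :
    ∃ ρ', Reach W P (addrCode b k).length ⟨o, ρ, μ⟩ ⟨o + (addrCode b k).length, ρ', μ⟩ ∧
      ρ' (2 * k + 2) = V.len + 16 * ρ (2 * k + 2) + b ∧
      ∀ y, (y % 2 = 1 ∨ y < 2 * k + 2) → ρ' y = ρ y := by
  simp only [addrCode, codeAt_cons] at hP
  obtain ⟨h1, h2, h3, h4, h5, h6, h7, -⟩ := hP
  have hne : (2 * (k + 1) + 2) ≠ 2 * k + 2 := by omega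
  refine ⟨_, ((reach_add h1 ?_).trans <| (reach_add h2 ?_).trans <| (reach_add h3 ?_).trans <|
    (reach_add h4 ?_).trans <| (reach_const h5 ?_).trans <| (reach_add h6 ?_).trans <|
    (reach_add h7 ?_)).cast rfl rfl rfl, ?_, ?_⟩
  · omega
  · simp only [Function.update_self]; omega
  · simp only [Function.update_self]; omega
  · simp only [Function.update_self]; omega
  · omega
  · simp; omega
  · simp [h0]; omega
  · simp [h0]; omega
  · intro y hy
    have e1 : y ≠ 2 * k + 2 := by omega
    have e2 : y ≠ 2 * (k + 1) + 2 := by omega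
    simp [e1, e2]

/-- The even registers serve as an evaluation stack. The last clause of the conclusion lets the
induction go through: evaluating a second operand at depth `k + 1` preserves the first one, kept at
depth `k`, and all variables. -/
theorem Exp.reach_code {V : Env} {s : St} (hW : V.len + 16 * V.bound + 16 ≤ W) (e : Exp)
    (hw : e.wf = true) (he : e.Ok V s) : ∀ {k o : ℕ} {ρ : ℕ → ℕ}, CodeAt P o (e.code k) →
    Represents V ρ μ s →
    ∃ ρ', Reach W P (e.code k).length ⟨o, ρ, μ⟩ ⟨o + (e.code k).length, ρ', μ⟩ ∧
      ρ' (2 * k + 2) = e.val V s ∧ Represents V ρ' μ s ∧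
      ∀ y, (y % 2 = 1 ∨ y < 2 * k + 2) → ρ' y = ρ y := by
  have key : ∀ {k : ℕ} {ρ ρ' : ℕ → ℕ}, Represents V ρ μ s →
      (∀ y, (y % 2 = 1 ∨ y < 2 * k + 2) → ρ' y = ρ y) → Represents V ρ' μ s := by
    intro k ρ ρ' h hy
    refine ⟨?_, fun x => ?_, h.inp, h.arr, h.var_lt, h.arr_lt, h.inp_lt⟩
    · rw [hy 0 (by omega), h.base]
    · rw [hy _ (by omega), h.var]
  have upd : ∀ {k v : ℕ} {ρ : ℕ → ℕ},
      (∀ y, (y % 2 = 1 ∨ y < 2 * k + 2) → Function.update ρ (2 * k + 2) v y = ρ y) := by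
    intro k v ρ y hy
    rw [Function.update_of_ne (by omega)]
  induction e with
  | const v =>
    intro k o ρ hP h
    simp only [Exp.code, codeAt_cons] at hP
    simp only [Exp.Ok] at he
    refine ⟨_, reach_const hP.1 (by omega), by simp [Exp.val], key h upd, upd⟩
  | var x =>
    intro k o ρ hP h
    simp only [Exp.code, codeAt_cons] at hP
    have := h.var_lt x
    refine ⟨_, reach_copy hP.1 (by rw [h.var]; omega), by simp [Exp.val, h.var], key h upd, upd⟩
  | add e f ihe ihf =>
    intro k o ρ hP h
    simp only [Exp.wf, Bool.and_eq_true] at hw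
    simp only [Exp.code, codeAt_append, codeAt_cons] at hP
    obtain ⟨ρ₁, hr₁, hv₁, h₁, hy₁⟩ := ihe hw.1 he.1 hP.1.1 h
    obtain ⟨ρ₂, hr₂, hv₂, h₂, hy₂⟩ := ihf hw.2 he.2.1 hP.1.2 h₁
    rw [List.length_append, ← add_assoc] at hP
    have hv₁' : ρ₂ (2 * k + 2) = e.val V s := by rw [hy₂ _ (by omega), hv₁]
    refine ⟨Function.update ρ₂ (2 * k + 2) (ρ₂ (2 * k + 2) + ρ₂ (2 * (k + 1) + 2)),
      ((hr₁.trans hr₂).trans (reach_add hP.2.1 ?_)).cast ?_ rfl ?_, ?_, key h₂ upd, ?_⟩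
    · have := he.2.2
      rw [hv₁', hv₂]
      omega
    · simp [Exp.code, add_assoc]
    · simp [Exp.code, add_assoc]
    · simp [Exp.val, hv₁', hv₂]
    · intro y hy
      rw [upd y hy, hy₂ y (by omega), hy₁ y hy]
  | sub e f ihe ihf =>
    intro k o ρ hP h
    simp only [Exp.wf, Bool.and_eq_true] at hw
    simp only [Exp.code, codeAt_append, codeAt_cons] at hP
    obtain ⟨ρ₁, hr₁, hv₁, h₁, hy₁⟩ := ihe hw.1 he.1 hP.1.1 h
    obtain ⟨ρ₂, hr₂, hv₂, h₂, hy₂⟩ := ihf hw.2 he.2 hP.1.2 h₁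
    rw [List.length_append, ← add_assoc] at hP
    have hv₁' : ρ₂ (2 * k + 2) = e.val V s := by rw [hy₂ _ (by omega), hv₁]
    refine ⟨Function.update ρ₂ (2 * k + 2) (ρ₂ (2 * k + 2) - ρ₂ (2 * (k + 1) + 2)),
      ((hr₁.trans hr₂).trans (reach_sub hP.2.1 ?_)).cast ?_ rfl ?_, ?_, key h₂ upd, ?_⟩
    · have := e.val_lt h hw.1 he.1
      rw [hv₁', hv₂]
      omega
    · simp [Exp.code, add_assoc]
    · simp [Exp.code, add_assoc]
    · simp [Exp.val, hv₁', hv₂]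
    · intro y hy
      rw [upd y hy, hy₂ y (by omega), hy₁ y hy]
  | get b e ih =>
    intro k o ρ hP h
    simp only [Exp.wf, Bool.and_eq_true, decide_eq_true_eq] at hw
    simp only [Exp.code, codeAt_append, codeAt_cons] at hP
    obtain ⟨ρ₁, hr₁, hv₁, h₁, hy₁⟩ := ih hw.2 he hP.1.1 h
    obtain ⟨ρ₂, hr₂, hv₂, hy₂⟩ := reach_addrCode (μ := μ) hw.1 hW hP.1.2 h₁.base
      (by rw [hv₁]; exact e.val_lt h hw.2 he)
    rw [List.length_append, ← add_assoc] at hP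
    have hμ : μ (ρ₂ (2 * k + 2)) = s.a b (e.val V s) := by
      rw [hv₂, h.arr b hw.1, hv₁]
    refine ⟨Function.update ρ₂ (2 * k + 2) (μ (ρ₂ (2 * k + 2))),
      ((hr₁.trans hr₂).trans (reach_load hP.2.1 ?_)).cast ?_ rfl ?_, ?_, ?_, ?_⟩
    · have := h.arr_lt b hw.1 (e.val V s)
      rw [hμ]
      omega
    · simp [Exp.code, add_assoc]
    · simp [Exp.code, add_assoc]
    · simp [Exp.val, hμ]
    · exact key (key h₁ hy₂) upd
    · intro y hy
      rw [upd y hy, hy₂ y hy, hy₁ y hy]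
  | inp e ih =>
    intro k o ρ hP h
    simp only [Exp.wf] at hw
    simp only [Exp.code, codeAt_append, codeAt_cons] at hP
    obtain ⟨ρ₁, hr₁, hv₁, h₁, hy₁⟩ := ih hw he.1 hP.1 h
    have hμ : μ (ρ₁ (2 * k + 2)) = V.inp (e.val V s) := by
      rw [hv₁, h.inp _ he.2]
    refine ⟨Function.update ρ₁ (2 * k + 2) (μ (ρ₁ (2 * k + 2))),
      (hr₁.trans (reach_load hP.2.1 ?_)).cast ?_ rfl ?_, ?_, ?_, ?_⟩
    · have := h.inp_lt (e.val V s) he.2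
      rw [hμ]
      omega
    · simp [Exp.code]
    · simp [Exp.code, add_assoc]
    · simp [Exp.val, hμ]
    · exact key h₁ upd
    · intro y hy
      rw [upd y hy, hy₁ y hy]

theorem Represents.assign {V : Env} {s : St} {x v : ℕ} (h : Represents V ρ μ s)
    (hv : v < V.bound) : Represents V (Function.update ρ (2 * x + 1) v) μ (s.assign x v) := by
  refine ⟨?_, fun y => ?_, h.inp, h.arr, fun y => ?_, h.arr_lt, h.inp_lt⟩
  · rw [Function.update_of_ne (by omega), h.base]
  · simp only [St.assign, Function.update_apply, h.var]
    grind
  · simp only [St.assign, Function.update_apply]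
    split_ifs
    · exact hv
    · exact h.var_lt y

/-- Addresses of distinct cells of the arrays `0, …, 15` differ because the residue modulo `16` of
the offset identifies the array; all of them lie beyond the input. -/
theorem Represents.put {V : Env} {s : St} {b i v : ℕ} (h : Represents V ρ μ s) (hb : b < 16)
    (hv : v < V.bound) :
    Represents V ρ (Function.update μ (V.len + 16 * i + b) v) (s.put b i v) := by
  refine ⟨h.base, h.var, fun j hj => ?_, fun d hd j => ?_, h.var_lt, fun d hd j => ?_, h.inp_lt⟩
  · rw [Function.update_of_ne (by omega), h.inp j hj]
  · have := h.arr d hd j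
    by_cases hdb : d = b
    · subst hdb
      by_cases hij : j = i
      · subst hij
        simp [St.put]
      · rw [Function.update_of_ne (by omega), this]
        simp [St.put, hij]
    · rw [Function.update_of_ne (by omega), this]
      simp [St.put, hdb]
  · simp only [St.put, Function.update_apply]
    split_ifs
    · simp only [Function.update_apply]
      split_ifs
      · exact hv
      · exact h.arr_lt b hb j
    · exact h.arr_lt d hd j

theorem reach_test {V : Env} {s : St} {e f : Exp} (hW : V.len + 16 * V.bound + 16 ≤ W)
    (hwe : e.wf = true) (hwf : f.wf = true) (he : e.Ok V s) (hf : f.Ok V s) {l : ℕ}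
    (hP : CodeAt P o (e.code 0 ++ f.code 1 ++ [.jumpLT 2 4 l])) (h : Represents V ρ μ s) :
    ∃ ρ', Reach W P ((e.code 0 ++ f.code 1).length + 1) ⟨o, ρ, μ⟩
      ⟨if e.val V s < f.val V s then l else o + (e.code 0 ++ f.code 1).length + 1, ρ', μ⟩ ∧
      Represents V ρ' μ s.tick := by
  simp only [codeAt_append, codeAt_cons] at hP
  obtain ⟨ρ₁, hr₁, hv₁, h₁, hy₁⟩ := e.reach_code hW hwe he hP.1.1 h
  obtain ⟨ρ₂, hr₂, hv₂, h₂, hy₂⟩ := f.reach_code hW hwf hf hP.1.2 h₁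
  have hj := reach_jumpLT (W := W) (ρ := ρ₂) (μ := μ) hP.2.1
  rw [show ρ₂ 2 = e.val V s by rw [hy₂ 2 (by omega)]; exact hv₁,
    show ρ₂ 4 = f.val V s from hv₂] at hj
  exact ⟨ρ₂, ((hr₁.trans hr₂).trans (hj.cast rfl (by simp [add_assoc]) rfl)).cast
    (by simp) rfl rfl, ⟨h₂.1, h₂.2, h₂.3, h₂.4, h₂.5, h₂.6, h₂.7⟩⟩

/-- One unit of structured time pays for `K` machine steps, where `K` bounds the length of the whole
code. Every test or assignment executes a straight piece of that code, together with at most the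
jumps belonging to it, so it costs at most `K`; sequencing and `skip` are free on both sides.
Keeping `K` fixed while passing to subprograms makes the estimates add up. -/
theorem Runs.reach {V : Env} (hW : V.len + 16 * V.bound + 16 ≤ W) {c : Cmd} {s s' : St}
    (hr : Runs V c s s') (K : ℕ) : ∀ {o : ℕ} {ρ μ : ℕ → ℕ}, c.wf = true →
    (c.code o).length ≤ K → CodeAt P o (c.code o) → Represents V ρ μ s →
    ∃ ρ' μ' k, Reach W P k ⟨o, ρ, μ⟩ ⟨o + (c.code o).length, ρ', μ'⟩ ∧
      k + K * s.time ≤ K * s'.time ∧ Represents V ρ' μ' s' := by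
  induction hr with
  | skip s =>
    intro o ρ μ hw hK hP h
    exact ⟨ρ, μ, 0, Reach.refl _, by simp, h⟩
  | @assign s x e he =>
    intro o ρ μ hw hK hP h
    simp only [Cmd.code, codeAt_append, codeAt_cons] at hP
    obtain ⟨ρ₁, hr₁, hv₁, h₁, hy₁⟩ := e.reach_code hW hw he hP.1 h
    have hb := e.val_lt h hw he
    refine ⟨Function.update ρ₁ (2 * x + 1) (ρ₁ 2), μ, _,
      (hr₁.trans (reach_copy hP.2.1 ?_)).cast rfl rfl ?_, ?_, ?_⟩
    · rw [show ρ₁ 2 = e.val V s from hv₁]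
      omega
    · simp [Cmd.code, add_assoc]
    · simp only [Cmd.code, List.length_append, List.length_singleton] at hK
      simp only [St.assign]
      rw [mul_add]
      omega
    · rw [show ρ₁ 2 = e.val V s from hv₁]
      exact h₁.assign hb
  | @put s b i e hi he =>
    intro o ρ μ hw hK hP h
    simp only [Cmd.wf, Bool.and_eq_true, decide_eq_true_eq] at hw
    simp only [Cmd.code, codeAt_append, codeAt_cons] at hP
    obtain ⟨ρ₁, hr₁, hv₁, h₁, hy₁⟩ := e.reach_code hW hw.2 he hP.1.1.1 h
    obtain ⟨ρ₂, hr₂, hv₂, h₂, hy₂⟩ := i.reach_code hW hw.1.2 hi hP.1.1.2 h₁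
    have hbi := i.val_lt h hw.1.2 hi
    have hbe := e.val_lt h hw.2 he
    have hP3 := hP.1.2
    rw [List.length_append, ← add_assoc] at hP3
    obtain ⟨ρ₃, hr₃, hv₃, hy₃⟩ := reach_addrCode (μ := μ) hw.1.1 hW hP3 h₂.base
      (by rw [hv₂]; exact hbi)
    have hP4 := hP.2.1
    rw [List.length_append, List.length_append, ← add_assoc, ← add_assoc] at hP4
    have h4 : ρ₃ 4 = V.len + 16 * i.val V s + b := by rw [← hv₂]; exact hv₃
    have h2 : ρ₃ 2 = e.val V s := by rw [hy₃ 2 (by omega), hy₂ 2 (by omega)]; exact hv₁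
    have hstore := reach_store (W := W) (ρ := ρ₃) (μ := μ) hP4
    rw [h4, h2] at hstore
    refine ⟨ρ₃, Function.update μ (V.len + 16 * i.val V s + b) (e.val V s), _,
      (((hr₁.trans hr₂).trans hr₃).trans hstore).cast rfl rfl ?_, ?_, ?_⟩
    · simp [Cmd.code, add_assoc]
    · simp only [Cmd.code, List.length_append, List.length_singleton] at hK
      simp only [St.put]
      rw [mul_add]
      omega
    · have h₃ : Represents V ρ₃ μ s := by
        refine ⟨?_, fun x => ?_, h.inp, h.arr, h.var_lt, h.arr_lt, h.inp_lt⟩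
        · rw [hy₃ 0 (by omega), h₂.base]
        · rw [hy₃ _ (by omega), h₂.var]
      exact h₃.put hw.1.1 hbe
  | @seq s s₁ s₂ c d hc hd ihc ihd =>
    intro o ρ μ hw hK hP h
    simp only [Cmd.wf, Bool.and_eq_true] at hw
    simp only [Cmd.code, codeAt_append] at hP
    simp only [Cmd.code, List.length_append] at hK
    obtain ⟨ρ₁, μ₁, k₁, hr₁, hk₁, h₁⟩ := ihc hw.1 (by omega) hP.1 h
    obtain ⟨ρ₂, μ₂, k₂, hr₂, hk₂, h₂⟩ := ihd hw.2 (by omega) hP.2 h₁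
    refine ⟨ρ₂, μ₂, k₁ + k₂, (hr₁.trans hr₂).cast rfl rfl ?_, by omega, h₂⟩
    simp [Cmd.code, add_assoc]
  | @iteTrue s s₁ e f c d he hf hlt hc ih =>
    intro o ρ μ hw hK hP h
    simp only [Cmd.wf, Bool.and_eq_true] at hw
    simp only [Cmd.code] at hP
    obtain ⟨hPt, hP⟩ := codeAt_append.1 hP
    rw [codeAt_append, codeAt_append] at hP
    obtain ⟨⟨hPd, hPj⟩, hPc⟩ := hP
    obtain ⟨ρ₁, hr₁, h₁⟩ := reach_test hW hw.1.1.1 hw.1.1.2 he hf hPt h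
    rw [if_pos hlt] at hr₁
    simp only [Cmd.code, List.length_append, List.length_singleton] at hK
    obtain ⟨ρ₂, μ₂, k₂, hr₂, hk₂, h₂⟩ := ih hw.1.2 (o := o + (e.code 0 ++ f.code 1).length + 1 +
      (d.code (o + (e.code 0 ++ f.code 1).length + 1)).length + 1)
      (by simp only [List.length_append]; omega)
      (by simpa [add_assoc] using hPc) h₁
    refine ⟨ρ₂, μ₂, _, (hr₁.trans hr₂).cast rfl rfl ?_, ?_, h₂⟩
    · simp [Cmd.code, add_assoc]
      omega
    · simp only [St.tick, mul_add, List.length_append] at hk₂ ⊢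
      omega
  | @iteFalse s s₁ e f c d he hf hlt hc ih =>
    intro o ρ μ hw hK hP h
    simp only [Cmd.wf, Bool.and_eq_true] at hw
    simp only [Cmd.code] at hP
    obtain ⟨hPt, hP⟩ := codeAt_append.1 hP
    rw [codeAt_append, codeAt_append, codeAt_cons] at hP
    obtain ⟨⟨hPd, hPj, -⟩, hPc⟩ := hP
    obtain ⟨ρ₁, hr₁, h₁⟩ := reach_test hW hw.1.1.1 hw.1.1.2 he hf hPt h
    rw [if_neg hlt] at hr₁
    simp only [Cmd.code, List.length_append, List.length_singleton] at hK
    obtain ⟨ρ₂, μ₂, k₂, hr₂, hk₂, h₂⟩ := ih hw.2 (o := o + (e.code 0 ++ f.code 1).length + 1)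
      (by simp only [List.length_append]; omega)
      (by simpa [add_assoc] using hPd) h₁
    have hj := reach_jump (W := W) (ρ := ρ₂) (μ := μ₂) hPj
    refine ⟨ρ₂, μ₂, _, ((hr₁.trans hr₂).trans (hj.cast rfl ?_ rfl)).cast rfl rfl ?_, ?_, h₂⟩
    · simp [add_assoc]
    · simp [Cmd.code, add_assoc]
      omega
    · simp only [St.tick, mul_add, List.length_append] at hk₂ ⊢
      omega
  | @loopTrue s s₁ s₂ e f c he hf hlt hc hl ihc ihl =>
    intro o ρ μ hw hK hP h
    have hP₀ := hP
    have hK₀ := hK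
    have hw₀ := hw
    simp only [Cmd.wf, Bool.and_eq_true] at hw
    simp only [Cmd.code] at hP
    obtain ⟨hPt, hP⟩ := codeAt_append.1 hP
    rw [codeAt_cons, codeAt_append, codeAt_cons] at hP
    obtain ⟨hPj, hPc, hPb, -⟩ := hP
    obtain ⟨ρ₁, hr₁, h₁⟩ := reach_test hW hw.1.1 hw.1.2 he hf hPt h
    rw [if_pos hlt] at hr₁
    simp only [Cmd.code, List.length_append, List.length_cons, List.length_nil] at hK
    obtain ⟨ρ₂, μ₂, k₂, hr₂, hk₂, h₂⟩ := ihc hw.2 (o := o + (e.code 0 ++ f.code 1).length + 2)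
      (by simp only [List.length_append]; omega)
      (by simpa [add_assoc] using hPc) h₁
    have hj := reach_jump (W := W) (ρ := ρ₂) (μ := μ₂) hPb
    obtain ⟨ρ₃, μ₃, k₃, hr₃, hk₃, h₃⟩ := ihl hw₀ hK₀ hP₀ h₂
    refine ⟨ρ₃, μ₃, _, ((hr₁.trans hr₂).trans (hj.cast rfl ?_ rfl)).trans hr₃, ?_, h₃⟩
    · simp [add_assoc]
    · simp only [St.tick, mul_add, List.length_append] at hk₂ hk₃ ⊢
      omega
  | @loopFalse s e f c he hf hlt =>
    intro o ρ μ hw hK hP h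
    simp only [Cmd.wf, Bool.and_eq_true] at hw
    simp only [Cmd.code] at hP
    obtain ⟨hPt, hP⟩ := codeAt_append.1 hP
    rw [codeAt_cons, codeAt_append, codeAt_cons] at hP
    obtain ⟨hPj, hPc, hPb, -⟩ := hP
    obtain ⟨ρ₁, hr₁, h₁⟩ := reach_test hW hw.1.1 hw.1.2 he hf hPt h
    rw [if_neg hlt] at hr₁
    simp only [Cmd.code, List.length_append, List.length_cons, List.length_nil] at hK
    have hj := reach_jump (W := W) (ρ := ρ₁) (μ := μ) hPj
    refine ⟨ρ₁, μ, _, (hr₁.trans (hj.cast rfl ?_ rfl)).cast rfl rfl ?_, ?_, h₁⟩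
    · simp [add_assoc]
    · simp [Cmd.code, add_assoc]
      omega
    · simp only [St.tick, mul_add, List.length_append]
      omega

/-- The complete machine program: find the end of the input, run `c`, and accept if the variable
`x` is positive. -/
def Cmd.program (c : Cmd) (x : ℕ) : Program :=
  [.load 0 0, .const 2 1, .add 0 0 2, .load 0 0] ++ (c.code 4 ++
    [.const 2 0, .jumpLT 2 (2 * x + 1) (4 + (c.code 4).length + 3), .halt false, .halt true])

theorem exec_mono {t t' : ℕ} {s : Config} {b : Bool} (h : exec W P t s = some b) (ht : t ≤ t') :
    exec W P t' s = some b := by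
  induction t generalizing t' s with
  | zero => simp [exec] at h
  | succ t ih =>
    obtain ⟨t', rfl⟩ : ∃ u, t' = u + 1 := ⟨t' - 1, by omega⟩
    rw [exec] at h ⊢
    cases hi : P[s.pc]? with
    | none => simp [hi] at h
    | some i =>
      rw [hi] at h
      cases i with
      | halt a => exact h
      | _ =>
        simp only [Option.bind_eq_some_iff] at h ⊢
        obtain ⟨s', hs', h⟩ := h
        exact ⟨s', hs', ih h (by omega)⟩

theorem Cmd.exec_program {V : Env} (hW : V.len + 16 * V.bound + 16 ≤ W) {c : Cmd} {x : ℕ}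
    (hw : c.wf = true) {input : List ℕ} (hlen : V.len = input.length)
    (hinp : ∀ i, V.inp i = input.getD i 0) (hlt : ∀ i, V.inp i < V.bound)
    (hB : 0 < V.bound) (hend : V.inp (V.inp 0 + 1) = V.len) {s : St}
    (hr : Runs V c ⟨fun _ => 0, fun _ _ => 0, 0⟩ s) :
    exec W (c.program x) ((c.code 4).length * s.time + 7) (init input) =
      some (decide (0 < s.r x)) := by
  have hP : CodeAt (c.program x) 0 (c.program x) := by
    intro i hi
    simp
  conv at hP => arg 3; rw [Cmd.program]
  obtain ⟨hP₁, hP₂⟩ := codeAt_append.1 hP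
  rw [codeAt_append] at hP₂
  obtain ⟨hPc, hP₂⟩ := hP₂
  simp only [codeAt_cons] at hP₁ hP₂
  obtain ⟨h1, h2, h3, h4, -⟩ := hP₁
  obtain ⟨h5, h6, h7, h8, -⟩ := hP₂
  set μ : ℕ → ℕ := fun i => input.getD i 0 with hμ
  have hμV : ∀ i, μ i = V.inp i := fun i => (hinp i).symm
  have h0 : V.inp 0 < V.bound := hlt 0
  -- In the prologue cell `0` gives $n$, and cell $n+1$ gives the end of the last list, which is the
  -- input length; it becomes the base address in register `0`.
  have r1 := reach_load (W := W) (ρ := fun _ => 0) (μ := μ) h1 (by rw [hμV]; omega)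
  have r2 := r1.trans (reach_const h2 (by omega))
  have r3 := r2.trans (reach_add h3 (by simp [hμV]; omega))
  have r4 := r3.trans (reach_load h4 (by simp [hμV, hend]; omega))
  obtain ⟨ρ', μ', k, hk, ht, hR⟩ := hr.reach hW (c.code 4).length hw le_rfl hPc
    (ρ := Function.update (Function.update (Function.update (Function.update (fun _ => 0) 0
      (V.inp 0)) 2 1) 0 (V.inp 0 + 1)) 0 V.len) (μ := μ) (by
      refine ⟨?_, fun y => ?_, fun i _ => hμV i, fun b hb i => ?_, fun y => hB, fun b hb i => hB,
        fun i _ => hlt i⟩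
      · simp
      · have e1 : 2 * y + 1 ≠ 2 := by omega
        simp [e1]
      · simp only [hμ]
        rw [List.getD_eq_default]
        omega)
  have r5 := (r4.cast rfl rfl (by simp [hμV, hend])).trans hk
  have r6 := r5.trans ((reach_const (ρ := ρ') (μ := μ') h5 (by omega)).cast rfl (by simp) rfl)
  have r7 := r6.trans (reach_jumpLT h6)
  have hx : Function.update ρ' 2 0 (2 * x + 1) = s.r x := by
    rw [Function.update_of_ne (by omega), hR.var]
  rw [hx, Function.update_self] at r7
  refine exec_mono (t := 0 + 1 + 1 + 1 + 1 + k + 1 + 1 + 1) ?_ ?_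
  · refine (r7 1).trans ?_
    split_ifs with hs
    · rw [exec]
      simp only [List.length_cons, List.length_nil] at h8
      simp [show (c.program x)[4 + (c.code 4).length + 3]? = _ from by simpa using h8, hs]
    · rw [exec]
      simp [show (c.program x)[4 + (c.code 4).length + 1 + 1]? = _ from by simpa using h7, hs]
  · simp at ht
    omega

end

/-! ### Weakest preconditions, frames and loop rules -/

section

/-- The variables that a structured program may change. -/
def Cmd.regs : Cmd → List ℕ
  | .skip => []
  | .assign x _ => [x]
  | .put _ _ _ => []
  | .seq c d => c.regs ++ d.regs
  | .ite _ _ c d => c.regs ++ d.regs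
  | .loop _ _ c => c.regs

/-- The arrays that a structured program may change. -/
def Cmd.arrs : Cmd → List ℕ
  | .skip => []
  | .assign _ _ => []
  | .put k _ _ => [k]
  | .seq c d => c.arrs ++ d.arrs
  | .ite _ _ c d => c.arrs ++ d.arrs
  | .loop _ _ c => c.arrs

/-- The states `s` and `t` differ at most in the variables and arrays that `c` may change. -/
structure Frame (c : Cmd) (s t : St) : Prop where
  reg : ∀ x, x ∉ c.regs → t.r x = s.r x
  arr : ∀ k, k ∉ c.arrs → t.a k = s.a k

theorem Frame.trans {c d e : Cmd} {s t u : St} (h : Frame c s t) (h' : Frame d t u)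
    (hr : ∀ x, x ∈ c.regs ∨ x ∈ d.regs → x ∈ e.regs)
    (ha : ∀ k, k ∈ c.arrs ∨ k ∈ d.arrs → k ∈ e.arrs) : Frame e s u := by
  refine ⟨fun x hx => ?_, fun k hk => ?_⟩
  · rw [h'.reg x (fun h => hx (hr x (.inr h))), h.reg x (fun h => hx (hr x (.inl h)))]
  · rw [h'.arr k (fun h => hk (ha k (.inr h))), h.arr k (fun h => hk (ha k (.inl h)))]

/-- The set of variables and arrays that may be written is syntactic, hence computable.
Specifications therefore need not mention what stays unchanged; it is recovered by `decide`. -/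
theorem Runs.frame {V : Env} {c : Cmd} {s t : St} (h : Runs V c s t) : Frame c s t := by
  induction h with
  | skip s => exact ⟨fun _ _ => rfl, fun _ _ => rfl⟩
  | assign h =>
    refine ⟨fun x hx => ?_, fun _ _ => rfl⟩
    simp only [Cmd.regs, List.mem_singleton] at hx
    simp [St.assign, hx]
  | put hi he =>
    refine ⟨fun _ _ => rfl, fun k hk => ?_⟩
    simp only [Cmd.arrs, List.mem_singleton] at hk
    simp [St.put, hk]
  | seq hc hd ihc ihd =>
    exact ihc.trans ihd (fun x hx => by simpa [Cmd.regs] using hx)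
      (fun x hx => by simpa [Cmd.arrs] using hx)
  | iteTrue he hf h hc ih =>
    refine ⟨fun x hx => ih.reg x ?_, fun k hk => ih.arr k ?_⟩
    · simp [Cmd.regs] at hx
      exact hx.1
    · simp [Cmd.arrs] at hk
      exact hk.1
  | iteFalse he hf h hc ih =>
    refine ⟨fun x hx => ih.reg x ?_, fun k hk => ih.arr k ?_⟩
    · simp [Cmd.regs] at hx
      exact hx.2
    · simp [Cmd.arrs] at hk
      exact hk.2
  | loopTrue he hf h hc hl ihc ihl =>
    refine ⟨fun x hx => ?_, fun k hk => ?_⟩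
    · rw [ihl.reg x hx]
      exact ihc.reg x hx
    · rw [ihl.arr k hk]
      exact ihc.arr k hk
  | loopFalse he hf h => exact ⟨fun _ _ => rfl, fun _ _ => rfl⟩

/-- Started in `s`, the program `c` halts in a state with the property `Q`. -/
def wp (V : Env) (c : Cmd) (Q : St → Prop) (s : St) : Prop :=
  ∃ t, Runs V c s t ∧ Q t

variable {V : Env} {Q R : St → Prop} {s : St} {c d : Cmd} {e f : Exp}

theorem wp.mono (h : wp V c Q s) (hQ : ∀ t, Frame c s t → Q t → R t) : wp V c R s := by
  obtain ⟨t, ht, hq⟩ := h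
  exact ⟨t, ht, hQ t ht.frame hq⟩

theorem wp_skip : wp V .skip Q s ↔ Q s := by
  constructor
  · rintro ⟨t, ht, hq⟩
    cases ht
    exact hq
  · exact fun h => ⟨s, .skip s, h⟩

theorem wp_assign {x : ℕ} :
    wp V (.assign x e) Q s ↔ e.Ok V s ∧ Q (s.assign x (e.val V s)) := by
  constructor
  · rintro ⟨t, ht, hq⟩
    cases ht with
    | assign h => exact ⟨h, hq⟩
  · exact fun h => ⟨_, .assign h.1, h.2⟩

theorem wp_put {k : ℕ} :
    wp V (.put k e f) Q s ↔ e.Ok V s ∧ f.Ok V s ∧ Q (s.put k (e.val V s) (f.val V s)) := by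
  constructor
  · rintro ⟨t, ht, hq⟩
    cases ht with
    | put h h' => exact ⟨h, h', hq⟩
  · exact fun h => ⟨_, .put h.1 h.2.1, h.2.2⟩

theorem wp_seq : wp V (.seq c d) Q s ↔ wp V c (fun t => wp V d Q t) s := by
  constructor
  · rintro ⟨t, ht, hq⟩
    cases ht with
    | seq hc hd => exact ⟨_, hc, _, hd, hq⟩
  · rintro ⟨t, ht, u, hu, hq⟩
    exact ⟨u, .seq ht hu, hq⟩

theorem wp_ite : wp V (.ite e f c d) Q s ↔ e.Ok V s ∧ f.Ok V s ∧
    (e.val V s < f.val V s → wp V c Q s.tick) ∧ (¬ e.val V s < f.val V s → wp V d Q s.tick) := by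
  constructor
  · rintro ⟨t, ht, hq⟩
    cases ht with
    | iteTrue he hf h hc => exact ⟨he, hf, fun _ => ⟨t, hc, hq⟩, fun h' => absurd h h'⟩
    | iteFalse he hf h hc => exact ⟨he, hf, fun h' => absurd h' h, fun _ => ⟨t, hc, hq⟩⟩
  · rintro ⟨he, hf, h₁, h₂⟩
    by_cases h : e.val V s < f.val V s
    · obtain ⟨t, ht, hq⟩ := h₁ h
      exact ⟨t, .iteTrue he hf h ht, hq⟩
    · obtain ⟨t, ht, hq⟩ := h₂ h
      exact ⟨t, .iteFalse he hf h ht, hq⟩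

/-- The rule for loops: `I` is an invariant, and the measure `μ` decreases. -/
theorem wp_loop (I : St → Prop) (μ : St → ℕ) (h₀ : I s)
    (hok : ∀ t, Frame (.loop e f c) s t → I t → e.Ok V t ∧ f.Ok V t)
    (hstep : ∀ t, Frame (.loop e f c) s t → I t → e.val V t < f.val V t →
      wp V c (fun u => I u ∧ μ u < μ t) t.tick)
    (hpost : ∀ t, Frame (.loop e f c) s t → I t → ¬ e.val V t < f.val V t → Q t.tick) :
    wp V (.loop e f c) Q s := by
  suffices H : ∀ m t, μ t ≤ m → Frame (.loop e f c) s t → I t → wp V (.loop e f c) Q t from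
    H _ s le_rfl ⟨fun _ _ => rfl, fun _ _ => rfl⟩ h₀
  intro m
  induction m with
  | zero =>
    intro t hm hF hI
    obtain ⟨he, hf⟩ := hok t hF hI
    by_cases h : e.val V t < f.val V t
    · obtain ⟨u, -, -, hu⟩ := hstep t hF hI h
      omega
    · exact ⟨_, .loopFalse he hf h, hpost t hF hI h⟩
  | succ m ih =>
    intro t hm hF hI
    obtain ⟨he, hf⟩ := hok t hF hI
    by_cases h : e.val V t < f.val V t
    · obtain ⟨u, hu, hIu, hμ⟩ := hstep t hF hI h
      have hFu : Frame (.loop e f c) s u :=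
        ⟨fun x hx => (hu.frame.reg x hx).trans (hF.reg x hx),
          fun k hk => (hu.frame.arr k hk).trans (hF.arr k hk)⟩
      obtain ⟨v, hv, hq⟩ := ih u (by omega) hFu hIu
      exact ⟨v, .loopTrue he hf h hu hv, hq⟩
    · exact ⟨_, .loopFalse he hf h, hpost t hF hI h⟩

/-- `for x := 0, …, e - 1 do c`. -/
def Cmd.for (x : ℕ) (e : Exp) (c : Cmd) : Cmd :=
  .seq (.assign x (.const 0)) (.loop (.var x) e (.seq c (.assign x (.add (.var x) (.const 1)))))

@[simp] theorem St.assign_r (s : St) (x v y : ℕ) :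
    (s.assign x v).r y = if y = x then v else s.r y := by
  simp [St.assign, Function.update_apply]

@[simp] theorem St.assign_a (s : St) (x v : ℕ) : (s.assign x v).a = s.a := rfl

@[simp] theorem St.assign_time (s : St) (x v : ℕ) : (s.assign x v).time = s.time + 1 := rfl

@[simp] theorem St.put_r (s : St) (k i v : ℕ) : (s.put k i v).r = s.r := rfl

@[simp] theorem St.put_a (s : St) (k i v l : ℕ) :
    (s.put k i v).a l = if l = k then Function.update (s.a k) i v else s.a l := by
  simp [St.put, Function.update_apply]

@[simp] theorem St.put_time (s : St) (k i v : ℕ) : (s.put k i v).time = s.time + 1 := rfl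

@[simp] theorem St.tick_r (s : St) : s.tick.r = s.r := rfl

@[simp] theorem St.tick_a (s : St) : s.tick.a = s.a := rfl

@[simp] theorem St.tick_time (s : St) : s.tick.time = s.time + 1 := rfl

/-- The rule for `for` loops with `N` rounds. -/
theorem wp_for_inv {x : ℕ} (N : ℕ) (I : ℕ → St → Prop) (hx : x ∉ c.regs)
    (hN : N < V.bound) (h₀ : I 0 (s.assign x 0))
    (hok : ∀ k ≤ N, ∀ t, Frame (.for x e c) s t → I k t → t.r x = k →
      e.Ok V t ∧ e.val V t = N)
    (hstep : ∀ k < N, ∀ t, Frame (.for x e c) s t → I k t → t.r x = k →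
      wp V c (fun u => I (k + 1) (u.assign x (k + 1))) t.tick)
    (hpost : ∀ t, Frame (.for x e c) s t → I N t → Q t.tick) :
    wp V (.for x e c) Q s := by
  -- The frame of the inner loop, taken after `x` was reset, is also a frame for the whole command,
  -- so the side conditions can refer to the original state.
  have hFr : ∀ t, Frame (.loop (.var x) e (.seq c (.assign x (.add (.var x) (.const 1)))))
      (s.assign x 0) t → Frame (.for x e c) s t := by
    intro t ht
    refine ⟨fun y hy => ?_, fun k hk => ?_⟩
    · rw [ht.reg y]
      · simp only [Cmd.for, Cmd.regs, List.mem_append, List.mem_singleton, not_or] at hy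
        simp [hy.1]
      · simpa [Cmd.for, Cmd.regs, and_comm] using hy
    · rw [ht.arr k]
      · rfl
      · simpa [Cmd.for, Cmd.arrs] using hk
  rw [Cmd.for, wp_seq, wp_assign]
  refine ⟨by simp only [Exp.Ok]; omega, ?_⟩
  refine wp_loop (fun t => t.r x ≤ N ∧ I (t.r x) t) (fun t => N - t.r x) ?_ ?_ ?_ ?_
  · simpa [Exp.val] using h₀
  · rintro t hF ⟨hle, hI⟩
    exact ⟨trivial, (hok _ hle t (hFr t hF) hI rfl).1⟩
  · rintro t hF ⟨hle, hI⟩ hlt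
    rw [(hok _ hle t (hFr t hF) hI rfl).2] at hlt
    simp only [Exp.val] at hlt
    rw [wp_seq]
    refine (hstep _ hlt t (hFr t hF) hI rfl).mono fun u hFu hu => ?_
    have hux : u.r x = t.r x := by rw [hFu.reg x hx]; rfl
    rw [wp_assign]
    simp only [Exp.Ok, Exp.val, hux]
    refine ⟨⟨trivial, by omega, by omega⟩, ⟨?_, ?_⟩, ?_⟩
    · simp
      omega
    · simpa using hu
    · simp
      omega
  · rintro t hF ⟨hle, hI⟩ hlt
    rw [(hok _ hle t (hFr t hF) hI rfl).2] at hlt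
    simp only [Exp.val] at hlt
    have hxN : t.r x = N := by omega
    rw [hxN] at hI
    exact hpost t (hFr t hF) hI

/-- The rule for `for` loops with `N` rounds, the `k`-th of which takes time at most `T k`. -/
theorem wp_for {x : ℕ} (N : ℕ) (T : ℕ → ℕ) (I : ℕ → St → Prop) (hx : x ∉ c.regs)
    (hN : N < V.bound) (h₀ : I 0 (s.assign x 0))
    (hok : ∀ k ≤ N, ∀ t, Frame (.for x e c) s t → I k t → t.r x = k →
      e.Ok V t ∧ e.val V t = N)
    (hstep : ∀ k < N, ∀ t, Frame (.for x e c) s t → I k t → t.r x = k →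
      wp V c (fun u => I (k + 1) (u.assign x (k + 1)) ∧ u.time ≤ t.time + T k) t.tick)
    (hpost : ∀ t, Frame (.for x e c) s t → I N t →
      t.time + 1 ≤ s.time + ∑ k ∈ Finset.range N, (T k + 1) + 2 → Q t.tick) :
    wp V (.for x e c) Q s := by
  -- The bound `T k` includes the test at the head of round `k`, and the summand `1` is the
  -- increment. The final `2` consists of the initial assignment and the last, failing test.
  refine wp_for_inv N (fun k t => I k t ∧
    t.time ≤ s.time + 1 + ∑ k ∈ Finset.range k, (T k + 1)) hx hN ⟨h₀, by simp⟩
    (fun k hk t hF hI => hok k hk t hF hI.1)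
    (fun k hk t hF hI hxk => (hstep k hk t hF hI.1 hxk).mono fun u _ hu => ⟨hu.1, ?_⟩)
    fun t hF hI => hpost t hF hI.1 (by omega)
  rw [St.assign_time, Finset.sum_range_succ]
  omega

end

/-! ### Breadth-first search: levels, parents and roots -/

section

/-- `E` is the adjacency relation of a graph with vertices `0, …, n - 1`. -/
structure IsGraph (n : ℕ) (E : ℕ → ℕ → Prop) : Prop where
  symm : ∀ u v, E u v → E v u
  irrefl : ∀ u, ¬ E u u
  lt : ∀ u v, E u v → u < n

/-- The subgraph of `E` induced by `X` is bipartite. -/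
def Bip (E : ℕ → ℕ → Prop) (X : ℕ → Prop) : Prop :=
  ∃ col : ℕ → Bool, ∀ u v, X u → X v → E u v → col u ≠ col v

/-- The invariant of breadth-first search in the subgraph induced by `X`: the queue `Q` has head
`h` and tail `t`; the discovered vertices have positive level `D`, a parent `PR` and a root `RT`;
a root gets the level `lev` of the vertex treated last; `cf` signals an edge `cu cv` between
vertices of the same level. -/
structure BfsInv (n : ℕ) (E : ℕ → ℕ → Prop) (X : ℕ → Prop) (D PR RT Q : ℕ → ℕ)
    (h t lev cf cu cv : ℕ) : Prop where
  le : h ≤ t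
  mem : ∀ i < t, X (Q i)
  inj : ∀ i < t, ∀ j < t, Q i = Q j → i = j
  disc : ∀ v < n, (D v ≠ 0 ↔ ∃ i < t, Q i = v)
  mono : ∀ i j, i ≤ j → j < t → D (Q i) ≤ D (Q j)
  bound : ∀ i < t, D (Q i) ≤ i + 1
  par : ∀ v < n, D v ≠ 0 → (PR v = v ∧ RT v = v) ∨
    (X (PR v) ∧ E v (PR v) ∧ D v = D (PR v) + 1 ∧ D (PR v) ≠ 0 ∧ RT v = RT (PR v))
  done : ∀ i < h, ∀ u, X u → E (Q i) u →
    D u ≠ 0 ∧ D u ≤ D (Q i) + 1 ∧ RT u = RT (Q i) ∧ (cf = 0 → D u ≠ D (Q i))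
  live : ∀ i j, h ≤ i → i < t → h ≤ j → j < t → RT (Q i) = RT (Q j)
  span : ∀ i, h ≤ i → i < t → D (Q i) ≤ D (Q h) + 1
  lev_pos : 1 ≤ lev
  lev_le : lev ≤ h + 1
  lev_ge : ∀ i < h, D (Q i) ≤ lev
  conf : cf ≠ 0 → X cu ∧ X cv ∧ E cu cv ∧ D cu = D cv ∧ D cu ≠ 0 ∧ RT cu = RT cv

variable {n : ℕ} {E : ℕ → ℕ → Prop} {X : ℕ → Prop} {D PR RT Q : ℕ → ℕ} {h t lev cf cu cv : ℕ}

theorem BfsInv.init (hD : ∀ v < n, D v = 0) : BfsInv n E X D PR RT Q 0 0 1 0 cu cv where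
  le := le_rfl
  mem := by simp
  inj := by simp
  disc := by simpa using hD
  mono := by simp
  bound := by simp
  par := fun v hv h => absurd (hD v hv) h
  done := by simp
  live := by simp
  span := by simp
  lev_pos := le_rfl
  lev_le := le_rfl
  lev_ge := by simp
  conf := by simp

theorem BfsInv.tail_le (H : BfsInv n E X D PR RT Q h t lev cf cu cv) (hX : ∀ v, X v → v < n) :
    t ≤ n := by
  have := Finset.card_le_card_of_injOn (s := Finset.range t) (t := Finset.range n) Q
    (fun i hi => by
      simp only [Finset.coe_range, Set.mem_Iio] at hi ⊢
      exact hX _ (H.mem i hi))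
    (fun i hi j hj => by
      simp only [Finset.coe_range, Set.mem_Iio] at hi hj
      exact H.inj i hi j hj)
  simpa using this

/-- A vertex enters the queue only once, so costs charged to treated vertices are bounded by a sum
over all vertices. With degrees as costs this gives linear time. -/
theorem BfsInv.sum_le (H : BfsInv n E X D PR RT Q h t lev cf cu cv) (hX : ∀ v, X v → v < n)
    (g : ℕ → ℕ) : ∑ i ∈ Finset.range h, g (Q i) ≤ ∑ v ∈ Finset.range n, g v := by
  have hle := H.le
  rw [← Finset.sum_image (f := g) (g := Q)]
  · refine Finset.sum_le_sum_of_subset fun v hv => ?_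
    simp only [Finset.mem_image, Finset.mem_range] at hv ⊢
    obtain ⟨i, hi, rfl⟩ := hv
    exact hX _ (H.mem i (by omega))
  · intro i hi j hj
    simp only [Finset.coe_range, Set.mem_Iio] at hi hj
    exact H.inj i (by omega) j (by omega)

/-- A new root. -/
theorem BfsInv.root {s : ℕ} (H : BfsInv n E X D PR RT Q t t lev cf cu cv)
    (hX : ∀ v, X v → v < n) (hs : X s) (h0 : D s = 0) :
    BfsInv n E X (Function.update D s lev) (Function.update PR s s) (Function.update RT s s)
      (Function.update Q t s) t (t + 1) lev cf cu cv := by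
  have hne : ∀ i < t, Q i ≠ s := fun i hi he => ((H.disc s (hX s hs)).2 ⟨i, hi, he⟩) h0
  have hpos := H.lev_pos
  constructor
  · omega
  · intro i hi
    grind [H.mem]
  · intro i hi j hj hij
    grind [H.inj]
  · intro v hv
    have := H.disc v hv
    by_cases hvs : v = s
    · subst hvs
      simp only [Function.update_self]
      exact ⟨fun _ => ⟨t, by omega, by simp⟩, fun _ => by omega⟩
    · rw [Function.update_of_ne hvs, this]
      constructor
      · rintro ⟨i, hi, rfl⟩
        exact ⟨i, by omega, by rw [Function.update_of_ne (by omega)]⟩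
      · rintro ⟨i, hi, hiv⟩
        by_cases hit : i = t
        · subst hit
          simp at hiv
          exact absurd hiv.symm hvs
        · exact ⟨i, by omega, by rwa [Function.update_of_ne hit] at hiv⟩
  · intro i j hij hj
    by_cases hjt : j = t
    · subst hjt
      by_cases hit : i = j
      · subst hit; exact le_rfl
      -- The queue is empty when a root is added, and `lev` bounds the levels of all treated
      -- vertices. Giving the root this level keeps levels monotone along the queue across
      -- components.
      · have := hne i (by omega)
        have := H.lev_ge i (by omega)
        simp [*]
    · have := hne i (by omega)
      have := hne j (by omega)
      have hit : i ≠ t := by omega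
      have := H.mono i j hij (by omega)
      simp [*]
  · intro i hi
    by_cases hit : i = t
    · subst hit
      simpa using H.lev_le
    · have := hne i (by omega)
      have := H.bound i (by omega)
      simp [*]
  · intro v hv hDv
    by_cases hvs : v = s
    · subst hvs
      simp
    · simp only [Function.update_of_ne hvs] at hDv ⊢
      rcases H.par v hv hDv with h | ⟨h1, h2, h3, h4, h5⟩
      · exact .inl h
      · have : PR v ≠ s := by rintro rfl; exact h4 h0
        right
        simp [*]
  · intro i hi u hu he
    have h1 := hne i hi
    have h2 : i ≠ t := by omega
    rw [Function.update_of_ne h2] at he ⊢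
    have := H.done i hi u hu he
    have : u ≠ s := by rintro rfl; exact this.1 h0
    simpa [*] using H.done i hi u hu he
  · intro i j h1 h2 h3 h4
    have : i = t := by omega
    have : j = t := by omega
    simp [*]
  · intro i h1 h2
    have : i = t := by omega
    simp [*]
  · exact hpos
  · exact H.lev_le
  · intro i hi
    have h1 := hne i hi
    have h2 : i ≠ t := by omega
    simpa [*] using H.lev_ge i hi
  · intro hcf
    obtain ⟨h1, h2, h3, h4, h5, h6⟩ := H.conf hcf
    have e1 : cu ≠ s := by rintro rfl; exact h5 h0
    have e2 : cv ≠ s := by rintro rfl; exact h5 (h4.trans h0)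
    have h7 : D cv ≠ 0 := h4 ▸ h5
    simp [*]

theorem BfsInv.setLev (H : BfsInv n E X D PR RT Q h t lev cf cu cv) (ht : h < t)
    (hX : ∀ v, X v → v < n) : BfsInv n E X D PR RT Q h t (D (Q h)) cf cu cv where
  __ := H
  lev_pos := Nat.one_le_iff_ne_zero.2 ((H.disc _ (hX _ (H.mem h ht))).2 ⟨h, ht, rfl⟩)
  lev_le := H.bound h ht
  lev_ge := fun i hi => H.mono i h (by omega) ht

/-- The vertex `u` has been checked as a neighbour of `v`. -/
def Checked (D RT : ℕ → ℕ) (cf v u : ℕ) : Prop :=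
  D u ≠ 0 ∧ D u ≤ D v + 1 ∧ RT u = RT v ∧ (cf = 0 → D u ≠ D v)

/-- If `u` was treated before the head, then its own neighbours, the head among them, were checked
then, and the queue is monotone in the level. Otherwise `u` is still waiting, and waiting vertices
share one root and span at most two consecutive levels. -/
theorem BfsInv.seen {u : ℕ} (H : BfsInv n E X D PR RT Q h t lev cf cu cv) (ht : h < t)
    (hX : ∀ v, X v → v < n) (hE : IsGraph n E) (hu : X u) (he : E (Q h) u) (h0 : D u ≠ 0) :
    D u ≤ D (Q h) + 1 ∧ RT u = RT (Q h) := by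
  obtain ⟨i, hi, rfl⟩ := (H.disc u (hX u hu)).1 h0
  by_cases hih : i < h
  · have h1 := H.mono i h (by omega) ht
    have h2 := H.done i hih (Q h) (H.mem h ht) (hE.symm _ _ he)
    exact ⟨by omega, h2.2.2.1.symm⟩
  · exact ⟨H.span i (by omega) hi, H.live i h (by omega) hi le_rfl ht⟩

/-- A newly discovered neighbour of the head of the queue. -/
theorem BfsInv.visit {u : ℕ} (H : BfsInv n E X D PR RT Q h t lev cf cu cv) (ht : h < t)
    (hX : ∀ v, X v → v < n) (hE : IsGraph n E) (hu : X u) (he : E (Q h) u) (h0 : D u = 0) :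
    BfsInv n E X (Function.update D u (D (Q h) + 1)) (Function.update PR u (Q h))
      (Function.update RT u (RT (Q h))) (Function.update Q t u) h (t + 1) lev cf cu cv := by
  have hne : ∀ i < t, Q i ≠ u := fun i hi he => ((H.disc u (hX u hu)).2 ⟨i, hi, he⟩) h0
  have hh : h ≠ t := by omega
  have hhu := hne h ht
  have hDh := (H.disc _ (hX _ (H.mem h ht))).2 ⟨h, ht, rfl⟩
  constructor
  · omega
  · intro i hi
    grind [H.mem]
  · intro i hi j hj hij
    grind [H.inj]
  · intro v hv
    have := H.disc v hv
    by_cases hvs : v = u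
    · subst hvs
      simp only [Function.update_self]
      exact ⟨fun _ => ⟨t, by omega, by simp⟩, fun _ => by omega⟩
    · rw [Function.update_of_ne hvs, this]
      constructor
      · rintro ⟨i, hi, rfl⟩
        exact ⟨i, by omega, by rw [Function.update_of_ne (by omega)]⟩
      · rintro ⟨i, hi, hiv⟩
        by_cases hit : i = t
        · subst hit
          simp at hiv
          exact absurd hiv.symm hvs
        · exact ⟨i, by omega, by rwa [Function.update_of_ne hit] at hiv⟩
  · intro i j hij hj
    by_cases hjt : j = t
    · subst hjt
      by_cases hit : i = j
      · subst hit; exact le_rfl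
      · have := hne i (by omega)
        have h1 : D (Q i) ≤ D (Q h) + 1 := by
          by_cases hih : h ≤ i
          · exact H.span i hih (by omega)
          · have := H.mono i h (by omega) ht
            omega
        simp [*]
    · have := hne i (by omega)
      have := hne j (by omega)
      have hit : i ≠ t := by omega
      have := H.mono i j hij (by omega)
      simp [*]
  · intro i hi
    by_cases hit : i = t
    · subst hit
      have := H.bound h ht
      simp
      omega
    · have := hne i (by omega)
      have := H.bound i (by omega)
      simp [*]
  · intro v hv hDv
    by_cases hvs : v = u
    · subst hvs
      right
      simp only [Function.update_self, Function.update_of_ne hhu]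
      exact ⟨H.mem h ht, hE.symm _ _ he, trivial, hDh, trivial⟩
    · simp only [Function.update_of_ne hvs] at hDv ⊢
      rcases H.par v hv hDv with h | ⟨h1, h2, h3, h4, h5⟩
      · exact .inl h
      · have : PR v ≠ u := by rintro rfl; exact h4 h0
        right
        simp [*]
  · intro i hi w hw hew
    have h1 := hne i (by omega)
    have h2 : i ≠ t := by omega
    rw [Function.update_of_ne h2] at hew ⊢
    have := H.done i hi w hw hew
    have : w ≠ u := by rintro rfl; exact this.1 h0
    simpa [*] using H.done i hi w hw hew
  · have key : ∀ i, h ≤ i → i < t + 1 →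
        Function.update RT u (RT (Q h)) (Function.update Q t u i) = RT (Q h) := by
      intro i h1 h2
      by_cases hit : i = t
      · simp [hit]
      · have := hne i (by omega)
        simp only [ne_eq, hit, not_false_eq_true, Function.update_of_ne, this]
        exact H.live i h h1 (by omega) le_rfl ht
    intro i j h1 h2 h3 h4
    rw [key i h1 h2, key j h3 h4]
  · intro i h1 h2
    by_cases hit : i = t
    · simp [*]
    · have := hne i (by omega)
      have := H.span i h1 (by omega)
      simp [*]
  · exact H.lev_pos
  · exact H.lev_le
  · intro i hi
    have h1 := hne i (by omega)
    have h2 : i ≠ t := by omega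
    simpa [*] using H.lev_ge i hi
  · intro hcf
    obtain ⟨h1, h2, h3, h4, h5, h6⟩ := H.conf hcf
    have e1 : cu ≠ u := by rintro rfl; exact h5 h0
    have e2 : cv ≠ u := by rintro rfl; exact h5 (h4.trans h0)
    have h7 : D cv ≠ 0 := h4 ▸ h5
    simp [*]

/-- A visit only changes data of an undiscovered vertex, which is neither `v` nor an already checked
neighbour. -/
theorem Checked.visit {u v w d ρ : ℕ} (hc : Checked D RT cf v w) (h0 : D u = 0) (hv : D v ≠ 0) :
    Checked (Function.update D u d) (Function.update RT u ρ) cf v w := by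
  have e1 : w ≠ u := by rintro rfl; exact hc.1 h0
  have e2 : v ≠ u := by rintro rfl; exact hv h0
  simpa [Checked, *] using hc

/-- Once a conflict is recorded, the search continues only to complete levels and parents; the
demand that neighbours have different levels is dropped. -/
theorem BfsInv.conflict {u : ℕ} (H : BfsInv n E X D PR RT Q h t lev cf cu cv) (ht : h < t)
    (hX : ∀ v, X v → v < n) (hE : IsGraph n E) (hu : X u) (he : E (Q h) u)
    (h0 : D u = D (Q h)) : BfsInv n E X D PR RT Q h t lev 1 u (Q h) where
  __ := H
  done := fun i hi w hw hew => by
    obtain ⟨h1, h2, h3, -⟩ := H.done i hi w hw hew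
    exact ⟨h1, h2, h3, by simp⟩
  conf := fun _ => by
    have hDh := (H.disc _ (hX _ (H.mem h ht))).2 ⟨h, ht, rfl⟩
    have := H.seen ht hX hE hu he (by omega)
    exact ⟨hu, H.mem h ht, hE.symm _ _ he, h0, by omega, this.2⟩

/-- The head of the queue has been treated. -/
theorem BfsInv.advance (H : BfsInv n E X D PR RT Q h t (D (Q h)) cf cu cv) (ht : h < t)
    (hc : ∀ u, X u → E (Q h) u → Checked D RT cf (Q h) u) :
    BfsInv n E X D PR RT Q (h + 1) t (D (Q h)) cf cu cv where
  __ := H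
  le := ht
  done := fun i hi u hu he => by
    by_cases hih : i = h
    · subst hih
      exact hc u hu he
    · exact H.done i (by omega) u hu he
  live := fun i j h1 h2 h3 h4 => H.live i j (by omega) h2 (by omega) h4
  span := fun i h1 h2 => by
    have a := H.span i (by omega) h2
    have b := H.mono h (h + 1) (by omega) (by omega)
    omega
  lev_le := by
    have := H.bound h ht
    omega
  lev_ge := fun i hi => H.mono i h (by omega) ht

/-- The result of breadth-first search. -/
structure BfsResult (n : ℕ) (E : ℕ → ℕ → Prop) (X : ℕ → Prop) (D PR RT : ℕ → ℕ)
    (cf cu cv : ℕ) : Prop where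
  bound : ∀ v, X v → D v ≤ n
  level : ∀ u v, X u → X v → E u v → D v ≤ D u + 1
  bip : cf = 0 → Bip E X
  par : ∀ v, X v → (PR v = v ∧ RT v = v) ∨
    (X (PR v) ∧ E v (PR v) ∧ D v = D (PR v) + 1 ∧ RT v = RT (PR v))
  conf : cf ≠ 0 → X cu ∧ X cv ∧ E cu cv ∧ D cu = D cv ∧ RT cu = RT cv

theorem BfsInv.result (H : BfsInv n E X D PR RT Q t t lev cf cu cv) (hX : ∀ v, X v → v < n)
    (hE : IsGraph n E) (hall : ∀ v, X v → D v ≠ 0) : BfsResult n E X D PR RT cf cu cv := by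
  have hdone : ∀ u v, X u → X v → E u v → D v ≤ D u + 1 ∧ (cf = 0 → D v ≠ D u) := by
    intro u v hu hv he
    obtain ⟨i, hi, rfl⟩ := (H.disc u (hX u hu)).1 (hall u hu)
    have := H.done i hi v hv he
    exact ⟨this.2.1, this.2.2.2⟩
  refine ⟨fun v hv => ?_, fun u v hu hv he => (hdone u v hu hv he).1, fun hcf => ?_,
    fun v hv => ?_, fun hcf => ?_⟩
  · obtain ⟨i, hi, rfl⟩ := (H.disc v (hX v hv)).1 (hall v hv)
    have h1 := H.bound i hi
    have h2 := H.tail_le hX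
    omega
  -- Colour by parity of the level: without conflict, adjacent levels differ by exactly one.
  · refine ⟨fun v => decide (D v % 2 = 0), fun u v hu hv he => ?_⟩
    have h1 := hdone u v hu hv he
    have h2 := h1.2 hcf
    have h3 := hdone v u hv hu (hE.symm _ _ he)
    simp only [ne_eq, decide_eq_decide]
    omega
  · rcases H.par v (hX v hv) (hall v hv) with h | ⟨h1, h2, h3, h4, h5⟩
    · exact .inl h
    · exact .inr ⟨h1, h2, h3, h5⟩
  · obtain ⟨h1, h2, h3, h4, h5, h6⟩ := H.conf hcf
    exact ⟨h1, h2, h3, h4, h6⟩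

/-! ### Ancestor chains and odd closed walks -/

/-- `W 0, …, W (l - 1)` is the chain of the ancestors of `c`. -/
structure IsChain (D PR W : ℕ → ℕ) (l c : ℕ) : Prop where
  pos : 1 ≤ l
  start : W 0 = c
  next : ∀ k, k + 1 < l → W (k + 1) = PR (W k) ∧ D (PR (W k)) < D (W k)
  last : ¬ D (PR (W (l - 1))) < D (W (l - 1))

variable {W : ℕ → ℕ} {l c : ℕ}

/-- Following parents while the level strictly drops must stop, whatever `PR` is; hence induction on
the level. -/
theorem IsChain.exists_of_level (D PR : ℕ → ℕ) : ∀ (m c : ℕ), D c ≤ m →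
    ∃ W l, IsChain D PR W l c := by
  intro m
  induction m with
  | zero =>
    intro c hc
    exact ⟨fun _ => c, 1, le_rfl, rfl, fun k hk => by omega, by omega⟩
  | succ m ih =>
    intro c hc
    by_cases h : D (PR c) < D c
    · obtain ⟨W, l, h1, h2, h3, h4⟩ := ih (PR c) (by omega)
      refine ⟨fun k => if k = 0 then c else W (k - 1), l + 1, by omega, by simp, fun k hk => ?_, ?_⟩
      · by_cases hk0 : k = 0
        · subst hk0
          simpa [h2] using h
        · obtain ⟨k, rfl⟩ : ∃ j, k = j + 1 := ⟨k - 1, by omega⟩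
          simpa using h3 k (by omega)
      · have : l ≠ 0 := by omega
        simpa [this] using h4
    · exact ⟨fun _ => c, 1, le_rfl, rfl, fun k hk => by omega, h⟩

theorem IsChain.level (hW : IsChain D PR W l c) (H : BfsResult n E X D PR RT cf cu cv)
    (hc : X c) : ∀ k < l, X (W k) ∧ D (W k) + k = D c ∧ RT (W k) = RT c := by
  intro k
  induction k with
  | zero =>
    intro _
    simp [hW.start, hc]
  | succ k ih =>
    intro hk
    obtain ⟨h1, h2, h3⟩ := ih (by omega)
    obtain ⟨h4, h5⟩ := hW.next k hk
    rw [h4]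
    rcases H.par _ h1 with h | ⟨h6, h7, h8, h9⟩
    · rw [h.1] at h5
      omega
    · exact ⟨h6, by omega, by rw [← h9, h3]⟩

/-- A vertex that is not a root has a parent one level lower, so the chain can stop only at a root;
the root is constant along the chain. -/
theorem IsChain.root (hW : IsChain D PR W l c) (H : BfsResult n E X D PR RT cf cu cv)
    (hc : X c) : W (l - 1) = RT c := by
  have hl := hW.pos
  obtain ⟨h1, h2, h3⟩ := hW.level H hc (l - 1) (by omega)
  have := hW.last
  rcases H.par _ h1 with h | ⟨h6, h7, h8, h9⟩
  · rw [← h3, h.2]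
  · omega

theorem IsChain.inj (hW : IsChain D PR W l c) (H : BfsResult n E X D PR RT cf cu cv)
    (hc : X c) : Set.InjOn W (Finset.range l) := by
  intro i hi j hj hij
  simp only [Finset.coe_range, Set.mem_Iio] at hi hj
  have h1 := (hW.level H hc i hi).2.1
  have h2 := (hW.level H hc j hj).2.1
  rw [hij] at h1
  omega

theorem IsChain.sum_le (hW : IsChain D PR W l c) (H : BfsResult n E X D PR RT cf cu cv)
    (hc : X c) (hX : ∀ v, X v → v < n) (g : ℕ → ℕ) :
    ∑ k ∈ Finset.range l, g (W k) ≤ ∑ v ∈ Finset.range n, g v := by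
  rw [← Finset.sum_image (f := g) (g := W) (hW.inj H hc)]
  refine Finset.sum_le_sum_of_subset fun v hv => ?_
  simp only [Finset.mem_image, Finset.mem_range] at hv ⊢
  obtain ⟨i, hi, rfl⟩ := hv
  exact hX _ (hW.level H hc i hi).1

theorem IsChain.length_le (hW : IsChain D PR W l c) (H : BfsResult n E X D PR RT cf cu cv)
    (hc : X c) (hX : ∀ v, X v → v < n) : l ≤ n := by
  simpa using hW.sum_le H hc hX (fun _ => 1)

-- Double counting of the pairs of a chain vertex and a neighbour `u` of it in `X`. The level of `W
-- k` is `D c - k` and differs from that of `u` by at most one, so `u` occurs for at most three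
-- values of `k`.
open Classical in
theorem IsChain.sum_card_le (hW : IsChain D PR W l c) (H : BfsResult n E X D PR RT cf cu cv)
    (hc : X c) (hE : IsGraph n E) :
    ∑ k ∈ Finset.range l, ((Finset.range n).filter fun u => X u ∧ E (W k) u).card ≤ 3 * n := by
  have := Finset.sum_card_bipartiteAbove_eq_sum_card_bipartiteBelow
    (s := Finset.range l) (t := Finset.range n) (fun k u => X u ∧ E (W k) u)
  simp only [Finset.bipartiteAbove, Finset.bipartiteBelow] at this
  rw [this]
  refine (Finset.sum_le_card_nsmul _ _ 3 fun u hu => ?_).trans (by simp [mul_comm])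
  -- The possible positions `k` form this interval; truncated subtraction can only shorten it.
  refine (Finset.card_le_card (t := Finset.Icc (D c - D u - 1) (D c + 1 - D u)) ?_).trans ?_
  · intro k hk
    simp only [Finset.mem_filter, Finset.mem_range, Finset.mem_Icc] at hk ⊢
    obtain ⟨hk, hu, he⟩ := hk
    obtain ⟨h1, h2, -⟩ := hW.level H hc k hk
    have h3 := H.level _ _ h1 hu he
    have h4 := H.level _ _ hu h1 (hE.symm _ _ he)
    omega
  · simp
    omega

/-- A set that meets all odd cycles meets the chains of the ancestors of a conflicting edge. -/
theorem BfsResult.exists_mem_chain (H : BfsResult n E X D PR RT cf cu cv) (hcf : cf ≠ 0)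
    {W' : ℕ → ℕ} {l' : ℕ} (hW : IsChain D PR W l cu) (hW' : IsChain D PR W' l' cv)
    (S : ℕ → Prop) (hS : Bip E fun v => X v ∧ ¬ S v) :
    (∃ k < l, S (W k)) ∨ ∃ k < l', S (W' k) := by
  by_contra hcon
  simp only [not_or, not_exists, not_and] at hcon
  obtain ⟨col, hcol⟩ := hS
  obtain ⟨hu, hv, he, hD, hR⟩ := H.conf hcf
  -- A chain that avoids `S` is a path in the bipartite remainder, so its colours alternate.
  have key : ∀ {W l c}, IsChain D PR W l c → X c → (∀ k < l, ¬ S (W k)) →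
      ∀ k < l, col (W k) = xor (col c) (decide (k % 2 = 1)) := by
    intro W l c hW hc hS k
    induction k with
    | zero => simp [hW.start]
    | succ k ih =>
      intro hk
      have h1 := ih (by omega)
      have h2 := hW.level H hc k (by omega)
      have h3 := hW.level H hc (k + 1) hk
      have h4 := hW.next k hk
      have h5 : E (W k) (W (k + 1)) := by
        rcases H.par _ h2.1 with h | h
        · rw [h.1] at h4
          omega
        · rw [h4.1]
          exact h.2.1
      have h6 := hcol _ _ ⟨h2.1, hS k (by omega)⟩ ⟨h3.1, hS _ hk⟩ h5
      rw [h1] at h6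
      have : decide ((k + 1) % 2 = 1) = !decide (k % 2 = 1) := by
        rw [← decide_not, decide_eq_decide]
        omega
      rw [this]
      revert h6
      cases col c <;> cases col (W (k + 1)) <;> cases decide (k % 2 = 1) <;> simp
  have hl := hW.pos
  have hl' := hW'.pos
  have h1 := key hW hu hcon.1 (l - 1) (by omega)
  have h2 := key hW' hv hcon.2 (l' - 1) (by omega)
  have h3 := (hW.level H hu (l - 1) (by omega)).2.1
  have h4 := (hW'.level H hv (l' - 1) (by omega)).2.1
  rw [hW.root H hu] at h1 h3
  rw [hW'.root H hv, ← hR] at h2 h4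
  -- Both ends of the conflicting edge have the same level and the same root, so the chains have
  -- equal length. Alternation back from the common root then forces equal colours on adjacent
  -- vertices.
  have h5 : l - 1 = l' - 1 := by omega
  rw [h5, h2] at h1
  have h6 := hcol cu cv ⟨hu, by simpa [hW.start] using hcon.1 0 hl⟩
    ⟨hv, by simpa [hW'.start] using hcon.2 0 hl'⟩ he
  revert h1 h6
  cases col cu <;> cases col cv <;> cases decide ((l' - 1) % 2 = 1) <;> simp

/-- If the graph is bipartite, even the empty set meets all its odd cycles, while it meets no chain.
-/
theorem BfsResult.bip_iff (H : BfsResult n E X D PR RT cf cu cv) : cf = 0 ↔ Bip E X := by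
  refine ⟨H.bip, fun hb => ?_⟩
  by_contra hcf
  obtain ⟨W, l, hW⟩ := IsChain.exists_of_level D PR _ cu le_rfl
  obtain ⟨W', l', hW'⟩ := IsChain.exists_of_level D PR _ cv le_rfl
  simpa using H.exists_mem_chain hcf hW hW' (fun _ => False) (by simpa using hb)

end

/-! ### Cliques that meet all odd cycles -/

section

/-- The graph `E` has a clique that meets all its odd cycles. -/
def TwoOne (n : ℕ) (E : ℕ → ℕ → Prop) : Prop :=
  ∃ C : ℕ → Prop, (∀ u v, C u → C v → u ≠ v → E u v) ∧ Bip E fun v => v < n ∧ ¬ C v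

/-- The vertices of `K` and `T` that are equal or adjacent to all vertices in `T`. -/
def Core (E : ℕ → ℕ → Prop) (K : ℕ → Prop) (T : Finset ℕ) (v : ℕ) : Prop :=
  (K v ∨ v ∈ T) ∧ ∀ t ∈ T, v = t ∨ E t v

/-- The vertices outside the core. -/
def Rest (n : ℕ) (E : ℕ → ℕ → Prop) (K : ℕ → Prop) (T : Finset ℕ) (v : ℕ) : Prop :=
  v < n ∧ ¬ Core E K T v

/-- The vertex `v` has a bipartite non-neighbourhood. -/
def Cand (n : ℕ) (E : ℕ → ℕ → Prop) (v : ℕ) : Prop :=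
  v < n ∧ Bip E fun u => u < n ∧ u ≠ v ∧ ¬ E v u

/-- `K` is a maximal clique among the vertices with bipartite non-neighbourhood. -/
structure IsMaxClique (n : ℕ) (E : ℕ → ℕ → Prop) (K : ℕ → Prop) : Prop where
  cand : ∀ v, K v → Cand n E v
  clique : ∀ u v, K u → K v → u ≠ v → E u v
  max : ∀ v, Cand n E v → ¬ K v → ∃ u, K u ∧ ¬ E u v

/-- `T` extends a part of `K` to a clique that meets all odd cycles. -/
structure IsExt (n : ℕ) (E : ℕ → ℕ → Prop) (K : ℕ → Prop) (T : Finset ℕ) : Prop where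
  lt : ∀ t ∈ T, t < n
  notMem : ∀ t ∈ T, ¬ K t
  clique : ∀ u ∈ T, ∀ v ∈ T, u ≠ v → E u v
  bip : Bip E (Rest n E K T)
  card : T.card ≤ 4

variable {n : ℕ} {E : ℕ → ℕ → Prop} {X Y K : ℕ → Prop} {S T : Finset ℕ}

theorem Bip.mono (h : Bip E X) (hY : ∀ v, Y v → X v) : Bip E Y := by
  obtain ⟨col, hcol⟩ := h
  exact ⟨col, fun u v hu hv => hcol u v (hY u hu) (hY v hv)⟩

/-- A proper 2-colouring is injective on a clique. -/
theorem Bip.card_le_two (h : Bip E X) (hT : ∀ v ∈ T, X v)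
    (hc : ∀ u ∈ T, ∀ v ∈ T, u ≠ v → E u v) : T.card ≤ 2 := by
  obtain ⟨col, hcol⟩ := h
  refine (Finset.card_le_card_of_injOn (t := Finset.univ) col
    (fun _ _ => Finset.mem_coe.2 (Finset.mem_univ _)) ?_).trans (by simp)
  intro u hu v hv huv
  by_contra hne
  exact hcol u v (hT u hu) (hT v hv) (hc u hu v hv hne) huv

/-- Soundness of every guess `T`, even one that is not a clique: two core vertices from `K` are
adjacent because `K` is a clique, and a core vertex in `T` is equal or adjacent to all core vertices
by the defining condition. -/
theorem TwoOne.of_bip (hE : IsGraph n E) (hK : IsMaxClique n E K) (h : Bip E (Rest n E K T)) :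
    TwoOne n E := by
  refine ⟨Core E K T, fun u v hu hv hne => ?_, h⟩
  rcases hu.1 with hu' | hu'
  · rcases hv.1 with hv' | hv'
    · exact hK.clique u v hu' hv' hne
    · exact hE.symm _ _ ((hu.2 v hv').resolve_left hne)
  · exact (hv.2 u hu').resolve_left hne.symm

-- Completeness: the part `T` of a solution `C` outside `K` is an extension. All of `C` lies in the
-- core of `T`, so the rest is contained in the bipartite complement of `C`. The bound `4` is `2 *
-- 2`: at most two vertices of `K` lie outside `C`, and each is missed by at most two vertices of
-- `T`.
open Classical in
theorem TwoOne.exists_isExt (hK : IsMaxClique n E K) (h : TwoOne n E) :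
    ∃ T, IsExt n E K T := by
  obtain ⟨C, hC, hb⟩ := h
  set T := (Finset.range n).filter fun v => C v ∧ ¬ K v with hT
  set O := (Finset.range n).filter fun v => K v ∧ ¬ C v with hO
  have hO2 : O.card ≤ 2 := by
    refine hb.card_le_two (fun v hv => ?_) (fun u hu v hv => hK.clique u v ?_ ?_)
    · simp only [hO, Finset.mem_filter, Finset.mem_range] at hv
      exact ⟨hv.1, hv.2.2⟩
    · simp only [hO, Finset.mem_filter] at hu
      exact hu.2.1
    · simp only [hO, Finset.mem_filter] at hv
      exact hv.2.1
  have hCand : ∀ v < n, C v → Cand n E v := fun v hv hCv =>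
    ⟨hv, hb.mono fun u hu => ⟨hu.1, fun hCu => hu.2.2 (hC v u hCv hCu hu.2.1.symm)⟩⟩
  -- Maximality of `K` gives each `v ∈ T` a non-neighbour in `K`, and that vertex is not in `C`,
  -- since `C` is a clique.
  have hcov : T ⊆ O.biUnion fun p => T.filter fun v => ¬ E p v := by
    intro v hv
    have hv' := hv
    simp only [hT, Finset.mem_filter, Finset.mem_range] at hv
    obtain ⟨u, hu, huv⟩ := hK.max v (hCand v hv.1 hv.2.1) hv.2.2
    simp only [Finset.mem_biUnion, hO, Finset.mem_filter, Finset.mem_range]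
    refine ⟨u, ⟨(hK.cand u hu).1, hu, fun hCu => huv (hC u v hCu hv.2.1 ?_)⟩, hv', huv⟩
    rintro rfl
    exact hv.2.2 hu
  refine ⟨T, ⟨fun t ht => ?_, fun t ht => ?_, fun u hu v hv => hC u v ?_ ?_, hb.mono ?_, ?_⟩⟩
  · simp only [hT, Finset.mem_filter, Finset.mem_range] at ht
    exact ht.1
  · simp only [hT, Finset.mem_filter] at ht
    exact ht.2.2
  · simp only [hT, Finset.mem_filter] at hu
    exact hu.2.1
  · simp only [hT, Finset.mem_filter] at hv
    exact hv.2.1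
  · rintro v ⟨hv, hnc⟩
    refine ⟨hv, fun hCv => hnc ⟨?_, fun t ht => ?_⟩⟩
    · by_cases hKv : K v
      · exact .inl hKv
      · exact .inr (by simp [hT, hv, hCv, hKv])
    · simp only [hT, Finset.mem_filter] at ht
      by_cases hvt : v = t
      · exact .inl hvt
      · exact .inr (hC t v ht.2.1 hCv (Ne.symm hvt))
  · refine (Finset.card_le_card hcov).trans ((Finset.card_biUnion_le_card_mul _ _ 2 ?_).trans ?_)
    · intro p hp
      simp only [hO, Finset.mem_filter, Finset.mem_range] at hp
      refine (hK.cand p hp.2.1).2.card_le_two (fun v hv => ?_) (fun u hu v hv => hC u v ?_ ?_)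
      · simp only [hT, Finset.mem_filter, Finset.mem_range] at hv
        refine ⟨hv.1.1, ?_, hv.2⟩
        rintro rfl
        exact hp.2.2 hv.1.2.1
      · simp only [hT, Finset.mem_filter] at hu
        exact hu.1.2.1
      · simp only [hT, Finset.mem_filter] at hv
        exact hv.1.2.1
    · omega

/-- A core vertex of the larger set `S` that is not itself in `S` comes from `K` and is adjacent to
all of `S ⊇ T`, so it is a core vertex of `T`. Hence what remains of the rest of `T` after deleting
`S` lies outside the core of `S`. -/
theorem IsExt.bip_rest (hS : IsExt n E K S) (hTS : T ⊆ S) :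
    Bip E fun v => Rest n E K T v ∧ ¬ v ∈ S := by
  refine hS.bip.mono fun v hv => ⟨hv.1.1, fun hc => hv.1.2 ⟨.inl ?_, fun t ht => hc.2 t (hTS ht)⟩⟩
  exact hc.1.resolve_right hv.2

theorem IsExt.rest (hS : IsExt n E K S) {t : ℕ} (ht : t ∈ S) (htT : t ∉ T) : Rest n E K T t :=
  ⟨hS.lt t ht, fun hc => hc.1.elim (hS.notMem t ht) htT⟩

/-- Because `T` is contained in the clique `S`, all of `T` lies in its own core. -/
theorem IsExt.notMem_of_rest (hS : IsExt n E K S) (hTS : T ⊆ S) {t : ℕ}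
    (h : Rest n E K T t) : t ∉ T := fun htT =>
  h.2 ⟨.inr htT, fun u hu => by
    by_cases htu : t = u
    · exact .inl htu
    · exact .inr (hS.clique u (hTS hu) t (hTS htT) (Ne.symm htu))⟩

theorem IsExt.mem_of_triangle (hS : IsExt n E K S) (hTS : T ⊆ S) {x y z : ℕ}
    (hx : Rest n E K T x) (hy : Rest n E K T y) (hz : Rest n E K T z)
    (hxy : E x y) (hyz : E y z) (hxz : E x z) : x ∈ S ∨ y ∈ S ∨ z ∈ S := by
  by_contra hcon
  simp only [not_or] at hcon
  obtain ⟨col, hcol⟩ := hS.bip_rest hTS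
  have h1 := hcol x y ⟨hx, hcon.1⟩ ⟨hy, hcon.2.1⟩ hxy
  have h2 := hcol y z ⟨hy, hcon.2.1⟩ ⟨hz, hcon.2.2⟩ hyz
  have h3 := hcol x z ⟨hx, hcon.1⟩ ⟨hz, hcon.2.2⟩ hxz
  revert h1 h2 h3
  cases col x <;> cases col y <;> cases col z <;> simp

/-- The vertices of `S` still missing from `T` lie outside the core of `T` and form a clique. -/
theorem IsExt.exists_triangle (hS : IsExt n E K S) (h : 2 < (S \ T).card) :
    ∃ x y z, Rest n E K T x ∧ Rest n E K T y ∧ Rest n E K T z ∧ E x y ∧ E y z ∧ E x z := by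
  obtain ⟨x, y, z, hx, hy, hz, hxy, hxz, hyz⟩ := Finset.two_lt_card_iff.1 h
  simp only [Finset.mem_sdiff] at hx hy hz
  exact ⟨x, y, z, hS.rest hx.1 hx.2, hS.rest hy.1 hy.2, hS.rest hz.1 hz.2,
    hS.clique _ hx.1 _ hy.1 hxy, hS.clique _ hy.1 _ hz.1 hyz, hS.clique _ hx.1 _ hz.1 hxz⟩

end

/-! ### The breadth-first search program -/

section

/-- Sequential composition. -/
def Cmd.block : List Cmd → Cmd
  | [] => .skip
  | c :: l => .seq c (.block l)

theorem wp_block_nil {V : Env} {Q : St → Prop} {s : St} : wp V (.block []) Q s ↔ Q s := wp_skip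

theorem wp_block_cons {V : Env} {Q : St → Prop} {s : St} {c : Cmd} {l : List Cmd} :
    wp V (.block (c :: l)) Q s ↔ wp V c (fun t => wp V (.block l) Q t) s := wp_seq

attribute [simp] wp_block_nil wp_block_cons wp_skip wp_assign wp_put wp_ite Exp.val Exp.Ok

-- The variables of the program.
@[simp] def rN : ℕ := 0
@[simp] def rANS : ℕ := 1
@[simp] def rV : ℕ := 2
@[simp] def rU : ℕ := 3
@[simp] def rX : ℕ := 4
@[simp] def rP : ℕ := 5
@[simp] def rJ : ℕ := 6
@[simp] def rS : ℕ := 7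
@[simp] def rHd : ℕ := 8
@[simp] def rTl : ℕ := 9
@[simp] def rLev : ℕ := 10
@[simp] def rCF : ℕ := 11
@[simp] def rCU : ℕ := 12
@[simp] def rCV : ℕ := 13
@[simp] def rBv : ℕ := 14
@[simp] def rBj : ℕ := 15
@[simp] def rBu : ℕ := 16
@[simp] def rBi : ℕ := 17

-- The arrays of the program.
@[simp] def aROW : ℕ := 0
@[simp] def aM : ℕ := 1
@[simp] def aDEG : ℕ := 2
@[simp] def aNB : ℕ := 3
@[simp] def aMASK : ℕ := 4
@[simp] def aK : ℕ := 5
@[simp] def aD : ℕ := 6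
@[simp] def aPAR : ℕ := 7
@[simp] def aRT : ℕ := 8
@[simp] def aQ : ℕ := 9
@[simp] def aKT : ℕ := 10
@[simp] def aX : ℕ := 11

/-- The cell of a two-dimensional array in the row `v` and the column `u`. -/
@[simp] def Exp.cell (k v u : ℕ) : Exp := .get k (.add (.get aROW (.var v)) (.var u))

/-- The representation of a graph: `row v` is the address of the row `v` of the matrix `mat` and of
the neighbour lists `nb`; the matrix has ones on the diagonal, and an additional row of ones. -/
structure IsRep (n : ℕ) (E : ℕ → ℕ → Prop) (M : ℕ) (row mat deg nb : ℕ → ℕ) : Prop where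
  row_eq : ∀ v ≤ n, row v = v * (n + 1)
  mat_one : ∀ v < n, ∀ u < n, v = u ∨ E v u → mat (v * (n + 1) + u) = 1
  mat_zero : ∀ v < n, ∀ u < n, ¬ (v = u ∨ E v u) → mat (v * (n + 1) + u) = 0
  dummy : ∀ u < n, mat (n * (n + 1) + u) = 1
  deg_le : ∀ v < n, deg v ≤ n
  nb_adj : ∀ v < n, ∀ j < deg v, E v (nb (v * (n + 1) + j))
  nb_surj : ∀ v u, E v u → ∃ j < deg v, nb (v * (n + 1) + j) = u
  nb_inj : ∀ v < n, ∀ i < deg v, ∀ j < deg v,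
    nb (v * (n + 1) + i) = nb (v * (n + 1) + j) → i = j
  sum_deg : ∑ v ∈ Finset.range n, deg v = M

/-- The graph is stored in the first four arrays. -/
abbrev St.Rep (n : ℕ) (E : ℕ → ℕ → Prop) (M : ℕ) (s : St) : Prop :=
  s.r rN = n ∧ IsRep n E M (s.a aROW) (s.a aM) (s.a aDEG) (s.a aNB)

/-- Treat one neighbour of the head of the queue. -/
def bfsNb : Cmd := .block [
  .assign rBu (.cell aNB rBv rBj),
  .ite (.const 0) (.get aMASK (.var rBu))
    (.ite (.get aD (.var rBu)) (.const 1)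
      (.block [
        .put aD (.var rBu) (.add (.var rLev) (.const 1)),
        .put aPAR (.var rBu) (.var rBv),
        .put aRT (.var rBu) (.get aRT (.var rBv)),
        .put aQ (.var rTl) (.var rBu),
        .assign rTl (.add (.var rTl) (.const 1))])
      (.ite (.get aD (.var rBu)) (.var rLev) .skip
        (.ite (.var rLev) (.get aD (.var rBu)) .skip
          (.block [.assign rCF (.const 1), .assign rCU (.var rBu), .assign rCV (.var rBv)]))))
    .skip]

/-- Treat the head of the queue. -/
def bfsHead : Cmd := .block [
  .assign rBv (.get aQ (.var rHd)),
  .assign rLev (.get aD (.var rBv)),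
  .for rBj (.get aDEG (.var rBv)) bfsNb,
  .assign rHd (.add (.var rHd) (.const 1))]

/-- Breadth-first search in the subgraph induced by the array `aMASK`. -/
def bfs : Cmd := .block [
  .for rBi (.var rN) (.put aD (.var rBi) (.const 0)),
  .assign rCF (.const 0),
  .assign rTl (.const 0),
  .assign rHd (.const 0),
  .assign rLev (.const 1),
  .for rS (.var rN) (.block [
    .ite (.const 0) (.get aMASK (.var rS))
      (.ite (.get aD (.var rS)) (.const 1)
        (.block [
          .put aD (.var rS) (.var rLev),
          .put aPAR (.var rS) (.var rS),
          .put aRT (.var rS) (.var rS),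
          .put aQ (.var rTl) (.var rS),
          .assign rTl (.add (.var rTl) (.const 1))])
        .skip)
      .skip,
    .loop (.var rHd) (.var rTl) bfsHead])]

/-- The bound for all values is large enough. -/
def Env.Large (V : Env) (n : ℕ) : Prop := (n + 1) * (n + 1) + n + 8 < V.bound

theorem Env.Large.row_lt {V : Env} {n : ℕ} (hV : V.Large n) {v j : ℕ} (hv : v ≤ n) (hj : j ≤ n) :
    v * (n + 1) + j < V.bound := by
  have := Nat.mul_le_mul_right (n + 1) hv
  unfold Env.Large at hV
  nlinarith

theorem Env.Large.lt {V : Env} {n : ℕ} (hV : V.Large n) {v : ℕ} (hv : v ≤ n + 8) :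
    v < V.bound := by
  unfold Env.Large at hV
  nlinarith

/-- The invariant of breadth-first search, with `h` vertices treated. -/
abbrev St.BfsInv (n : ℕ) (E : ℕ → ℕ → Prop) (X : ℕ → Prop) (h : ℕ) (s : St) : Prop :=
  WordRAM.BfsInv n E X (s.a aD) (s.a aPAR) (s.a aRT) (s.a aQ) h (s.r rTl) (s.r rLev) (s.r rCF)
    (s.r rCU) (s.r rCV)

variable {V : Env} {n M : ℕ} {E : ℕ → ℕ → Prop}

/-- Besides the search invariant, three facts must survive each step so that the loop over
neighbours can accumulate them: the queue up to its head is fixed, levels never return to zero, and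
checked neighbours stay checked. -/
theorem bfsNb_spec {X : ℕ → Prop} {s : St} {h j : ℕ} (hV : V.Large n) (hE : IsGraph n E)
    (hX : ∀ v, X v ↔ v < n ∧ 0 < s.a aMASK v) (hR : s.Rep n E M) (hI : s.BfsInv n E X h)
    (hh : h < s.r rTl) (hv : s.r rBv = s.a aQ h) (hl : s.r rLev = s.a aD (s.r rBv))
    (hj : s.r rBj = j) (hjd : j < s.a aDEG (s.r rBv)) :
    wp V bfsNb (fun t => t.BfsInv n E X h ∧ t.r rLev = t.a aD (s.r rBv) ∧ h < t.r rTl ∧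
      (∀ i ≤ h, t.a aQ i = s.a aQ i) ∧ (∀ w, s.a aD w ≠ 0 → t.a aD w ≠ 0) ∧
      (∀ w, Checked (s.a aD) (s.a aRT) (s.r rCF) (s.r rBv) w →
        Checked (t.a aD) (t.a aRT) (t.r rCF) (s.r rBv) w) ∧
      (X (s.a aNB (s.r rBv * (n + 1) + j)) →
        Checked (t.a aD) (t.a aRT) (t.r rCF) (s.r rBv) (s.a aNB (s.r rBv * (n + 1) + j))) ∧
      t.time ≤ s.time + 8) s := by
  obtain ⟨hN, hR⟩ := hR
  have hX' : ∀ v, X v → v < n := fun v h => ((hX v).1 h).1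
  have htn := hI.tail_le hX'
  dsimp [St.BfsInv] at *
  have hXv : X (s.r 14) := hv ▸ hI.mem h hh
  have hvn := hX' _ hXv
  have hDv : s.a 6 (s.r 14) ≠ 0 := (hI.disc _ hvn).2 ⟨h, hh, hv.symm⟩
  have hDb : s.a 6 (s.r 14) ≤ n := by
    have := hI.bound h hh
    rw [hv]
    omega
  have hjn : j < n := lt_of_lt_of_le hjd (hR.deg_le _ hvn)
  have hadj := hR.nb_adj _ hvn j hjd
  have hrow := hR.row_eq _ hvn.le
  set u := s.a 3 (s.r 14 * (n + 1) + j) with hu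
  have hun : u < n := hE.lt _ _ (hE.symm _ _ hadj)
  have b1 := hV.row_lt hvn.le hjn.le
  have b2 : 1 < V.bound := hV.lt (by omega)
  have b3 : s.r 10 + 1 < V.bound := hV.lt (by omega)
  have b4 : s.r 9 + 1 < V.bound := hV.lt (by omega)
  have b5 : 0 < V.bound := by omega
  have hDu := hI.seen hh hX' hE (u := u)
  rw [← hv] at hDu
  simp only [bfsNb]
  simp [hrow, hj, ← hu, b1, b2, b3, b4, b5]
  refine ⟨fun hm => ?_, fun hm => ?_⟩
  · have hXu : X u := (hX u).2 ⟨hun, hm⟩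
    refine ⟨fun hD => ?_, fun hD => ?_⟩
    · have huv : s.r 14 ≠ u := by
        intro he
        rw [he] at hDv
        exact hDv hD
      have := hI.visit hh hX' hE hXu (hv ▸ hadj) hD
      rw [← hv, ← hl] at this
      refine ⟨this, ?_, by omega, fun i hi => ?_, fun w hw => ?_, fun w hw => hw.visit hD hDv, fun _ => ?_⟩
      · rw [Function.update_of_ne huv, hl]
      · rw [Function.update_of_ne (by omega)]
      · rwa [Function.update_of_ne (by rintro rfl; exact hw hD)]
      · simp [Checked, huv, hl]
    · obtain ⟨h1, h2⟩ := hDu hXu hadj hD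
      refine ⟨fun hlt => ⟨hI, hl, hh, fun _ => ⟨hD, h1, h2, fun _ => by omega⟩⟩, fun hge =>
        ⟨fun hgt => ⟨hI, hl, hh, fun _ => ⟨hD, h1, h2, fun _ => by omega⟩⟩, fun hle => ?_⟩⟩
      have := hI.conflict hh hX' hE hXu (hv ▸ hadj) (by rw [← hv]; omega)
      rw [← hv] at this
      refine ⟨this, hl, hh, fun w hw => ⟨hw.1, hw.2.1, hw.2.2.1, by simp⟩, fun _ =>
        ⟨hD, h1, h2, by simp⟩⟩
  · refine ⟨hI, hl, hh, fun hXu => ?_⟩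
    have := ((hX u).1 hXu).2
    omega

theorem bfsHead_spec {X : ℕ → Prop} {s : St} {h : ℕ} (hV : V.Large n) (hE : IsGraph n E)
    (hX : ∀ v, X v ↔ v < n ∧ 0 < s.a aMASK v) (hR : s.Rep n E M) (hI : s.BfsInv n E X h)
    (hh : h < s.r rTl) (hhd : s.r rHd = h) :
    wp V bfsHead (fun t => t.BfsInv n E X (h + 1) ∧ t.r rHd = h + 1 ∧
      (∀ i ≤ h, t.a aQ i = s.a aQ i) ∧ (∀ w, s.a aD w ≠ 0 → t.a aD w ≠ 0) ∧
      t.time ≤ s.time + 10 * s.a aDEG (s.a aQ h) + 5) s := by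
  have hX' : ∀ v, X v → v < n := fun v h => ((hX v).1 h).1
  have htn := hI.tail_le hX'
  have hvn := hX' _ (hI.mem h hh)
  have hR' := hR
  obtain ⟨hN, hG⟩ := hR
  have hdn := hG.deg_le _ hvn
  dsimp [St.BfsInv] at *
  simp only [bfsHead]
  simp [hhd]
  set v := s.a 9 h with hv
  refine wp_for (s.a 2 v) (fun _ => 9) (fun j t => t.BfsInv n E X h ∧ t.r rLev = t.a aD v ∧
    h < t.r rTl ∧ (∀ i ≤ h, t.a aQ i = s.a aQ i) ∧ (∀ w, s.a aD w ≠ 0 → t.a aD w ≠ 0) ∧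
    ∀ i < j, X (s.a aNB (v * (n + 1) + i)) →
      Checked (t.a aD) (t.a aRT) (t.r rCF) v (s.a aNB (v * (n + 1) + i))) ?_ ?_ ?_ ?_ ?_ ?_
  · decide
  · exact hV.lt (by omega)
  · simp [St.BfsInv]
    exact ⟨hI.setLev hh hX', hh⟩
  · intro k hk t hF ⟨h1, h2, h3, h4, h4', h5⟩ hj
    have e1 := hF.reg 14 (by decide)
    have e2 := hF.arr 2 (by decide)
    simp at e1 e2
    simp [e1, e2]
  · intro k hk t hF ⟨h1, h2, h3, h4, h4', h5⟩ hj
    have e0 := hF.reg 0 (by decide)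
    have e1 := hF.reg 14 (by decide)
    have a0 := hF.arr 0 (by decide)
    have a1 := hF.arr 1 (by decide)
    have a2 := hF.arr 2 (by decide)
    have a3 := hF.arr 3 (by decide)
    have a4 := hF.arr 4 (by decide)
    simp at e0 e1 a0 a1 a2 a3 a4 h2 h3 h4 h4' h5
    have hq := h4 h le_rfl
    refine (bfsNb_spec (s := t.tick) (h := h) (j := k) (X := X) (M := M) hV hE ?_ ?_ h1 h3 ?_ ?_ hj
      ?_).mono ?_
    · simpa [a4] using hX
    · simpa [St.Rep, e0, a0, a1, a2, a3] using hR'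
    · simp [e1, hq, hv]
    · simp [h2, e1]
    · simpa [e1, a2] using hk
    · rintro u hFu ⟨g1, g2, g3, g4, g4', g5, g6, g7⟩
      simp [e1, a3] at g2 g3 g4 g4' g5 g6 g7 ⊢
      refine ⟨⟨?_, g2, g3, fun i hi => (g4 i hi).trans (h4 i hi), fun w hw => g4' w (h4' w hw),
        fun i hi hXi => ?_⟩, by omega⟩
      · simpa [St.BfsInv] using g1
      · rcases Nat.lt_or_eq_of_le hi with hi | rfl
        · exact g5 _ (h5 i hi hXi)
        · exact g6 hXi
  · rintro t hF ⟨h1, h2, h3, h4, h4', h5⟩ ht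
    have e8 := hF.reg 8 (by decide)
    simp at e8 h2 h3 h4 h4' h5 ht
    have hb1 : s.r 8 + 1 < V.bound := hV.lt (by omega)
    have hb2 : 1 < V.bound := hV.lt (by omega)
    simp [St.BfsInv, e8] at h1 ⊢
    have hq : t.a 9 h = v := h4 h le_rfl
    refine ⟨⟨hb2, hb1⟩, ?_, hhd, h4, h4', by omega⟩
    rw [h2, ← hq] at h1 ⊢
    -- The list contains every neighbour of the head, so all neighbours have been checked.
    refine h1.advance h3 fun u hXu he => ?_
    obtain ⟨i, hi, rfl⟩ := hG.nb_surj _ u he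
    rw [hq] at hi hXu ⊢
    exact h5 i hi hXu

/-- The result of breadth-first search, as stored in the state. -/
abbrev St.BfsResult (n : ℕ) (E : ℕ → ℕ → Prop) (X : ℕ → Prop) (s : St) : Prop :=
  WordRAM.BfsResult n E X (s.a aD) (s.a aPAR) (s.a aRT) (s.r rCF) (s.r rCU) (s.r rCV)

/-- The time of the nested loops is amortised: the invariant charges `10 * deg + 6` to each treated
queue position instead of bounding a single round. Since every vertex is treated at most once, the
total is linear in `n + M`. -/
theorem bfs_spec {X : ℕ → Prop} {s : St} (hV : V.Large n) (hE : IsGraph n E)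
    (hX : ∀ v, X v ↔ v < n ∧ 0 < s.a aMASK v) (hR : s.Rep n E M) :
    wp V bfs (fun t => t.BfsResult n E X ∧ t.time ≤ s.time + 20 * (n + M) + 10) s := by
  have hX' : ∀ v, X v → v < n := fun v h => ((hX v).1 h).1
  have hR' := hR
  obtain ⟨hN, hG⟩ := hR
  dsimp [St.BfsResult] at *
  have hb0 : 0 < V.bound := hV.lt (by omega)
  have hb1 : 1 < V.bound := hV.lt (by omega)
  have hn := hV.lt (show n ≤ n + 8 by omega)
  simp only [bfs, wp_block_cons]
  refine wp_for n (fun _ => 2) (fun j t => ∀ v < j, t.a aD v = 0) (by decide) hn (by simp) ?_ ?_ ?_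
  · intro k hk t hF hI hj
    have e0 := hF.reg 0 (by decide)
    simp [e0, hN]
  · intro k hk t hF hI hj
    simp at hI hj ⊢
    refine ⟨hb0, fun v hv => ?_⟩
    simp only [Function.update_apply, hj]
    split_ifs
    · rfl
    · exact hI v (by omega)
  intro t₁ hF₁ hD ht₁
  have e0 := hF₁.reg 0 (by decide)
  have a0 := hF₁.arr 0 (by decide)
  have a1 := hF₁.arr 1 (by decide)
  have a2 := hF₁.arr 2 (by decide)
  have a3 := hF₁.arr 3 (by decide)
  have a4 := hF₁.arr 4 (by decide)
  simp [hb0, hb1]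
  simp at hD ht₁
  set t₂ := ((((t₁.tick.assign 11 0).assign 9 0).assign 8 0).assign 10 1) with ht₂
  have f0 : t₂.r 0 = n := by simp [ht₂, e0, hN]
  have b0 : t₂.a 0 = s.a 0 := by simp [ht₂, a0]
  have b1 : t₂.a 1 = s.a 1 := by simp [ht₂, a1]
  have b2 : t₂.a 2 = s.a 2 := by simp [ht₂, a2]
  have b3 : t₂.a 3 = s.a 3 := by simp [ht₂, a3]
  have b4 : t₂.a 4 = s.a 4 := by simp [ht₂, a4]
  have htime : t₂.time ≤ s.time + 3 * n + 6 := by simp [ht₂]; omega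
  have hI₂ : t₂.BfsInv n E X 0 := by simpa [St.BfsInv, ht₂] using BfsInv.init hD
  have g1 : t₂.r 8 = 0 := by simp [ht₂]
  have g2 : t₂.r 9 = 0 := by simp [ht₂]
  clear_value t₂
  -- After each round the queue is empty and the first `j` vertices are discovered if they belong to
  -- `X`.
  refine wp_for_inv n (fun j t => t.BfsInv n E X (t.r rHd) ∧ t.r rHd = t.r rTl ∧
    (∀ v < j, X v → t.a aD v ≠ 0) ∧ t.time ≤ t₂.time + 1 + 10 * j +
      ∑ i ∈ Finset.range (t.r rHd), (10 * s.a aDEG (t.a aQ i) + 6)) (by decide) hn ?_ ?_ ?_ ?_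
  · simpa [g1, g2, St.BfsInv] using hI₂
  · intro k hk t hF hI hj
    have e0 := hF.reg 0 (by decide)
    simp [e0, f0]
  · rintro k hk t hF ⟨h1, h2, h3, h4⟩ hj
    have f0 : t.r 0 = n := (hF.reg 0 (by decide)).trans f0
    have b0 : t.a 0 = s.a 0 := (hF.arr 0 (by decide)).trans b0
    have b1 : t.a 1 = s.a 1 := (hF.arr 1 (by decide)).trans b1
    have b2 : t.a 2 = s.a 2 := (hF.arr 2 (by decide)).trans b2
    have b3 : t.a 3 = s.a 3 := (hF.arr 3 (by decide)).trans b3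
    have b4 : t.a 4 = s.a 4 := (hF.arr 4 (by decide)).trans b4
    have hRt : t.Rep n E M := by simpa [St.Rep, f0, b0, b1, b2, b3] using hG
    have hXt : ∀ v, X v ↔ v < n ∧ 0 < t.a 4 v := by simpa [b4] using hX
    clear hF
    dsimp [St.BfsInv] at h1 h2 h3 h4 hj
    have htn := h1.tail_le hX'
    have hb3 : t.r 9 + 1 < V.bound := hV.lt (by omega)
    -- The three branches (new root, vertex already discovered, vertex outside `X`) meet in one
    -- claim about the loop that empties the queue.
    suffices H : ∀ t' : St, t'.Rep n E M → t'.a 2 = s.a 2 → t'.a 4 = t.a 4 → t'.BfsInv n E X (t.r 8) →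
        t'.r 8 = t.r 8 →
        (∀ i < t.r 8, t'.a 9 i = t.a 9 i) → (∀ v < k + 1, X v → t'.a 6 v ≠ 0) →
        t'.time ≤ t.time + 8 →
        wp V (.loop (.var 8) (.var 9) bfsHead) (fun u => u.BfsInv n E X (u.r 8) ∧
          u.r 8 = u.r 9 ∧ (∀ v < k + 1, X v → u.a 6 v ≠ 0) ∧
          u.time + 1 ≤ t₂.time + 1 + 10 * (k + 1) +
            ∑ i ∈ Finset.range (u.r 8), (10 * s.a 2 (u.a 9 i) + 6)) t' by
      dsimp only [rS, rHd, rTl, aMASK, aD, aPAR, aRT, aQ, rLev] at *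
      simp only [wp_block_cons, wp_block_nil, wp_ite, wp_put, wp_assign, wp_skip]
      simp [hj, hb0, hb1, hb3]
      have hall : X k → t.a 6 k ≠ 0 → ∀ v < k + 1, X v → t.a 6 v ≠ 0 := by
        intro hk1 hk2 v hv hXv
        rcases Nat.lt_succ_iff_lt_or_eq.1 hv with hv | rfl
        · exact h3 v hv hXv
        · exact hk2
      refine ⟨fun hm => ⟨fun hD => ?_, fun hD => ?_⟩, fun hm => ?_⟩
      · have hXk : X k := (hXt k).2 ⟨hk, hm⟩
        rw [h2] at h1
        have hlev := h1.lev_pos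
        refine (H _ ?_ ?_ ?_ ?_ ?_ ?_ ?_ ?_).mono fun u _ hu => by simpa [St.BfsInv] using hu
        · simpa [St.Rep] using hRt
        · simp [b2]
        · simp
        · simpa [St.BfsInv, h2] using h1.root hX' hXk hD
        · simp
        · intro i hi
          simp
          rw [Function.update_of_ne (by omega)]
        · intro v hv hXv
          simp only [St.assign_a, St.put_a, St.tick_a]
          simp [Function.update_apply]
          split_ifs with hvk
          · omega
          · exact h3 v (by omega) hXv
        · simp
      · have hXk : X k := (hXt k).2 ⟨hk, hm⟩
        refine (H _ ?_ ?_ ?_ ?_ ?_ ?_ ?_ ?_).mono fun u _ hu => by simpa [St.BfsInv] using hu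
        · simpa [St.Rep] using hRt
        · simp [b2]
        · simp
        · simpa [St.BfsInv] using h1
        · simp
        · simp
        · simpa using hall hXk hD
        · simp
      · refine (H _ ?_ ?_ ?_ ?_ ?_ ?_ ?_ ?_).mono fun u _ hu => by simpa [St.BfsInv] using hu
        · simpa [St.Rep] using hRt
        · simp [b2]
        · simp
        · simpa [St.BfsInv] using h1
        · simp
        · simp
        · intro v hv hXv
          have hvk : v ≠ k := by
            rintro rfl
            have := ((hXt v).1 hXv).2
            omega
          simpa using h3 v (by omega) hXv
        · simp
    intro t' hR' ha2 ha4 hI hr8 hQ hall htime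
    have hX'' : ∀ v, X v ↔ v < n ∧ 0 < t'.a 4 v := by simpa [ha4] using hXt
    refine wp_loop (fun u => u.BfsInv n E X (u.r 8) ∧ (∀ v < k + 1, X v → u.a 6 v ≠ 0) ∧
      u.time + 2 ≤ t₂.time + 1 + 10 * (k + 1) +
        ∑ i ∈ Finset.range (u.r 8), (10 * s.a 2 (u.a 9 i) + 6)) (fun u => n - u.r 8) ?_ ?_ ?_ ?_
    · refine ⟨by rwa [hr8], hall, ?_⟩
      rw [hr8, Finset.sum_congr rfl fun i hi => by rw [hQ i (Finset.mem_range.1 hi)]]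
      omega
    · intro u hF hu
      simp
    · rintro u hF ⟨i1, i2, i3⟩ hlt
      simp at hlt
      have e0 := hF.reg 0 (by decide)
      have a0 := hF.arr 0 (by decide)
      have a1 := hF.arr 1 (by decide)
      have a2 := hF.arr 2 (by decide)
      have a3 := hF.arr 3 (by decide)
      have a4 := hF.arr 4 (by decide)
      have hRu : u.Rep n E M := by
        rcases hR' with ⟨h, h'⟩
        exact ⟨e0.trans h, by simpa [a0, a1, a2, a3] using h'⟩
      have hun := i1.tail_le hX'
      simp at hun
      refine (bfsHead_spec (s := u.tick) (X := X) hV hE (by simpa [a4] using hX'') hRu i1 hlt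
        rfl).mono ?_
      rintro w - ⟨g1, g2, g3, g4, g5⟩
      simp at g1 g2 g3 g4 g5 ⊢
      refine ⟨⟨by rwa [g2], fun v hv hXv => g4 v (i2 v (by omega) hXv), ?_⟩, by omega⟩
      rw [g2, Finset.sum_range_succ, Finset.sum_congr rfl fun i hi => by
        rw [g3 i (Finset.mem_range.1 hi).le], g3 _ le_rfl]
      rw [a2, ha2] at g5
      omega
    · rintro u hF ⟨i1, i2, i3⟩ hlt
      simp [St.BfsInv] at hlt i1 i2 i3 ⊢
      have := i1.le
      exact ⟨i1, by omega, i2, by omega⟩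
  · rintro t hF ⟨h1, h2, h3, h4⟩
    simp [St.BfsInv] at h1 h2 h3 h4 ⊢
    rw [← h2] at h1
    have hsum := h1.sum_le hX' fun v => 10 * s.a 2 v + 6
    refine ⟨h1.result hX' hE fun v hv => h3 v (hX' v hv) hv, ?_⟩
    have : ∑ v ∈ Finset.range n, (10 * s.a 2 v + 6) = 10 * M + 6 * n := by
      rw [Finset.sum_add_distrib, ← Finset.mul_sum, hG.sum_deg]
      simp [mul_comm]
    omega

end

/-! ### Testing one extension -/

section

@[simp] def rT1 : ℕ := 18
@[simp] def rT2 : ℕ := 19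
@[simp] def rT3 : ℕ := 20
@[simp] def rT4 : ℕ := 21
@[simp] def rMk : ℕ := 22
@[simp] def rPv : ℕ := 23
@[simp] def rPu : ℕ := 24
@[simp] def rOk : ℕ := 25

/-- Store the set of vertices outside the core of `rT1, …, rT4` (where `n` means no vertex). -/
def mkMask : Cmd := .block [
  .for rMk (.var rN) (.put aKT (.var rMk) (.get aK (.var rMk))),
  .put aKT (.var rT1) (.const 1),
  .put aKT (.var rT2) (.const 1),
  .put aKT (.var rT3) (.const 1),
  .put aKT (.var rT4) (.const 1),
  .for rMk (.var rN) (.put aMASK (.var rMk) (.sub (.const 1) (.sub (.add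
    (.add (.add (.cell aM rT1 rMk) (.cell aM rT2 rMk)) (.add (.cell aM rT3 rMk) (.cell aM rT4 rMk)))
    (.get aKT (.var rMk))) (.const 4))))]

/-- Accept if the subgraph outside the core is bipartite. -/
def testExt : Cmd := .block [mkMask, bfs, .ite (.const 0) (.var rCF) .skip (.assign rANS (.const 1))]

/-- The vertices among `a, b, c, d`, where `n` means no vertex. -/
def tset (n a b c d : ℕ) : Finset ℕ := ({a, b, c, d} : Finset ℕ).filter (· < n)

theorem mem_tset {n a b c d v : ℕ} :
    v ∈ tset n a b c d ↔ (v = a ∨ v = b ∨ v = c ∨ v = d) ∧ v < n := by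
  simp [tset]

theorem core_tset {E : ℕ → ℕ → Prop} {K : ℕ → Prop} {n a b c d v : ℕ} :
    Core E K (tset n a b c d) v ↔ (K v ∨ v ∈ tset n a b c d) ∧
      (a < n → v = a ∨ E a v) ∧ (b < n → v = b ∨ E b v) ∧ (c < n → v = c ∨ E c v) ∧
      (d < n → v = d ∨ E d v) := by
  refine and_congr_right fun _ => ⟨fun h => ?_, ?_⟩
  · exact ⟨fun h' => h a (mem_tset.2 ⟨by simp, h'⟩), fun h' => h b (mem_tset.2 ⟨by simp, h'⟩),
      fun h' => h c (mem_tset.2 ⟨by simp, h'⟩), fun h' => h d (mem_tset.2 ⟨by simp, h'⟩)⟩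
  · rintro ⟨ha, hb, hc, hd⟩ t ht
    obtain ⟨rfl | rfl | rfl | rfl, h⟩ := mem_tset.1 ht
    exacts [ha h, hb h, hc h, hd h]

/-- `f` is the indicator function of `K`. -/
def IsInd (n : ℕ) (K : ℕ → Prop) (f : ℕ → ℕ) : Prop :=
  (∀ v, K v → v < n) ∧ ∀ v < n, f v ≤ 1 ∧ (f v = 1 ↔ K v)

variable {V : Env} {n M : ℕ} {E : ℕ → ℕ → Prop} {K : ℕ → Prop}

/-- The extra row of ones makes the pseudo-vertex `n` impose no condition, so sets with fewer than
four vertices need no separate treatment. -/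
theorem IsRep.mat_eq {row mat deg nb : ℕ → ℕ} (h : IsRep n E M row mat deg nb) {t v : ℕ}
    (ht : t ≤ n) (hv : v < n) : mat (t * (n + 1) + v) ≤ 1 ∧
      (mat (t * (n + 1) + v) = 1 ↔ (t < n → v = t ∨ E t v)) := by
  rcases ht.lt_or_eq with ht | rfl
  · by_cases hc : t = v ∨ E t v
    · rw [h.mat_one t ht v hv hc]
      simp [ht, eq_comm (a := v), hc]
    · rw [h.mat_zero t ht v hv hc]
      simp [ht, eq_comm (a := v), hc]
  · rw [h.dummy v hv]
    simp

/-- Core membership is a conjunction of five conditions: lying in `K ∪ T`, and being equal or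
adjacent to each of four vertices. Writing a one into cell `n` for an absent vertex is harmless, as
only cells below `n` are read. -/
theorem mkMask_spec {s : St} {a b c d : ℕ} (hV : V.Large n) (hR : s.Rep n E M)
    (hK : IsInd n K (s.a aK)) (h1 : s.r rT1 = a) (h2 : s.r rT2 = b) (h3 : s.r rT3 = c)
    (h4 : s.r rT4 = d) (ha : a ≤ n) (hb : b ≤ n) (hc : c ≤ n) (hd : d ≤ n) :
    wp V mkMask (fun t => (∀ v, Rest n E K (tset n a b c d) v ↔ v < n ∧ 0 < t.a aMASK v) ∧
      t.time ≤ s.time + 6 * n + 10) s := by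
  obtain ⟨hN, hG⟩ := hR
  dsimp at *
  have hn := hV.lt (show n ≤ n + 8 by omega)
  have b1 : 1 < V.bound := hV.lt (by omega)
  have b4 : 4 < V.bound := hV.lt (by omega)
  simp only [mkMask, wp_block_cons]
  refine wp_for n (fun _ => 2) (fun j t => ∀ v < j, t.a aKT v = s.a aK v) (by decide) hn
    (by simp) ?_ ?_ ?_
  · intro k hk t hF hI hj
    have e0 := hF.reg 0 (by decide)
    simp [e0, hN]
  · intro k hk t hF hI hj
    have a5 := hF.arr 5 (by decide)
    simp at hI hj ⊢
    intro v hv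
    simp only [Function.update_apply, hj, a5]
    split_ifs with h
    · rw [h]
    · exact hI v (by omega)
  intro t₁ hF₁ hI₁ ht₁
  have e0 := hF₁.reg 0 (by decide)
  have e18 := hF₁.reg 18 (by decide)
  have e19 := hF₁.reg 19 (by decide)
  have e20 := hF₁.reg 20 (by decide)
  have e21 := hF₁.reg 21 (by decide)
  have a0 := hF₁.arr 0 (by decide)
  have a1 := hF₁.arr 1 (by decide)
  simp at hI₁ ht₁
  simp [b1, e18, e19, e20, e21, h1, h2, h3, h4]
  refine wp_for n (fun _ => 2) (fun j t => ∀ v < j,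
    (Rest n E K (tset n a b c d) v ↔ 0 < t.a aMASK v)) (by decide) hn (by simp) ?_ ?_ ?_
  · intro k hk t hF hI hj
    have e0' := hF.reg 0 (by decide)
    simp at e0'
    simp [e0', e0, hN]
  · intro k hk t hF hI hj
    have e18' := hF.reg 18 (by decide)
    have e19' := hF.reg 19 (by decide)
    have e20' := hF.reg 20 (by decide)
    have e21' := hF.reg 21 (by decide)
    have a0' := hF.arr 0 (by decide)
    have a1' := hF.arr 1 (by decide)
    have a10' := hF.arr 10 (by decide)
    simp at e18' e19' e20' e21' a0' a1' a10' hI hj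
    have m1 := hG.mat_eq ha hk
    have m2 := hG.mat_eq hb hk
    have m3 := hG.mat_eq hc hk
    have m4 := hG.mat_eq hd hk
    have r1 := hV.row_lt ha hk.le
    have r2 := hV.row_lt hb hk.le
    have r3 := hV.row_lt hc hk.le
    have r4 := hV.row_lt hd hk.le
    obtain ⟨k1, k2⟩ := hK.2 k hk
    simp [e18', e19', e20', e21', e18, e19, e20, e21, h1, h2, h3, h4, hj, a0', a1', a0, a1,
      hG.row_eq _ ha, hG.row_eq _ hb, hG.row_eq _ hc, hG.row_eq _ hd, r1, r2, r3, r4, b1, b4]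
    have hkt : t.a 10 k ≤ 1 ∧ (t.a 10 k = 1 ↔ K k ∨ k ∈ tset n a b c d) := by
      rw [a10', mem_tset]
      simp only [Function.update_apply]
      have := hI₁ k hk
      grind
    -- The five summands are zeros and ones, so the sum is `5` exactly on the core. Truncated
    -- subtraction turns this into the mask `1 - (sum - 4)`.
    have hs : s.a 1 (a * (n + 1) + k) + s.a 1 (b * (n + 1) + k) +
        (s.a 1 (c * (n + 1) + k) + s.a 1 (d * (n + 1) + k)) + t.a 10 k < V.bound :=
      hV.lt (by omega)
    refine ⟨by refine ⟨?_, ?_⟩ <;> omega, fun v hv => ?_⟩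
    by_cases hvk : v = k
    · subst hvk
      rw [Function.update_self]
      simp only [Rest, core_tset, hk, true_and, ← hkt.2, ← m1.2, ← m2.2, ← m3.2, ← m4.2]
      omega
    · rw [Function.update_of_ne hvk]
      exact hI v (by omega)
  · intro t hF hI ht
    simp at hI ht ⊢
    refine ⟨fun v => ⟨fun h => ⟨h.1, (hI v h.1).1 h⟩, fun h => (hI v h.1).2 h.2⟩, by omega⟩

theorem testExt_spec {s : St} {a b c d : ℕ} (hV : V.Large n) (hE : IsGraph n E)
    (hR : s.Rep n E M) (hK : IsInd n K (s.a aK)) (h1 : s.r rT1 = a) (h2 : s.r rT2 = b)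
    (h3 : s.r rT3 = c) (h4 : s.r rT4 = d) (ha : a ≤ n) (hb : b ≤ n) (hc : c ≤ n) (hd : d ≤ n) :
    wp V testExt (fun t => (t.r rANS ≠ 0 ↔ s.r rANS ≠ 0 ∨ Bip E (Rest n E K (tset n a b c d))) ∧
      t.time ≤ s.time + 26 * (n + M) + 30) s := by
  have b1 : 1 < V.bound := hV.lt (by omega)
  have b0 : 0 < V.bound := hV.lt (by omega)
  simp only [testExt, wp_block_cons]
  refine (mkMask_spec hV hR hK h1 h2 h3 h4 ha hb hc hd).mono fun t hF ⟨hX, ht⟩ => ?_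
  have e0 := hF.reg 0 (by decide)
  have e1 := hF.reg 1 (by decide)
  have a0 := hF.arr 0 (by decide)
  have a1 := hF.arr 1 (by decide)
  have a2 := hF.arr 2 (by decide)
  have a3 := hF.arr 3 (by decide)
  have hRt : t.Rep n E M := by simpa [St.Rep, e0, a0, a1, a2, a3] using hR
  refine (bfs_spec hV hE hX hRt).mono fun u hFu ⟨hB, hu⟩ => ?_
  have f1 := hFu.reg 1 (by decide)
  have := hB.bip_iff
  simp at this
  simp [b0, b1, f1, e1, ← this, Nat.pos_iff_ne_zero]
  refine ⟨fun h => ⟨?_, by omega⟩, fun h => ⟨by simp [h], by omega⟩⟩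
  tauto

/-! ### The greedy maximal clique -/

/-- Greedily choose a maximal clique among the vertices with bipartite non-neighbourhood. -/
def greedy : Cmd := .for rPv (.var rN) (.block [
  .for rPu (.var rN) (.put aMASK (.var rPu) (.sub (.const 1) (.cell aM rPv rPu))),
  bfs,
  .ite (.const 0) (.var rCF) .skip (.block [
    .assign rOk (.const 1),
    .for rPu (.var rN) (.ite (.const 0) (.get aK (.var rPu))
      (.ite (.const 0) (.cell aM rPv rPu) .skip (.assign rOk (.const 0))) .skip),
    .ite (.const 0) (.var rOk) (.put aK (.var rPv) (.const 1)) .skip])])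

/-- The set with indicator function `f` is a maximal clique among the first `k` vertices with
bipartite non-neighbourhood. -/
structure GreedyInv (n : ℕ) (E : ℕ → ℕ → Prop) (f : ℕ → ℕ) (k : ℕ) : Prop where
  le_one : ∀ v, f v ≤ 1
  lt : ∀ v, f v = 1 → v < k
  cand : ∀ v, f v = 1 → Cand n E v
  clique : ∀ u v, f u = 1 → f v = 1 → u ≠ v → E u v
  max : ∀ v < k, Cand n E v → f v ≠ 1 → ∃ u, f u = 1 ∧ ¬ E u v

theorem GreedyInv.skip {f : ℕ → ℕ} {k : ℕ} (h : GreedyInv n E f k)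
    (hk : Cand n E k → ∃ u, f u = 1 ∧ ¬ E u k) : GreedyInv n E f (k + 1) where
  __ := h
  lt := fun v hv => (h.lt v hv).trans (Nat.lt_succ_self k)
  max := fun v hv hc hf => by
    rcases Nat.lt_succ_iff_lt_or_eq.1 hv with hv | rfl
    · exact h.max v hv hc hf
    · exact hk hc

/-- Enlarging the clique never invalidates `max`: the witnesses against rejected vertices remain in
it. -/
theorem GreedyInv.insert {f : ℕ → ℕ} {k : ℕ} (h : GreedyInv n E f k) (hE : IsGraph n E)
    (hk : Cand n E k) (hadj : ∀ u, f u = 1 → E u k) :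
    GreedyInv n E (Function.update f k 1) (k + 1) := by
  constructor
  · intro v
    simp only [Function.update_apply]
    split_ifs
    · exact le_rfl
    · exact h.le_one v
  · intro v hv
    simp only [Function.update_apply] at hv
    split_ifs at hv with hvk
    · omega
    · exact (h.lt v hv).trans (Nat.lt_succ_self k)
  · intro v hv
    simp only [Function.update_apply] at hv
    split_ifs at hv with hvk
    · exact hvk ▸ hk
    · exact h.cand v hv
  · intro u v hu hv hne
    simp only [Function.update_apply] at hu hv
    split_ifs at hu hv with h1 h2 h2
    · exact absurd (h1.trans h2.symm) hne
    · exact h1 ▸ hE.symm _ _ (hadj v hv)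
    · exact h2 ▸ hadj u hu
    · exact h.clique u v hu hv hne
  · intro v hv hc hf
    simp only [Function.update_apply] at hf
    split_ifs at hf with hvk
    · exact absurd rfl hf
    · obtain ⟨u, hu, he⟩ := h.max v (by omega) hc hf
      refine ⟨u, ?_, he⟩
      rw [Function.update_of_ne]
      · exact hu
      · have := h.lt u hu
        omega

theorem greedy_spec {s : St} (hV : V.Large n) (hE : IsGraph n E) (hR : s.Rep n E M)
    (hK : ∀ v, s.a aK v = 0) :
    wp V greedy (fun t => (∃ K, IsMaxClique n E K ∧ IsInd n K (t.a aK)) ∧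
      t.time ≤ s.time + n * (30 * (n + M) + 40) + 2) s := by
  have hn := hV.lt (show n ≤ n + 8 by omega)
  have b1 : 1 < V.bound := hV.lt (by omega)
  have b0 : 0 < V.bound := hV.lt (by omega)
  simp only [greedy]
  refine wp_for n (fun _ => 30 * (n + M) + 39) (fun k t => GreedyInv n E (t.a aK) k) (by decide)
    hn ?_ ?_ ?_ ?_
  · simp at hK ⊢
    constructor <;> simp [hK]
  · intro k hk t hF hI hj
    have e0 := hF.reg 0 (by decide)
    simpa [e0] using hR.1
  · intro k hk t hF hI hj
    have e0 := hF.reg 0 (by decide)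
    have a0 := hF.arr 0 (by decide)
    have a1 := hF.arr 1 (by decide)
    have a2 := hF.arr 2 (by decide)
    have a3 := hF.arr 3 (by decide)
    have hRt : t.Rep n E M := by simpa [St.Rep, e0, a0, a1, a2, a3] using hR
    clear hF e0 a0 a1 a2 a3
    obtain ⟨hN, hG⟩ := hRt
    dsimp at hI hj hN hG
    have hrow := hG.row_eq k hk.le
    simp only [wp_block_cons]
    -- The ones on the diagonal of the matrix exclude `k` itself from the mask of its
    -- non-neighbours.
    refine wp_for n (fun _ => 2) (fun j t' => ∀ u < j, (0 < t'.a aMASK u ↔ u ≠ k ∧ ¬ E k u))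
      (by decide) hn (by simp) ?_ ?_ ?_
    · intro k hk t hF hI hj
      have e0 := hF.reg 0 (by decide)
      simpa [e0] using hN
    · intro u hu t' hF hI' hj'
      have e23 := hF.reg 23 (by decide)
      have a0 := hF.arr 0 (by decide)
      have a1 := hF.arr 1 (by decide)
      simp at e23 a0 a1 hI' hj' ⊢
      simp [e23, hj, hj', a0, a1, hrow, b1, hV.row_lt hk.le hu.le]
      intro v hv
      by_cases hvu : v = u
      · subst hvu
        have := hG.mat_eq hk.le hu
        simp only [hk, true_imp_iff] at this
        rw [Function.update_self]
        have h' : t.a 1 (k * (n + 1) + v) = 0 ↔ ¬ t.a 1 (k * (n + 1) + v) = 1 := by omega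
        rw [Nat.sub_pos_iff_lt, Nat.lt_one_iff, h', this.2, not_or]
      · rw [Function.update_of_ne hvu]
        exact hI' v (by omega)
    intro t₁ hF₁ hI₁ ht₁
    have e0 := hF₁.reg 0 (by decide)
    have e23 := hF₁.reg 23 (by decide)
    have a0 := hF₁.arr 0 (by decide)
    have a1 := hF₁.arr 1 (by decide)
    have a2 := hF₁.arr 2 (by decide)
    have a3 := hF₁.arr 3 (by decide)
    have a5 := hF₁.arr 5 (by decide)
    simp at hI₁ ht₁ e0 e23 a0 a1 a2 a3 a5
    refine (bfs_spec (s := t₁.tick) (X := fun u => u < n ∧ u ≠ k ∧ ¬ E k u) (M := M) hV hE ?_ ?_).mono ?_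
    · intro v
      refine and_congr_right fun hv => ?_
      simp [hI₁ v hv]
    · simpa [St.Rep, e0, a0, a1, a2, a3, hN] using hG
    rintro t₂ hF₂ ⟨hB, ht₂⟩
    have hbip := hB.bip_iff
    have f0 := hF₂.reg 0 (by decide)
    have f23 := hF₂.reg 23 (by decide)
    have c0 := hF₂.arr 0 (by decide)
    have c1 := hF₂.arr 1 (by decide)
    have c5 := hF₂.arr 5 (by decide)
    simp [e0, e23, a0, a1, a5, hj, hN] at f0 f23 c0 c1 c5 ht₂ hbip
    clear hF₁ hF₂ hB
    have hcand : t₂.r 11 = 0 ↔ Cand n E k := by rw [hbip, Cand]; simp [hk]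
    simp [b0, b1]
    refine ⟨fun hcf => ⟨?_, by omega⟩, fun hcf => ?_⟩
    · rw [c5]
      exact hI.skip fun hc => absurd (hcand.2 hc) (by omega)
    have hc := hcand.1 hcf
    refine wp_for n (fun _ => 4) (fun j t' => (t'.r rOk = 0 ∨ t'.r rOk = 1) ∧
      (t'.r rOk = 1 → ∀ u < j, t.a aK u = 1 → E u k) ∧
      (t'.r rOk = 0 → ∃ u, t.a aK u = 1 ∧ ¬ E u k))
      (by decide) hn (by simp) ?_ ?_ ?_
    · intro k hk t hF hI hj
      have e0 := hF.reg 0 (by decide)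
      simp at e0
      simpa [e0] using f0
    · intro u hu t' hF hI' hj'
      have e23 := hF.reg 23 (by decide)
      have a0 := hF.arr 0 (by decide)
      have a1 := hF.arr 1 (by decide)
      have a5 := hF.arr 5 (by decide)
      simp at e23 a0 a1 a5 hI' hj' ⊢
      obtain ⟨h1, h2, h3⟩ := hI'
      simp [e23, f23, hj', a0, a1, a5, c0, c1, c5, hrow, b0, hV.row_lt hk.le hu.le]
      have hm := hG.mat_eq hk.le hu
      simp only [hk, true_imp_iff] at hm
      have hu1 := hI.le_one u
      have hlt := hI.lt u
      refine ⟨fun hf => ⟨fun hm1 => ?_, fun hm0 => ?_⟩, fun hf => ?_⟩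
      · have hf : t.a 5 u = 1 := by omega
        have : E k u := (hm.2.1 (by omega)).resolve_left (by have := hlt hf; omega)
        refine ⟨h1, fun h v hv hv' => ?_, h3⟩
        rcases Nat.lt_or_eq_of_le hv with hv | rfl
        · exact h2 h v hv hv'
        · exact hE.symm _ _ this
      · have hf : t.a 5 u = 1 := by omega
        refine ⟨u, hf, fun he => ?_⟩
        have := hm.2.2 (.inr (hE.symm _ _ he))
        omega
      · refine ⟨h1, fun h v hv hv' => ?_, h3⟩
        rcases Nat.lt_or_eq_of_le hv with hv | rfl
        · exact h2 h v hv hv'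
        · omega
    · rintro t₃ hF₃ ⟨h1, h2, h3⟩ ht₃
      have e23 := hF₃.reg 23 (by decide)
      have a5 := hF₃.arr 5 (by decide)
      simp [c5, f23] at e23 a5 h1 h2 h3 ht₃
      simp [e23, a5]
      refine ⟨fun hok => ⟨?_, by omega⟩, fun hok => ⟨?_, by omega⟩⟩
      · refine hI.insert hE hc fun u hu => h2 (by omega) u ?_ hu
        exact (hI.lt u hu).trans hk
      · exact hI.skip fun _ => h3 hok
  · intro t hF hI ht
    simp at hI ht ⊢
    refine ⟨⟨fun v => t.a 5 v = 1, ⟨fun v hv => hI.cand v hv, fun u v => hI.clique u v,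
      fun v hv hf => hI.max v hv.1 hv hf⟩, fun v hv => hI.lt v hv, fun v _ => ⟨hI.le_one v, ?_⟩⟩, ?_⟩
    · rfl
    · ring_nf at ht ⊢
      omega

end

/-! ### Finding a triangle -/

section

@[simp] def rTb : ℕ := 26
@[simp] def rTv : ℕ := 27
@[simp] def rTj : ℕ := 28
@[simp] def rTu : ℕ := 29
@[simp] def rTk : ℕ := 30
@[simp] def rTw : ℕ := 31
@[simp] def aW : ℕ := 12
@[simp] def aY : ℕ := 13

/-- Look for triangles that contain the edge between `rTv` and `rTu`. -/
def triEdge : Cmd := .for rTk (.get aDEG (.var rTu)) (.block [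
  .assign rTw (.cell aNB rTu rTk),
  .ite (.const 0) (.get aMASK (.var rTw))
    (.ite (.const 0) (.cell aM rTv rTw)
      (.ite (.var rTv) (.var rTw)
        (.block [
          .put aY (.var rTb) (.var rTv),
          .put aY (.add (.var rTb) (.const 1)) (.var rTu),
          .put aY (.add (.var rTb) (.const 2)) (.var rTw)])
        .skip)
      .skip)
    .skip])

/-- Store the vertices of a triangle in the subgraph induced by the array `aMASK`, if there is one,
in the array `aY` from `rTb` on, followed by `n`. -/
def tri : Cmd := .block [
  .put aY (.var rTb) (.var rN),
  .put aY (.add (.var rTb) (.const 1)) (.var rN),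
  .put aY (.add (.var rTb) (.const 2)) (.var rN),
  .put aY (.add (.var rTb) (.const 3)) (.var rN),
  .for rTv (.var rN) (.ite (.const 0) (.get aMASK (.var rTv))
    (.for rTj (.get aDEG (.var rTv)) (.block [
      .assign rTu (.cell aNB rTv rTj),
      .ite (.const 0) (.get aMASK (.var rTu)) triEdge .skip]))
    .skip)]

/-- `x`, `y`, `z` is a triangle in the subgraph induced by `X`. -/
def IsTriangle (E : ℕ → ℕ → Prop) (X : ℕ → Prop) (x y z : ℕ) : Prop :=
  X x ∧ X y ∧ X z ∧ E x y ∧ E y z ∧ E x z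

/-- The content `Y` of the cells for triangles, originally `Y₀`; if `F` holds, then a triangle was
stored in the cells from `b` on. -/
structure TriInv (n : ℕ) (E : ℕ → ℕ → Prop) (X : ℕ → Prop) (Y₀ : ℕ → ℕ) (b : ℕ) (Y : ℕ → ℕ)
    (F : Prop) : Prop where
  le : ∀ i < 4, Y (b + i) ≤ n
  last : Y (b + 3) = n
  out : ∀ i < b, Y i = Y₀ i
  found : F → IsTriangle E X (Y b) (Y (b + 1)) (Y (b + 2))

variable {V : Env} {n M : ℕ} {E : ℕ → ℕ → Prop} {X : ℕ → Prop}

theorem TriInv.mono {Y₀ Y : ℕ → ℕ} {b : ℕ} {F F' : Prop} (h : TriInv n E X Y₀ b Y F)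
    (hF : F' → F) : TriInv n E X Y₀ b Y F' :=
  ⟨h.le, h.last, h.out, fun h' => h.found (hF h')⟩

/-- Any new triangle may overwrite an old one, so after storing, `found` holds for every condition
`F'`. -/
theorem TriInv.store {Y₀ Y : ℕ → ℕ} {b x y z : ℕ} {F : Prop} (h : TriInv n E X Y₀ b Y F)
    (hX : ∀ v, X v → v < n) (hT : IsTriangle E X x y z) (F' : Prop) :
    TriInv n E X Y₀ b
      (Function.update (Function.update (Function.update Y b x) (b + 1) y) (b + 2) z) F' := by
  have hx := hX _ hT.1
  have hy := hX _ hT.2.1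
  have hz := hX _ hT.2.2.1
  constructor
  · intro i hi
    have := h.le i hi
    simp only [Function.update_apply]
    split_ifs <;> omega
  · have := h.last
    simp [this]
  · intro i hi
    have := h.out i hi
    simp only [Function.update_apply]
    split_ifs <;> omega
  · intro _
    simpa [Function.update_apply] using hT

/-- The condition `v < w` is needed because `v` is itself a neighbour of `u` and the matrix has ones
on its diagonal: it excludes `w = v`. -/
theorem triEdge_spec {s : St} {b v u : ℕ} {Y₀ : ℕ → ℕ} {F : Prop} (hV : V.Large n)
    (hE : IsGraph n E) (hX : ∀ v, X v ↔ v < n ∧ 0 < s.a aMASK v) (hR : s.Rep n E M) (hb : b ≤ 4)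
    (hsb : s.r rTb = b) (hsv : s.r rTv = v) (hsu : s.r rTu = u) (hv : X v) (hu : X u)
    (he : E v u) (hY : TriInv n E X Y₀ b (s.a aY) F) :
    wp V triEdge (fun t => TriInv n E X Y₀ b (t.a aY)
      (F ∨ ∃ w, X w ∧ E u w ∧ E v w ∧ v < w) ∧ t.time ≤ s.time + 9 * n + 3) s := by
  obtain ⟨hN, hG⟩ := hR
  have hX' : ∀ v, X v → v < n := fun v h => ((hX v).1 h).1
  have hvn := hX' v hv
  have hun := hX' u hu
  have hdeg := hG.deg_le u hun
  dsimp at *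
  simp only [triEdge]
  refine wp_for (s.a 2 u) (fun _ => 8) (fun k t => TriInv n E X Y₀ b (t.a aY)
    (F ∨ ∃ i < k, X (s.a 3 (u * (n + 1) + i)) ∧ E v (s.a 3 (u * (n + 1) + i)) ∧
      v < s.a 3 (u * (n + 1) + i))) (by decide) (hV.lt (by omega)) (by simpa using hY) ?_ ?_ ?_
  · intro k hk t hF hI hj
    have e := hF.reg 29 (by decide)
    have a2 := hF.arr 2 (by decide)
    simp [e, hsu, a2]
  · intro k hk t hF hI hj
    have e26 := hF.reg 26 (by decide)
    have e27 := hF.reg 27 (by decide)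
    have e29 := hF.reg 29 (by decide)
    have a0 := hF.arr 0 (by decide)
    have a1 := hF.arr 1 (by decide)
    have a3 := hF.arr 3 (by decide)
    have a4 := hF.arr 4 (by decide)
    simp at hI hj
    set w := s.a 3 (u * (n + 1) + k) with hw
    have huw : E u w := hG.nb_adj u hun k hk
    have hwn : w < n := hE.lt _ _ (hE.symm _ _ huw)
    have hm := hG.mat_eq hvn.le hwn
    simp only [hvn, true_imp_iff] at hm
    simp [e26, e27, e29, hsb, hsu, hsv, a0, a1, a3, a4, hG.row_eq v hvn.le, hG.row_eq u hun.le,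
      hj, ← hw, hV.row_lt hun.le (show k ≤ n by omega), hV.row_lt hvn.le hwn.le,
      hV.lt (show 0 ≤ n + 8 by omega), hV.lt (show 1 ≤ n + 8 by omega),
      hV.lt (show 2 ≤ n + 8 by omega), hV.lt (show b + 1 ≤ n + 8 by omega),
      hV.lt (show b + 2 ≤ n + 8 by omega)]
    have hskip : (X w → E v w → ¬ v < w) → TriInv n E X Y₀ b (t.a 13)
        (F ∨ ∃ i ≤ k, X (s.a 3 (u * (n + 1) + i)) ∧ E v (s.a 3 (u * (n + 1) + i)) ∧
          v < s.a 3 (u * (n + 1) + i)) := by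
      intro h
      refine hI.mono (Or.imp_right ?_)
      rintro ⟨i, hi, h1, h2, h3⟩
      rcases Nat.lt_or_eq_of_le hi with hi | rfl
      · exact ⟨i, hi, h1, h2, h3⟩
      · exact absurd h3 (h h1 h2)
    refine ⟨fun hmask => ⟨fun hmat => ⟨fun hvw => ?_, fun hvw => ?_⟩, fun hmat => ?_⟩,
      fun hmask => ?_⟩
    · refine hI.store hX' ⟨hv, hu, (hX w).2 ⟨hwn, hmask⟩, he, huw, ?_⟩ _
      exact (hm.2.1 (by omega)).resolve_left (by omega)
    · exact hskip fun _ _ => by omega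
    · refine hskip fun _ h => ?_
      have := hm.2.2 (.inr h)
      omega
    · refine hskip fun h => ?_
      have := ((hX w).1 h).2
      omega
  · intro t hF hI ht
    simp at hI ht ⊢
    refine ⟨hI.mono (Or.imp_right ?_), ?_⟩
    · rintro ⟨w, h1, h2, h3, h4⟩
      obtain ⟨j, hj, rfl⟩ := hG.nb_surj u w h2
      exact ⟨j, hj, h1, h3, h4⟩
    · omega

/-- Each of the `M` directed edges is extended by a scan of at most `n` neighbours. The fourth cell
always holds `n` and serves later as the branch that adds no vertex. -/
theorem tri_spec {s : St} {b : ℕ} (hV : V.Large n) (hE : IsGraph n E)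
    (hX : ∀ v, X v ↔ v < n ∧ 0 < s.a aMASK v) (hR : s.Rep n E M) (hb : b ≤ 4)
    (hsb : s.r rTb = b) :
    wp V tri (fun t => TriInv n E X (s.a aY) b (t.a aY) (∃ x y z, IsTriangle E X x y z) ∧
      t.time ≤ s.time + M * (9 * n + 10) + 5 * n + 6) s := by
  have hR' := hR
  obtain ⟨hN, hG⟩ := hR
  have hX' : ∀ v, X v → v < n := fun v h => ((hX v).1 h).1
  have hn := hV.lt (show n ≤ n + 8 by omega)
  dsimp at *
  simp only [tri]
  simp [hsb, hN,
      hV.lt (show 1 ≤ n + 8 by omega),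
      hV.lt (show 2 ≤ n + 8 by omega), hV.lt (show 3 ≤ n + 8 by omega),
      hV.lt (show b + 1 ≤ n + 8 by omega),
      hV.lt (show b + 2 ≤ n + 8 by omega), hV.lt (show b + 3 ≤ n + 8 by omega)]
  refine wp_for n (fun v => s.a 2 v * (9 * n + 10) + 4) (fun k t => TriInv n E X (s.a 13) b (t.a aY)
    (∃ v < k, ∃ u w, IsTriangle E X v u w ∧ v < w)) (by decide) hn ?_ ?_ ?_ ?_
  · constructor
    · intro i hi
      simp [Function.update_apply]
      split_ifs <;> omega
    · simp
    · intro i hi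
      simp [Function.update_apply]
      grind
    · simp
  · intro k hk t hF hI hj
    have e := hF.reg 0 (by decide)
    simp at e
    simp [e, hN]
  · intro v hv t hF hI hj
    have e0 := hF.reg 0 (by decide)
    have e26 := hF.reg 26 (by decide)
    have a0 := hF.arr 0 (by decide)
    have a1 := hF.arr 1 (by decide)
    have a2 := hF.arr 2 (by decide)
    have a3 := hF.arr 3 (by decide)
    have a4 := hF.arr 4 (by decide)
    simp at hI hj e0 e26 a0 a1 a2 a3 a4
    clear hF
    simp [hj, a4, hV.lt (show 0 ≤ n + 8 by omega)]
    refine ⟨fun hmask => ?_, fun hmask => ?_⟩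
    swap
    · refine hI.mono ?_
      rintro ⟨v', hv', u, w, h1, h2⟩
      rcases Nat.lt_or_eq_of_le hv' with hv' | rfl
      · exact ⟨v', hv', u, w, h1, h2⟩
      · have := ((hX _).1 h1.1).2
        omega
    have hXv : X v := (hX v).2 ⟨hv, hmask⟩
    have hdeg := hG.deg_le v hv
    refine wp_for (s.a 2 v) (fun _ => 9 * n + 7) (fun j t => TriInv n E X (s.a 13) b (t.a aY)
      ((∃ v' < v, ∃ u w, IsTriangle E X v' u w ∧ v' < w) ∨
        ∃ i < j, ∃ w, IsTriangle E X v (s.a 3 (v * (n + 1) + i)) w ∧ v < w)) (by decide)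
      (hV.lt (by omega)) (by simpa using hI) ?_ ?_ ?_
    · intro k hk t' hF hI hj'
      have e27 := hF.reg 27 (by decide)
      have c2 := hF.arr 2 (by decide)
      simp at e27 c2
      simp [e27, c2, a2, hj]
    · intro j hjd t' hF hI' hj'
      have f0 := hF.reg 0 (by decide)
      have f26 := hF.reg 26 (by decide)
      have f27 := hF.reg 27 (by decide)
      have c0 := hF.arr 0 (by decide)
      have c1 := hF.arr 1 (by decide)
      have c2 := hF.arr 2 (by decide)
      have c3 := hF.arr 3 (by decide)
      have c4 := hF.arr 4 (by decide)
      simp [e0, e26, hj, a0, a1, a2, a3, a4] at hI' hj' f0 f26 f27 c0 c1 c2 c3 c4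
      clear hF
      set u := s.a 3 (v * (n + 1) + j) with hu
      have hvu : E v u := hG.nb_adj v hv j hjd
      have hun : u < n := hE.lt _ _ (hE.symm _ _ hvu)
      simp [hj', f27, c0, c3, c4, hG.row_eq v hv.le, ← hu,
        hV.row_lt hv.le (show j ≤ n by omega), hV.lt (show 0 ≤ n + 8 by omega)]
      refine ⟨fun hmu => ?_, fun hmu => ⟨?_, by omega⟩⟩
      · refine (triEdge_spec (s := (t'.tick.assign 29 u).tick) (b := b) (v := v) (u := u) (X := X) (M := M) hV hE ?_ ?_ hb ?_ ?_ ?_ hXv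
          ((hX u).2 ⟨hun, hmu⟩) hvu (Y₀ := s.a 13) hI').mono ?_
        · simpa [c4] using hX
        · simpa [St.Rep, f0, c0, c1, c2, c3, hN] using hG
        · simpa [f26] using hsb
        · simpa using f27
        · simp
        · rintro t'' hF ⟨h1, h2⟩
          simp at h1 h2 ⊢
          refine ⟨h1.mono ?_, by omega⟩
          rintro (h | ⟨i, hi, w, hw⟩)
          · exact .inl (.inl h)
          · rcases Nat.lt_or_eq_of_le hi with hi | rfl
            · exact .inl (.inr ⟨i, hi, w, hw⟩)
            · exact .inr ⟨w, hw.1.2.2.1, hw.1.2.2.2.2.1, hw.1.2.2.2.2.2, hw.2⟩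
      · refine hI'.mono (Or.imp_right ?_)
        rintro ⟨i, hi, w, hw⟩
        rcases Nat.lt_or_eq_of_le hi with hi | rfl
        · exact ⟨i, hi, w, hw⟩
        · exact absurd hmu ((hX _).1 hw.1.2.1).2.ne'
    · intro t' hF hI' ht'
      simp at hI' ht' ⊢
      refine ⟨hI'.mono ?_, by
        have : s.a 2 v * (9 * n + 7 + 1) ≤ s.a 2 v * (9 * n + 10) := Nat.mul_le_mul_left _ (by omega)
        omega⟩
      rintro ⟨v', hv', u, w, h1, h2⟩
      rcases Nat.lt_or_eq_of_le hv' with hv' | rfl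
      · exact .inl ⟨v', hv', u, w, h1, h2⟩
      · obtain ⟨j, hj, rfl⟩ := hG.nb_surj _ u h1.2.2.2.1
        exact .inr ⟨j, hj, w, h1, h2⟩
  · intro t hF hI ht
    simp [Finset.sum_add_distrib, ← Finset.sum_mul, hG.sum_deg] at hI ht ⊢
    refine ⟨hI.mono ?_, by omega⟩
    rintro ⟨x, y, z, h⟩
    obtain ⟨h1, h2, h3, h4, h5, h6⟩ := h
    -- The scan only records triangles whose first vertex is smaller than the third; reversing a
    -- triangle achieves this.
    rcases lt_trichotomy x z with hxz | rfl | hxz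
    · exact ⟨x, hX' x h1, y, z, ⟨h1, h2, h3, h4, h5, h6⟩, hxz⟩
    · exact absurd h6 (hE.irrefl _)
    · exact ⟨z, hX' z h3, y, x, ⟨h3, h2, h1, hE.symm _ _ h5, hE.symm _ _ h4, hE.symm _ _ h6⟩, hxz⟩

end

/-! ### Extensions by at most two further vertices -/

section

@[simp] def rWl : ℕ := 32
@[simp] def rWx : ℕ := 33
@[simp] def rWk : ℕ := 34
@[simp] def rWj : ℕ := 35
@[simp] def rWu : ℕ := 36
@[simp] def rWi : ℕ := 37

/-- Append a vertex and its ancestors to the list in the array `aW` of length `rWl`. -/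
def pushChain (c : ℕ) : Cmd := .block [
  .assign rWx (.var c),
  .put aW (.var rWl) (.var rWx),
  .assign rWl (.add (.var rWl) (.const 1)),
  .loop (.get aD (.get aPAR (.var rWx))) (.get aD (.var rWx)) (.block [
    .assign rWx (.get aPAR (.var rWx)),
    .put aW (.var rWl) (.var rWx),
    .assign rWl (.add (.var rWl) (.const 1))])]

/-- Test all extensions by a vertex in the array `aW`, and possibly a neighbour of it in `aX`. -/
def tryLast : Cmd := .for rWk (.var rWl) (.block [
  .assign rT3 (.get aW (.var rWk)),
  .assign rT4 (.var rN),
  testExt,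
  .for rWj (.get aDEG (.var rT3)) (.block [
    .assign rWu (.cell aNB rT3 rWj),
    .ite (.const 0) (.get aX (.var rWu)) (.block [.assign rT4 (.var rWu), testExt]) .skip])])

/-- Look for an extension by at most two vertices besides `rT1`, `rT2`. -/
def lastTwo : Cmd := .block [
  .assign rT3 (.var rN),
  .assign rT4 (.var rN),
  mkMask,
  bfs,
  .ite (.const 0) (.var rCF)
    (.block [
      .for rWi (.var rN) (.put aX (.var rWi) (.get aMASK (.var rWi))),
      .assign rWl (.const 0),
      pushChain rCU,
      pushChain rCV,
      tryLast])
    (.assign rANS (.const 1))]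

variable {V : Env} {n M : ℕ} {E : ℕ → ℕ → Prop} {K X : ℕ → Prop}

/-- The level of the current vertex drops with every round. It is the termination measure, and it
bounds both the length and the time: `l + D` and `time + 4 * D` do not increase. The offset `l₀`
allows a second chain to be appended to the first. -/
theorem pushChain_spec {s : St} {c l₀ : ℕ} {RT : ℕ → ℕ} {cf cu cv : ℕ} (hX : ∀ v, X v → v < n)
    (H : BfsResult n E X (s.a aD) (s.a aPAR) RT cf cu cv) (hc : X (s.r c))
    (hl : s.r rWl = l₀) (hl₀ : l₀ ≤ n) (hn : 2 * n + 8 < V.bound) :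
    wp V (pushChain c) (fun t => (∃ l, t.r rWl = l₀ + l ∧
      IsChain (s.a aD) (s.a aPAR) (fun i => t.a aW (l₀ + i)) l (s.r c)) ∧
      (∀ i < l₀, t.a aW i = s.a aW i) ∧ t.time ≤ s.time + 4 * n + 4) s := by
  dsimp at *
  have hcn := hX _ hc
  have hDc := H.bound _ hc
  simp only [pushChain]
  simp [hl, show l₀ + 1 < V.bound by omega, show 1 < V.bound by omega]
  refine wp_loop (fun t => ∃ l, t.r rWl = l₀ + l ∧ 1 ≤ l ∧ t.a aW l₀ = s.r c ∧
    (∀ k, k + 1 < l → t.a aW (l₀ + (k + 1)) = s.a 7 (t.a aW (l₀ + k)) ∧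
      s.a 6 (s.a 7 (t.a aW (l₀ + k))) < s.a 6 (t.a aW (l₀ + k))) ∧
    t.a aW (l₀ + (l - 1)) = t.r rWx ∧ X (t.r rWx) ∧ l + s.a 6 (t.r rWx) ≤ 1 + n ∧
    (∀ i < l₀, t.a aW i = s.a aW i) ∧
    t.time + 4 * s.a 6 (t.r rWx) ≤ s.time + 3 + 4 * n) (fun t => s.a 6 (t.r rWx)) ?_ ?_ ?_ ?_
  · refine ⟨1, ?_⟩
    simp [hc]
    refine ⟨by omega, fun i hi => Function.update_of_ne (by omega) _ _, by omega⟩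
  · rintro t hF ⟨l, h1, h2, h3, h4, h5, h6, h7, h8, h9⟩
    simp
  · rintro t hF ⟨l, h1, h2, h3, h4, h5, h6, h7, h8, h9⟩ hlt
    have a6 := hF.arr 6 (by decide)
    have a7 := hF.arr 7 (by decide)
    simp at a6 a7 h1 h3 h4 h5 h6 h7 h8 h9 hlt
    rw [a6, a7] at hlt
    have := hX _ h6
    have hp : X (s.a 7 (t.r 33)) := by
      rcases H.par _ h6 with ⟨h, -⟩ | ⟨h, -⟩
      · rw [h] at hlt
        omega
      · exact h
    have hpn := hX _ hp
    simp [a7, h1, show l₀ + l + 1 < V.bound by omega, show 1 < V.bound by omega]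
    refine ⟨⟨l + 1, by omega, by omega, ?_, fun k hk => ?_, ?_, hp, by omega, fun i hi => ?_,
      by omega⟩, hlt⟩
    · rw [Function.update_of_ne (by omega), h3]
    · rw [Function.update_of_ne (a := l₀ + k) (by omega)]
      by_cases hkl : k + 1 = l
      · rw [hkl, Function.update_self]
        obtain rfl : k = l - 1 := by omega
        rw [h5]
        exact ⟨rfl, hlt⟩
      · rw [Function.update_of_ne (by omega)]
        exact h4 k (by omega)
    · rw [show l₀ + (l + 1 - 1) = l₀ + l by omega, Function.update_self]
    · rw [Function.update_of_ne (by omega), h8 i hi]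
  · rintro t hF ⟨l, h1, h2, h3, h4, h5, h6, h7, h8, h9⟩ hlt
    have a6 := hF.arr 6 (by decide)
    have a7 := hF.arr 7 (by decide)
    simp at a6 a7 h1 h3 h4 h5 h6 h7 h8 h9 hlt
    simp [h1]
    refine ⟨⟨h2, by simpa using h3, fun k hk => by simpa using h4 k hk, ?_⟩, h8, by omega⟩
    simp [h5]
    rwa [a6, a7] at hlt

-- A neighbour outside `X` costs only constant time, and a full test is run only for neighbours in
-- `X`. This is why the bound separates the degree from the number of neighbours in `X`.
open Classical in
theorem tryLast_spec {s : St} {a b L : ℕ} (hV : V.Large n) (hE : IsGraph n E) (hR : s.Rep n E M)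
    (hK : IsInd n K (s.a aK)) (h1 : s.r rT1 = a) (h2 : s.r rT2 = b) (ha : a ≤ n) (hb : b ≤ n)
    (hX : ∀ v, X v ↔ v < n ∧ 0 < s.a aX v) (hL : s.r rWl = L) (hLV : L < V.bound)
    (hW : ∀ k < L, s.a aW k < n) :
    wp V tryLast (fun t => (t.r rANS ≠ 0 ↔ s.r rANS ≠ 0 ∨ ∃ k < L,
        Bip E (Rest n E K (tset n a b (s.a aW k) n)) ∨
          ∃ u, (E (s.a aW k) u ∧ X u) ∧ Bip E (Rest n E K (tset n a b (s.a aW k) u))) ∧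
      t.time ≤ s.time + ∑ k ∈ Finset.range L, ((26 * (n + M) + 40) * (1 +
        ((Finset.range n).filter fun u => X u ∧ E (s.a aW k) u).card) + 4 * s.a aDEG (s.a aW k)) + 2)
      s := by
  dsimp at *
  simp only [tryLast]
  -- The loop rule adds one unit per round, which the truncated `- 1` compensates; the summand is
  -- positive.
  refine wp_for L (fun k => (26 * (n + M) + 40) * (1 +
    ((Finset.range n).filter fun u => X u ∧ E (s.a 12 k) u).card) + 4 * s.a 2 (s.a 12 k) - 1)
    (fun k t => t.r rANS ≠ 0 ↔ s.r rANS ≠ 0 ∨ ∃ i < k,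
      Bip E (Rest n E K (tset n a b (s.a 12 i) n)) ∨
        ∃ u, (E (s.a 12 i) u ∧ X u) ∧ Bip E (Rest n E K (tset n a b (s.a 12 i) u)))
    (by decide) hLV (by simp) ?_ ?_ ?_
  · intro k hk t hF hI hj
    have e := hF.reg 32 (by decide)
    simp [e, hL]
  · intro k hk t hF hI hj
    have e0 := hF.reg 0 (by decide)
    have e18 := hF.reg 18 (by decide)
    have e19 := hF.reg 19 (by decide)
    have a0 := hF.arr 0 (by decide)
    have a1 := hF.arr 1 (by decide)
    have a2 := hF.arr 2 (by decide)
    have a3 := hF.arr 3 (by decide)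
    have a5 := hF.arr 5 (by decide)
    have a11 := hF.arr 11 (by decide)
    have a12 := hF.arr 12 (by decide)
    clear hF
    simp at hI hj
    have hwn := hW k hk
    simp [hj]
    obtain ⟨w, hw⟩ : ∃ w, s.a 12 k = w := ⟨_, rfl⟩
    rw [a12, hw]
    rw [hw] at hwn
    have hRs := hR
    obtain ⟨hN, hG⟩ := hRs
    dsimp at hN hG
    refine (testExt_spec (s := ((t.tick.assign 20 w).assign 21 (t.r 0))) (E := E) (K := K) (M := M)
      hV hE ?_ ?_ rfl rfl rfl rfl ?_ ?_ ?_ ?_).mono ?_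
    · simpa [St.Rep, e0, a0, a1, a2, a3] using hR
    · simpa [a5] using hK
    · simp [e18, h1, ha]
    · simp [e19, h2, hb]
    · simpa using hwn.le
    · simp [e0, hN]
    rintro t₁ hF ⟨hans, ht₁⟩
    have f0 := hF.reg 0 (by decide)
    have f18 := hF.reg 18 (by decide)
    have f19 := hF.reg 19 (by decide)
    have f20 := hF.reg 20 (by decide)
    have c0 := hF.arr 0 (by decide)
    have c1 := hF.arr 1 (by decide)
    have c2 := hF.arr 2 (by decide)
    have c3 := hF.arr 3 (by decide)
    have c5 := hF.arr 5 (by decide)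
    have c11 := hF.arr 11 (by decide)
    clear hF
    simp [e0, e18, e19, h1, h2, hN] at hans ht₁ f0 f18 f19 f20
    simp [a0, a1, a2, a3, a5, a11] at c0 c1 c2 c3 c5 c11
    rw [hI] at hans
    have hdeg := hG.deg_le w hwn
    refine wp_for (s.a 2 w) (fun j => if X (s.a 3 (w * (n + 1) + j)) then 26 * (n + M) + 35 else 3)
      (fun j t => t.r rANS ≠ 0 ↔ t₁.r rANS ≠ 0 ∨ ∃ i < j, X (s.a 3 (w * (n + 1) + i)) ∧
        Bip E (Rest n E K (tset n a b w (s.a 3 (w * (n + 1) + i)))))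
      (by decide) (hV.lt (by omega)) (by simp) ?_ ?_ ?_
    · intro k hk t hF hI hj
      have e := hF.reg 20 (by decide)
      have a := hF.arr 2 (by decide)
      simp [e, a, f20, c2]
    · intro j hjd t₂ hF hI' hj'
      have e0 := hF.reg 0 (by decide)
      have e18 := hF.reg 18 (by decide)
      have e19 := hF.reg 19 (by decide)
      have e20 := hF.reg 20 (by decide)
      have d0 := hF.arr 0 (by decide)
      have d1 := hF.arr 1 (by decide)
      have d2 := hF.arr 2 (by decide)
      have d3 := hF.arr 3 (by decide)
      have d5 := hF.arr 5 (by decide)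
      have d11 := hF.arr 11 (by decide)
      clear hF
      simp at hI' hj' e0 e18 e19 e20 d0 d1 d2 d3 d5 d11
      rw [f0] at e0
      rw [f18] at e18
      rw [f19] at e19
      rw [f20] at e20
      rw [c0] at d0
      rw [c1] at d1
      rw [c2] at d2
      rw [c3] at d3
      rw [c5] at d5
      rw [c11] at d11
      obtain ⟨u, hu⟩ : ∃ u, s.a 3 (w * (n + 1) + j) = u := ⟨_, rfl⟩
      have hwu : E w u := hu ▸ hG.nb_adj w hwn j hjd
      have hun : u < n := hE.lt _ _ (hE.symm _ _ hwu)
      simp [e20, hj', d0, d3, d11, hG.row_eq w hwn.le, hu, hV.row_lt hwn.le (show j ≤ n by omega),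
        hV.lt (show 0 ≤ n + 8 by omega)]
      refine ⟨fun hxu => ?_, fun hxu => ?_⟩
      · have hXu : X u := (hX u).2 ⟨hun, hxu⟩
        refine (testExt_spec (s := (((t₂.tick.assign 36 u).tick).assign 21 u)) (E := E) (K := K)
          (M := M) hV hE ?_ ?_ rfl rfl rfl rfl ?_ ?_ ?_ ?_).mono ?_
        · simpa [St.Rep, e0, d0, d1, d2, d3, hN] using hG
        · simpa [d5] using hK
        · simp [e18, ha]
        · simp [e19, hb]
        · simp [e20, hwn.le]
        · simpa using hun.le
        · rintro t₃ hF ⟨g1, g2⟩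
          simp [e18, e19, e20] at g1 g2 ⊢
          rw [if_pos hXu]
          refine ⟨?_, by omega⟩
          rw [g1, hI']
          constructor
          · rintro ((h | ⟨i, hi, h⟩) | h)
            · exact .inl h
            · exact .inr ⟨i, hi.le, h⟩
            · exact .inr ⟨j, le_rfl, by rw [hu]; exact ⟨hXu, h⟩⟩
          · rintro (h | ⟨i, hi, h⟩)
            · exact .inl (.inl h)
            · rcases Nat.lt_or_eq_of_le hi with hi | rfl
              · exact .inl (.inr ⟨i, hi, h⟩)
              · exact .inr (hu ▸ h.2)
      · have hXu : ¬ X u := fun h => by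
          have := ((hX u).1 h).2
          omega
        rw [if_neg hXu]
        refine ⟨?_, by omega⟩
        rw [hI']
        refine or_congr_right ⟨fun ⟨i, hi, h⟩ => ⟨i, hi.le, h⟩, fun ⟨i, hi, h⟩ => ?_⟩
        rcases Nat.lt_or_eq_of_le hi with hi | rfl
        · exact ⟨i, hi, h⟩
        · exact absurd (hu ▸ h.1) hXu
    · intro t₂ hF hI' ht₂
      -- Neighbour lists have no repetitions, so tested list positions inject into neighbours in
      -- `X`.
      have hcard : ((Finset.range (s.a 2 w)).filter fun j => X (s.a 3 (w * (n + 1) + j))).card ≤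
          ((Finset.range n).filter fun u => X u ∧ E w u).card := by
        refine Finset.card_le_card_of_injOn (fun j => s.a 3 (w * (n + 1) + j)) ?_ ?_
        · intro j hj
          simp at hj ⊢
          exact ⟨((hX _).1 hj.2).1, hj.2, hG.nb_adj w hwn j hj.1⟩
        · intro i hi j hj
          simp at hi hj
          exact hG.nb_inj w hwn i hi.1 j hj.1
      have hsum : ∑ j ∈ Finset.range (s.a 2 w), ((if X (s.a 3 (w * (n + 1) + j)) then
          26 * (n + M) + 35 else 3) + 1) ≤ (26 * (n + M) + 40) *
          ((Finset.range n).filter fun u => X u ∧ E w u).card + 4 * s.a 2 w := by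
        refine (Finset.sum_le_sum (g := fun j => (if X (s.a 3 (w * (n + 1) + j)) then
          26 * (n + M) + 40 else 0) + 4) fun j _ => by split_ifs <;> omega).trans ?_
        rw [Finset.sum_add_distrib, ← Finset.sum_filter]
        simp only [Finset.sum_const, smul_eq_mul, Finset.card_range]
        have := Nat.mul_le_mul_right (26 * (n + M) + 40) hcard
        linarith
      simp at hI' ht₂ ⊢
      refine ⟨?_, ?_⟩
      · rw [hI', hans]
        constructor
        · rintro (((h | ⟨i, hi, h⟩) | h) | ⟨j, hj, h⟩)
          · exact .inl h
          · exact .inr ⟨i, hi.le, h⟩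
          · exact .inr ⟨k, le_rfl, .inl (by rwa [hw])⟩
          · refine .inr ⟨k, le_rfl, .inr ?_⟩
            rw [hw]
            exact ⟨_, ⟨hG.nb_adj w hwn j hj, h.1⟩, h.2⟩
        · rintro (h | ⟨i, hi, h⟩)
          · exact .inl (.inl (.inl h))
          · rcases Nat.lt_or_eq_of_le hi with hi | rfl
            · exact .inl (.inl (.inr ⟨i, hi, h⟩))
            · rw [hw] at h
              rcases h with h3 | ⟨u, ⟨h1, h2⟩, h3⟩
              · exact .inl (.inr h3)
              · obtain ⟨j, hj, rfl⟩ := hG.nb_surj _ _ h1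
                exact .inr ⟨j, hj, h2, h3⟩
      · rw [mul_add]
        omega
  · intro t hF hI ht
    refine ⟨hI, ?_⟩
    have : ∀ k ∈ Finset.range L, ((26 * (n + M) + 40) * (1 +
        ((Finset.range n).filter fun u => X u ∧ E (s.a 12 k) u).card) + 4 * s.a 2 (s.a 12 k) - 1) + 1 =
        (26 * (n + M) + 40) * (1 +
        ((Finset.range n).filter fun u => X u ∧ E (s.a 12 k) u).card) + 4 * s.a 2 (s.a 12 k) := by
      intro k _
      rw [mul_add]
      omega
    rw [Finset.sum_congr rfl this] at ht
    exact ht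

-- The factor `4` of `C * n` is `1 + 3`: at most `n` chain vertices tested alone, and at most `3 *
-- n` pairs with a neighbour.
open Classical in
theorem IsChain.sum_cost_le {D PR RT W : ℕ → ℕ} {l c cf cu cv : ℕ} (hW : IsChain D PR W l c)
    (H : BfsResult n E X D PR RT cf cu cv) (hc : X c) (hX : ∀ v, X v → v < n) (hE : IsGraph n E)
    (C : ℕ) (deg : ℕ → ℕ) : ∑ k ∈ Finset.range l,
      (C * (1 + ((Finset.range n).filter fun u => X u ∧ E (W k) u).card) + 4 * deg (W k)) ≤
      4 * (C * n) + 4 * ∑ v ∈ Finset.range n, deg v := by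
  have h1 := hW.length_le H hc hX
  have h2 := hW.sum_card_le H hc hE
  have h3 := hW.sum_le H hc hX deg
  rw [Finset.sum_add_distrib, ← Finset.mul_sum, ← Finset.mul_sum, Finset.sum_add_distrib]
  simp only [Finset.sum_const, Finset.card_range, smul_eq_mul, mul_one]
  have := Nat.mul_le_mul_left C (Nat.add_le_add h1 h2)
  linarith

theorem IsExt.exists_eq_tset {S : Finset ℕ} {a b w : ℕ} (hS : IsExt n E K S)
    (hT : tset n a b n n ⊆ S) (hcard : (S \ tset n a b n n).card ≤ 2)
    (hw : w ∈ S) (hwT : w ∉ tset n a b n n) :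
    S = tset n a b w n ∨
      ∃ u ∈ S, u ∉ tset n a b n n ∧ u ≠ w ∧ S = tset n a b w u := by
  have hwS : w ∈ S \ tset n a b n n := Finset.mem_sdiff.2 ⟨hw, hwT⟩
  have key : ∀ d, (∀ v, v ∈ S \ tset n a b n n ↔ v = w ∨ (v = d ∧ d < n)) →
      S = tset n a b w d := by
    intro d hd
    ext v
    by_cases hv : v ∈ tset n a b n n
    · refine ⟨fun _ => ?_, fun _ => hT hv⟩
      rw [mem_tset] at hv ⊢
      exact ⟨by have := hv.1; have := hv.2; omega, hv.2⟩
    · have h1 : v ∈ S ↔ v = w ∨ (v = d ∧ d < n) := by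
        rw [← hd, Finset.mem_sdiff, and_iff_left hv]
      have h2 := hS.lt w hw
      rw [h1]
      rw [mem_tset] at hv ⊢
      omega
  by_cases h : ∃ u ∈ S \ tset n a b n n, u ≠ w
  · obtain ⟨u, hu, hne⟩ := h
    refine .inr ⟨u, (Finset.mem_sdiff.1 hu).1, (Finset.mem_sdiff.1 hu).2, hne, key u fun v => ?_⟩
    have : S \ tset n a b n n = {w, u} := by
      symm
      refine Finset.eq_of_subset_of_card_le ?_ ?_
      · intro x hx
        simp only [Finset.mem_insert, Finset.mem_singleton] at hx
        rcases hx with rfl | rfl <;> assumption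
      · rwa [Finset.card_pair hne.symm]
    have h2 := hS.lt u (Finset.mem_sdiff.1 hu).1
    rw [this]
    simp [h2]
  · push Not at h
    refine .inl (key n fun v => ⟨fun hv => .inl (h v hv), ?_⟩)
    rintro (rfl | h)
    · exact hwS
    · omega

/-- If the rest is already bipartite, the answer is yes. Otherwise an extension must meet one of the
two chains of the conflicting edge in some `w`; its possible second vertex is adjacent to `w` and
outside the core, so it is among those tried. The factor `8` comes from two chains with `4 * n`
tests each. -/
theorem lastTwo_spec {s : St} {a b : ℕ} (hV : V.Large n) (hn : 2 * n + 8 < V.bound)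
    (hE : IsGraph n E) (hR : s.Rep n E M) (hK : IsInd n K (s.a aK)) (h1 : s.r rT1 = a)
    (h2 : s.r rT2 = b) (ha : a ≤ n) (hb : b ≤ n) :
    wp V lastTwo (fun t => (t.r rANS ≠ 0 → s.r rANS ≠ 0 ∨ ∃ T, Bip E (Rest n E K T)) ∧
      (s.r rANS ≠ 0 → t.r rANS ≠ 0) ∧
      (∀ S, IsExt n E K S → tset n a b n n ⊆ S → (S \ tset n a b n n).card ≤ 2 → t.r rANS ≠ 0) ∧
      t.time ≤ s.time + 8 * ((26 * (n + M) + 40) * n) + 60 * (n + M) + 60) s := by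
  obtain ⟨hN, hG⟩ := hR
  dsimp at hN hG
  have hb0 : 0 < V.bound := by omega
  have hb1 : 1 < V.bound := by omega
  have hnV : n < V.bound := by omega
  simp only [lastTwo]
  simp
  refine (mkMask_spec (s := (s.assign 20 (s.r 0)).assign 21 (s.r 0)) (E := E) (K := K) (M := M)
    hV ?_ ?_ h1 h2 rfl rfl ha hb ?_ ?_).mono ?_
  · simpa [St.Rep, hN] using hG
  · simpa using hK
  · simp [hN]
  · simp [hN]
  rintro t₁ hF ⟨hX, ht₁⟩
  have e0 := hF.reg 0 (by decide)
  have e1 := hF.reg 1 (by decide)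
  have e18 := hF.reg 18 (by decide)
  have e19 := hF.reg 19 (by decide)
  have a0 := hF.arr 0 (by decide)
  have a1 := hF.arr 1 (by decide)
  have a2 := hF.arr 2 (by decide)
  have a3 := hF.arr 3 (by decide)
  have a5 := hF.arr 5 (by decide)
  clear hF
  simp [hN] at e0 e1 e18 e19 a0 a1 a2 a3 a5 hX ht₁
  refine (bfs_spec (M := M) hV hE hX ?_).mono ?_
  · simpa [St.Rep, e0, a0, a1, a2, a3] using hG
  rintro t₂ hF ⟨hB, ht₂⟩
  have f0 := (hF.reg 0 (by decide)).trans e0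
  have f1 := (hF.reg 1 (by decide)).trans e1
  have f18 := (hF.reg 18 (by decide)).trans e18
  have f19 := (hF.reg 19 (by decide)).trans e19
  have c0 := (hF.arr 0 (by decide)).trans a0
  have c1 := (hF.arr 1 (by decide)).trans a1
  have c2 := (hF.arr 2 (by decide)).trans a2
  have c3 := (hF.arr 3 (by decide)).trans a3
  have c4 := hF.arr 4 (by decide)
  have c5 := (hF.arr 5 (by decide)).trans a5
  clear hF e0 e1 e18 e19 a0 a1 a2 a3 a5
  have hX' : ∀ v, Rest n E K (tset n a b n n) v → v < n := fun v h => h.1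
  simp [hb0, hb1]
  refine ⟨fun hcf => ?_, fun hcf => ⟨.inr ⟨_, hB.bip hcf⟩, by omega⟩⟩
  obtain ⟨hcu, hcv, -⟩ := hB.conf hcf.ne'
  dsimp [St.BfsResult] at hB hcu hcv
  -- The set outside the core is saved in `aX`, and below the chains in `aW`, because every later
  -- test overwrites the mask and the search data.
  refine wp_for n (fun _ => 2) (fun j t => ∀ v < j, t.a aX v = t₂.a aMASK v) (by decide) hnV
    (by simp) ?_ ?_ ?_
  · intro k hk t hF hI hj
    have e0 := hF.reg 0 (by decide)
    simp at e0
    simp [e0, f0]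
  · intro k hk t hF hI hj
    have a4 := hF.arr 4 (by decide)
    simp at hI hj a4 ⊢
    intro v hv
    simp only [Function.update_apply, hj, a4]
    split_ifs with h
    · rw [h]
    · exact hI v (by omega)
  intro t₃ hF hI ht₃
  have g0 := (hF.reg 0 (by decide)).trans f0
  have g1 := (hF.reg 1 (by decide)).trans f1
  have g12 := hF.reg 12 (by decide)
  have g13 := hF.reg 13 (by decide)
  have g18 := (hF.reg 18 (by decide)).trans f18
  have g19 := (hF.reg 19 (by decide)).trans f19
  have d0 := (hF.arr 0 (by decide)).trans c0
  have d1 := (hF.arr 1 (by decide)).trans c1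
  have d2 := (hF.arr 2 (by decide)).trans c2
  have d3 := (hF.arr 3 (by decide)).trans c3
  have d5 := (hF.arr 5 (by decide)).trans c5
  have d6 := hF.arr 6 (by decide)
  have d7 := hF.arr 7 (by decide)
  clear hF f0 f1 f18 f19 c0 c1 c2 c3 c5
  simp [c4] at hI ht₃ g12 g13 d6 d7
  rw [← g12] at hcu
  rw [← g13] at hcv
  rw [← d6, ← d7] at hB
  refine (pushChain_spec (s := (t₃.tick.assign 32 0)) (c := 12) (l₀ := 0) hX' hB hcu (by simp)
    (Nat.zero_le _) hn).mono ?_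
  rintro t₄ hF ⟨⟨l, hl, hW⟩, -, ht₄⟩
  have e0 := hF.reg 0 (by decide)
  have e1 := hF.reg 1 (by decide)
  have e13 := hF.reg 13 (by decide)
  have e18 := hF.reg 18 (by decide)
  have e19 := hF.reg 19 (by decide)
  have a0 := hF.arr 0 (by decide)
  have a1 := hF.arr 1 (by decide)
  have a2 := hF.arr 2 (by decide)
  have a3 := hF.arr 3 (by decide)
  have a5 := hF.arr 5 (by decide)
  have a6 := hF.arr 6 (by decide)
  have a7 := hF.arr 7 (by decide)
  have a11 := hF.arr 11 (by decide)
  clear hF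
  simp [g0, g1, g18, g19, d0, d1, d2, d3, d5] at e0 e1 e13 e18 e19 a0 a1 a2 a3 a5 a6 a7 a11 hl hW ht₄
  have hln := hW.length_le hB hcu hX'
  rw [← e13] at hcv
  have hB' := hB
  rw [← a6, ← a7] at hB'
  refine (pushChain_spec (s := t₄) (c := 13) hX' hB' hcv hl hln hn).mono ?_
  rintro t₅ hF ⟨⟨l', hl', hW'⟩, hold, ht₅⟩
  have f0 := (hF.reg 0 (by decide)).trans e0
  have f1 := (hF.reg 1 (by decide)).trans e1
  have f18 := (hF.reg 18 (by decide)).trans e18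
  have f19 := (hF.reg 19 (by decide)).trans e19
  have c0 := (hF.arr 0 (by decide)).trans a0
  have c1 := (hF.arr 1 (by decide)).trans a1
  have c2 := (hF.arr 2 (by decide)).trans a2
  have c3 := (hF.arr 3 (by decide)).trans a3
  have c5 := (hF.arr 5 (by decide)).trans a5
  have c11 := (hF.arr 11 (by decide)).trans a11
  clear hF
  dsimp only [aD, aPAR] at hW'
  rw [a6, a7] at hW'
  simp at hl' hold
  have hl'n := hW'.length_le hB hcv hX'
  -- Appending the second chain leaves the first `l` cells unchanged.
  replace hW : IsChain (t₃.a 6) (t₃.a 7) (t₅.a 12) l (t₃.r 12) := by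
    have hpos := hW.pos
    refine ⟨hpos, ?_, fun k hk => ?_, ?_⟩
    · rw [hold 0 (by omega), hW.start]
    · rw [hold k (by omega), hold (k + 1) (by omega)]
      exact hW.next k hk
    · rw [hold (l - 1) (by omega)]
      exact hW.last
  have hWX : ∀ k < l + l', Rest n E K (tset n a b n n) (t₅.a 12 k) := by
    intro k hk
    by_cases hkl : k < l
    · exact (hW.level hB hcu k hkl).1
    · obtain ⟨j, rfl⟩ := Nat.exists_eq_add_of_le (not_lt.1 hkl)
      exact (hW'.level hB hcv j (by omega)).1
  classical
  refine (tryLast_spec (s := t₅) (a := a) (b := b) (L := l + l') (E := E) (K := K) (M := M)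
    (X := Rest n E K (tset n a b n n)) hV hE ?_ ?_ ?_ ?_ ha hb ?_ hl' (by omega)
    fun k hk => (hWX k hk).1).mono ?_
  · simpa [St.Rep, f0, c0, c1, c2, c3] using hG
  · simpa [c5] using hK
  · simpa [f18] using h1
  · simpa [f19] using h2
  · intro v
    rw [hX]
    refine and_congr_right fun hv => ?_
    simp [c11, hI v hv]
  rintro t₆ hF ⟨hans, ht₆⟩
  clear hF
  have s1 := hW.sum_cost_le hB hcu hX' hE (26 * (n + M) + 40) (s.a 2)
  have s2 := hW'.sum_cost_le hB hcv hX' hE (26 * (n + M) + 40) (s.a 2)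
  rw [hG.sum_deg] at s1 s2
  simp [c2, f1] at hans ht₆
  rw [Finset.sum_range_add] at ht₆
  refine ⟨fun h => ?_, fun h => ?_, fun S hS hT hcard => ?_, ?_⟩
  · rcases hans.1 h with h | ⟨k, hk, h | ⟨u, -, h⟩⟩
    · exact .inl h
    · exact .inr ⟨_, h⟩
    · exact .inr ⟨_, h⟩
  · exact hans.2 (.inl h)
  · refine hans.2 (.inr ?_)
    obtain ⟨k, hk, hkS⟩ : ∃ k < l + l', t₅.a 12 k ∈ S := by
      rw [g12] at hW
      rw [e13, g13] at hW'
      rcases hB.exists_mem_chain (by omega) hW hW' (· ∈ S) (hS.bip_rest hT) with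
        ⟨k, hk, h⟩ | ⟨k, hk, h⟩
      · exact ⟨k, by omega, h⟩
      · exact ⟨l + k, by omega, h⟩
    refine ⟨k, hk, ?_⟩
    have hkT := hS.notMem_of_rest hT (hWX k hk)
    rcases hS.exists_eq_tset hT hcard hkS hkT with h | ⟨u, hu, huT, hne, h⟩
    · left
      rw [← h]
      exact hS.bip
    · refine .inr ⟨u, ⟨hS.clique _ hkS _ hu hne.symm, hS.rest hu huT⟩, ?_⟩
      rw [← h]
      exact hS.bip
  · have := ht₆.trans (Nat.add_le_add_right (Nat.add_le_add_left (Nat.add_le_add s1 s2) _) _)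
    omega

end

/-! ### The search tree -/

section

@[simp] def rM1 : ℕ := 38
@[simp] def rM2 : ℕ := 39

/-- Look for a triangle outside the core of `rT1`, `rT2`. -/
def restTri : Cmd := .block [
  .assign rT3 (.var rN),
  .assign rT4 (.var rN),
  mkMask,
  tri]

/-- Look for an extension that contains `rT1` and at most three other vertices. -/
def lastThree : Cmd := .block [
  .assign rT2 (.var rN),
  .assign rTb (.const 4),
  restTri,
  .for rM2 (.const 4) (.block [
    .assign rT2 (.get aY (.add (.const 4) (.var rM2))),
    lastTwo])]

/-- Look for an extension. -/
def search : Cmd := .block [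
  .assign rT1 (.var rN),
  .assign rT2 (.var rN),
  .assign rTb (.const 0),
  restTri,
  .for rM1 (.const 4) (.block [
    .assign rT1 (.get aY (.var rM1)),
    lastThree])]

/-- Some extension contains `T` and at most `m` other vertices. -/
def Completes (n : ℕ) (E : ℕ → ℕ → Prop) (K : ℕ → Prop) (T : Finset ℕ) (m : ℕ) : Prop :=
  ∃ S, IsExt n E K S ∧ T ⊆ S ∧ (S \ T).card ≤ m

variable {V : Env} {n M : ℕ} {E : ℕ → ℕ → Prop} {K X : ℕ → Prop}

/-- One branching step. If more than two vertices are missing, a triangle was stored, and the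
extension contains one of its vertices, which is not yet in `T`. If at most two are missing, the
cell with value `n` leaves `T` as it is, and the weaker bound `m ≥ 2` already holds. -/
theorem Completes.exists_index {T : Finset ℕ} {m b : ℕ} {Y₀ Y : ℕ → ℕ}
    (h : Completes n E K T (m + 1)) (hm : 2 ≤ m)
    (hY : TriInv n E (Rest n E K T) Y₀ b Y (∃ x y z, IsTriangle E (Rest n E K T) x y z)) :
    ∃ i < 4, ∀ T', (∀ v, v ∈ T' ↔ v ∈ T ∨ v = Y (b + i) ∧ v < n) → Completes n E K T' m := by
  obtain ⟨S, hS, hTS, hcard⟩ := h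
  have key : ∀ y ∈ S, y ∉ T → ∀ T', (∀ v, v ∈ T' ↔ v ∈ T ∨ v = y ∧ v < n) →
      Completes n E K T' m := by
    intro y hyS hyT T' hT'
    have hT : T' = insert y T := by
      ext v
      rw [hT', Finset.mem_insert, or_comm]
      have := hS.lt y hyS
      refine or_congr_left ⟨fun h => h.1, ?_⟩
      rintro rfl
      exact ⟨rfl, this⟩
    refine ⟨S, hS, ?_, ?_⟩
    · rw [hT]
      exact Finset.insert_subset hyS hTS
    · rw [hT, Finset.sdiff_insert, Finset.card_erase_of_mem (Finset.mem_sdiff.2 ⟨hyS, hyT⟩)]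
      omega
  by_cases hc : 2 < (S \ T).card
  · obtain ⟨x, y, z, h⟩ := hS.exists_triangle hc
    obtain ⟨h1, h2, h3, h4, h5, h6⟩ := hY.found ⟨x, y, z, h⟩
    rcases hS.mem_of_triangle hTS h1 h2 h3 h4 h5 h6 with h | h | h
    · exact ⟨0, by omega, key _ h (hS.notMem_of_rest hTS h1)⟩
    · exact ⟨1, by omega, key _ h (hS.notMem_of_rest hTS h2)⟩
    · exact ⟨2, by omega, key _ h (hS.notMem_of_rest hTS h3)⟩
  · refine ⟨3, by omega, fun T' hT' => ?_⟩
    obtain rfl : T' = T := by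
      ext v
      rw [hT', hY.last]
      refine or_iff_left ?_
      omega
    exact ⟨S, hS, hTS, by omega⟩

theorem restTri_spec {s : St} {a b i : ℕ} (hV : V.Large n) (hE : IsGraph n E)
    (hR : s.Rep n E M) (hK : IsInd n K (s.a aK)) (h1 : s.r rT1 = a) (h2 : s.r rT2 = b) (ha : a ≤ n)
    (hb : b ≤ n) (hi : i ≤ 4) (hsi : s.r rTb = i) :
    wp V restTri (fun t => TriInv n E (Rest n E K (tset n a b n n)) (s.a aY) i (t.a aY)
        (∃ x y z, IsTriangle E (Rest n E K (tset n a b n n)) x y z) ∧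
      t.time ≤ s.time + M * (9 * n + 10) + 11 * n + 20) s := by
  obtain ⟨hN, hG⟩ := hR
  dsimp at hN hG hsi
  simp only [restTri]
  simp
  refine (mkMask_spec (s := (s.assign 20 (s.r 0)).assign 21 (s.r 0)) (E := E) (K := K) (M := M)
    hV ?_ ?_ h1 h2 rfl rfl ha hb ?_ ?_).mono ?_
  · simpa [St.Rep, hN] using hG
  · simpa using hK
  · simp [hN]
  · simp [hN]
  rintro t₁ hF ⟨hX, ht₁⟩
  have e0 := hF.reg 0 (by decide)
  have e26 := hF.reg 26 (by decide)
  have a0 := hF.arr 0 (by decide)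
  have a1 := hF.arr 1 (by decide)
  have a2 := hF.arr 2 (by decide)
  have a3 := hF.arr 3 (by decide)
  have a13 := hF.arr 13 (by decide)
  clear hF
  simp [hN] at e0 e26 a0 a1 a2 a3 a13 hX ht₁
  refine (tri_spec (b := i) (M := M) hV hE hX ?_ hi ?_).mono ?_
  · simpa [St.Rep, e0, a0, a1, a2, a3] using hG
  · simp [e26, hsi]
  · rintro t₂ - ⟨h1, h2⟩
    simp [a13] at h1
    exact ⟨h1, by omega⟩

/-- The inner triangle is stored from cell `4` on, so the cells below `4`, over which the outer loop
still runs, survive. -/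
theorem lastThree_spec {s : St} {a : ℕ} (hV : V.Large n) (hn : 2 * n + 8 < V.bound)
    (hE : IsGraph n E) (hR : s.Rep n E M) (hK : IsInd n K (s.a aK)) (h1 : s.r rT1 = a)
    (ha : a ≤ n) :
    wp V lastThree (fun t => (t.r rANS ≠ 0 → s.r rANS ≠ 0 ∨ ∃ T, Bip E (Rest n E K T)) ∧
      (s.r rANS ≠ 0 → t.r rANS ≠ 0) ∧
      (Completes n E K (tset n a n n n) 3 → t.r rANS ≠ 0) ∧
      (∀ i < 4, t.a aY i = s.a aY i) ∧
      t.time ≤ s.time + 32 * ((26 * (n + M) + 40) * n) + M * (9 * n + 10) + 260 * (n + M) + 290)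
      s := by
  obtain ⟨hN, hG⟩ := hR
  dsimp at hN hG h1
  have hb4 : 4 < V.bound := hV.lt (by omega)
  simp only [lastThree]
  simp [hb4]
  refine (restTri_spec (s := (s.assign 19 (s.r 0)).assign 26 4) (E := E) (K := K) (M := M) (a := a)
    (b := n) (i := 4) hV hE ?_ ?_ ?_ ?_ ha ?_ ?_ ?_).mono ?_
  · simpa [St.Rep, hN] using hG
  · simpa using hK
  · simpa using h1
  · simp [hN]
  · simp
  · simp
  · simp
  rintro t₁ hF ⟨hY, ht₁⟩
  have e0 := hF.reg 0 (by decide)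
  have e1 := hF.reg 1 (by decide)
  have e18 := hF.reg 18 (by decide)
  have a0 := hF.arr 0 (by decide)
  have a1 := hF.arr 1 (by decide)
  have a2 := hF.arr 2 (by decide)
  have a3 := hF.arr 3 (by decide)
  have a5 := hF.arr 5 (by decide)
  clear hF
  simp [hN, h1] at e0 e1 e18 a0 a1 a2 a3 a5 hY ht₁
  refine wp_for 4 (fun _ => 8 * ((26 * (n + M) + 40) * n) + 60 * (n + M) + 62)
    (fun k t => (t.r rANS ≠ 0 → s.r rANS ≠ 0 ∨ ∃ T, Bip E (Rest n E K T)) ∧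
      (s.r rANS ≠ 0 → t.r rANS ≠ 0) ∧
      (∀ i < k, Completes n E K (tset n a (t₁.a 13 (4 + i)) n n) 2 → t.r rANS ≠ 0))
    (by decide) hb4 ?_ ?_ ?_ ?_
  · simpa [e1] using fun h => Or.inl h
  · intro k hk t hF hI hj
    simp [hb4]
  · rintro k hk t hF ⟨hs, hm, hc⟩ hj
    have f0 := (hF.reg 0 (by decide)).trans e0
    have f18 := (hF.reg 18 (by decide)).trans e18
    have c0 := (hF.arr 0 (by decide)).trans a0
    have c1 := (hF.arr 1 (by decide)).trans a1
    have c2 := (hF.arr 2 (by decide)).trans a2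
    have c3 := (hF.arr 3 (by decide)).trans a3
    have c5 := (hF.arr 5 (by decide)).trans a5
    have c13 := hF.arr 13 (by decide)
    clear hF
    simp at hs hm hc hj
    simp [hj, hb4, c13, hV.lt (show 4 + k ≤ n + 8 by omega)]
    refine (lastTwo_spec (s := t.tick.assign 19 (t₁.a 13 (4 + k))) (E := E) (K := K) (M := M)
      (a := a) (b := t₁.a 13 (4 + k)) hV hn hE ?_ ?_ ?_ ?_ ha (hY.le k hk)).mono ?_
    · simpa [St.Rep, f0, c0, c1, c2, c3] using hG
    · simpa [c5] using hK
    · simpa using f18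
    · simp
    rintro u - ⟨g1, g2, g3, g4⟩
    simp at g1 g2 g3 g4 ⊢
    refine ⟨⟨fun h => ?_, fun h => g2 (hm h), fun i hi => ?_⟩, by omega⟩
    · exact (g1 h).elim hs .inr
    · rcases Nat.lt_or_eq_of_le hi with hi | rfl
      · exact fun h => g2 (hc i hi h)
      · rintro ⟨S, h1, h2, h3⟩
        exact g3 S h1 h2 h3
  · rintro t hF ⟨hs, hm, hc⟩ ht
    have c13 := hF.arr 13 (by decide)
    simp at hs hm hc ht
    simp [c13]
    refine ⟨hs, hm, fun h => ?_, fun i hi => hY.out i hi, ?_⟩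
    · obtain ⟨i, hi, h⟩ := h.exists_index le_rfl hY
      refine hc i hi (h _ fun v => ?_)
      simp only [mem_tset]
      omega
    · linarith

/-- Two levels of branching bring the number of missing vertices from four to two. There are only `4
* 4` leaves, so the cost stays within a constant factor of one leaf plus the triangle searches. -/
theorem search_spec {s : St} (hV : V.Large n) (hn : 2 * n + 8 < V.bound) (hE : IsGraph n E)
    (hR : s.Rep n E M) (hK : IsInd n K (s.a aK)) (hKmax : IsMaxClique n E K)
    (hans : s.r rANS = 0) :
    wp V search (fun t => (t.r rANS ≠ 0 ↔ TwoOne n E) ∧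
      t.time ≤ s.time + 4000 * ((n + M + 2) * (n + 1))) s := by
  obtain ⟨hN, hG⟩ := hR
  dsimp at hN hG hans
  have hb4 : 4 < V.bound := hV.lt (by omega)
  simp only [search]
  simp [show 0 < V.bound by omega]
  refine (restTri_spec (s := ((s.assign 18 (s.r 0)).assign 19 (s.r 0)).assign 26 0) (E := E) (K := K)
    (M := M) (a := n) (b := n) (i := 0) hV hE ?_ ?_ ?_ ?_ le_rfl le_rfl ?_ ?_).mono ?_
  · simpa [St.Rep, hN] using hG
  · simpa using hK
  · simp [hN]
  · simp [hN]
  · simp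
  · simp
  rintro t₁ hF ⟨hY, ht₁⟩
  have e0 := hF.reg 0 (by decide)
  have e1 := hF.reg 1 (by decide)
  have a0 := hF.arr 0 (by decide)
  have a1 := hF.arr 1 (by decide)
  have a2 := hF.arr 2 (by decide)
  have a3 := hF.arr 3 (by decide)
  have a5 := hF.arr 5 (by decide)
  clear hF
  simp [hN, hans] at e0 e1 a0 a1 a2 a3 a5 hY ht₁
  refine wp_for 4
    (fun _ => 32 * ((26 * (n + M) + 40) * n) + M * (9 * n + 10) + 260 * (n + M) + 292)
    (fun k t => (t.r rANS ≠ 0 → ∃ T, Bip E (Rest n E K T)) ∧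
      (∀ i < k, Completes n E K (tset n (t₁.a 13 i) n n n) 3 → t.r rANS ≠ 0) ∧
      ∀ i < 4, t.a aY i = t₁.a 13 i)
    (by decide) hb4 ?_ ?_ ?_ ?_
  · simp [e1]
  · intro k hk t hF hI hj
    simp [hb4]
  · rintro k hk t hF ⟨hs, hc, hy⟩ hj
    have f0 := (hF.reg 0 (by decide)).trans e0
    have c0 := (hF.arr 0 (by decide)).trans a0
    have c1 := (hF.arr 1 (by decide)).trans a1
    have c2 := (hF.arr 2 (by decide)).trans a2
    have c3 := (hF.arr 3 (by decide)).trans a3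
    have c5 := (hF.arr 5 (by decide)).trans a5
    clear hF
    simp at hs hc hj hy
    simp [hj, hy k hk]
    have hle := hY.le k hk
    simp at hle
    refine (lastThree_spec (s := t.tick.assign 18 (t₁.a 13 k)) (E := E) (K := K) (M := M)
      (a := t₁.a 13 k) hV hn hE ?_ ?_ ?_ hle).mono ?_
    · simpa [St.Rep, f0, c0, c1, c2, c3] using hG
    · simpa [c5] using hK
    · simp
    rintro u - ⟨g1, g2, g3, g4, g5⟩
    simp at g1 g2 g3 g4 g5 ⊢
    refine ⟨⟨fun h => ?_, fun i hi => ?_, fun i hi => (g4 i hi).trans (hy i hi)⟩, ?_⟩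
    · exact (g1 h).elim hs id
    · rcases Nat.lt_or_eq_of_le hi with hi | rfl
      · exact fun h => g2 (hc i hi h)
      · exact g3
    · linarith
  · rintro t hF ⟨hs, hc, -⟩ ht
    simp at hs hc ht ⊢
    refine ⟨⟨fun h => ?_, fun h => ?_⟩, ?_⟩
    · obtain ⟨T, hT⟩ := hs h
      exact .of_bip hE hKmax hT
    · obtain ⟨S, hS⟩ := h.exists_isExt hKmax
      -- With all four arguments equal to `n` the set `tset` is empty, so any extension completes
      -- it.
      have hS0 : Completes n E K (tset n n n n n) (3 + 1) := by
        refine ⟨S, hS, fun v hv => ?_, ?_⟩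
        · rw [mem_tset] at hv
          omega
        · exact (Finset.card_le_card Finset.sdiff_subset).trans hS.card
      obtain ⟨i, hi, h⟩ := hS0.exists_index (by omega) hY
      refine hc i hi (h _ fun v => ?_)
      simp only [mem_tset, zero_add]
      omega
    · ring_nf at ht ht₁ ⊢
      omega

end

/-! ### Building the graph or its complement from the input -/

section

/-- Store the row `rV` of the matrix, and the neighbours of `rV`, in the graph (if `f` is `0`) or its
complement (if `f` is `1`). -/
def buildRow (f : ℕ) : Cmd := .block [
  .for rU (.var rN) (.put aM (.add (.get aROW (.var rV)) (.var rU)) (.const f)),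
  .assign rP (.inp (.add (.var rV) (.const 1))),
  .loop (.var rP) (.inp (.add (.var rV) (.const 2))) (.block [
    .put aM (.add (.get aROW (.var rV)) (.inp (.var rP))) (.const (1 - f)),
    .assign rP (.add (.var rP) (.const 1))]),
  .put aM (.add (.get aROW (.var rV)) (.var rV)) (.const 0),
  .assign rJ (.const 0),
  .for rU (.var rN) (.ite (.const 0) (.cell aM rV rU)
    (.block [
      .put aNB (.add (.get aROW (.var rV)) (.var rJ)) (.var rU),
      .assign rJ (.add (.var rJ) (.const 1))])
    .skip),
  .put aDEG (.var rV) (.var rJ),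
  .put aM (.add (.get aROW (.var rV)) (.var rV)) (.const 1)]

/-- Store the input graph (if `f` is `0`) or its complement (if `f` is `1`). -/
def build (f : ℕ) : Cmd := .block [
  .assign rN (.inp (.const 0)),
  .assign rX (.const 0),
  .for rV (.add (.var rN) (.const 1)) (.block [
    .put aROW (.var rV) (.var rX),
    .assign rX (.add (.var rX) (.add (.var rN) (.const 1)))]),
  .for rV (.var rN) (buildRow f),
  .for rU (.var rN) (.put aM (.add (.get aROW (.var rN)) (.var rU)) (.const 1))]

/-- The input consists of adjacency lists for `A`. -/
structure IsInput (V : Env) (n : ℕ) (A : ℕ → ℕ → Prop) : Prop where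
  size : V.inp 0 = n
  le_len : n + 2 ≤ V.len
  end_le : ∀ v < n, V.inp (v + 2) ≤ V.len
  start_le : ∀ v < n, V.inp (v + 1) ≤ V.inp (v + 2)
  le_start : ∀ v < n, V.inp (v + 2) ≤ V.inp (v + 1) + n
  mem_iff : ∀ v < n, ∀ u, A v u ↔ ∃ p, V.inp (v + 1) ≤ p ∧ p < V.inp (v + 2) ∧ V.inp p = u
  lt : ∀ v u, A v u → u < n
  len_lt : V.len < V.bound

/-- The graph `A` (if `f` is `0`) or its complement (if `f` is `1`). -/
def Flip (n f : ℕ) (A : ℕ → ℕ → Prop) (v u : ℕ) : Prop :=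
  v < n ∧ u < n ∧ v ≠ u ∧ (A v u ↔ f = 0)

/-- The row `v` of the representation of a graph. -/
structure IsRow (n : ℕ) (E : ℕ → ℕ → Prop) (mat deg nb : ℕ → ℕ) (v : ℕ) : Prop where
  mat_one : ∀ u < n, v = u ∨ E v u → mat (v * (n + 1) + u) = 1
  mat_zero : ∀ u < n, ¬ (v = u ∨ E v u) → mat (v * (n + 1) + u) = 0
  deg_le : deg v ≤ n
  nb_adj : ∀ j < deg v, E v (nb (v * (n + 1) + j))
  nb_surj : ∀ u, E v u → ∃ j < deg v, nb (v * (n + 1) + j) = u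
  nb_inj : ∀ i < deg v, ∀ j < deg v, nb (v * (n + 1) + i) = nb (v * (n + 1) + j) → i = j

variable {V : Env} {n f : ℕ} {A E : ℕ → ℕ → Prop}

/-- Rows occupy consecutive blocks of length `n + 1`, so row `v` is unaffected by writes at or
beyond the start of row `v + 1`. -/
theorem IsRow.congr {mat deg nb mat' deg' nb' : ℕ → ℕ} {v : ℕ} (h : IsRow n E mat deg nb v)
    (hm : ∀ i < (v + 1) * (n + 1), mat' i = mat i) (hd : deg' v = deg v)
    (hn : ∀ i < (v + 1) * (n + 1), nb' i = nb i) : IsRow n E mat' deg' nb' v := by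
  have hle := h.deg_le
  have key : ∀ u, u < n → v * (n + 1) + u < (v + 1) * (n + 1) := fun u hu => by
    rw [add_mul]
    omega
  constructor
  · intro u hu
    rw [hm _ (key u hu)]
    exact h.mat_one u hu
  · intro u hu
    rw [hm _ (key u hu)]
    exact h.mat_zero u hu
  · rwa [hd]
  · intro j hj
    rw [hd] at hj
    rw [hn _ (key j (by omega))]
    exact h.nb_adj j hj
  · intro u hu
    rw [hd]
    obtain ⟨j, hj, h⟩ := h.nb_surj u hu
    exact ⟨j, hj, by rw [hn _ (key j (by omega)), h]⟩
  · intro i hi j hj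
    rw [hd] at hi hj
    rw [hn _ (key i (by omega)), hn _ (key j (by omega))]
    exact h.nb_inj i hi j hj

/-- The row is filled with `f` and the listed neighbours are overwritten with `1 - f`, which costs
$O(n)$ since a list has at most `n` entries. The neighbour list is then read off the row, for the
graph and for its complement alike. -/
theorem buildRow_spec {s : St} {k : ℕ} (hV : V.Large n) (hA : IsInput V n A) (hf : f ≤ 1)
    (hN : s.r rN = n) (hk : k < n) (hsk : s.r rV = k) (hrow : s.a aROW k = k * (n + 1)) :
    wp V (buildRow f) (fun t => IsRow n (Flip n f A) (t.a aM) (t.a aDEG) (t.a aNB) k ∧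
      (∀ i < k * (n + 1), t.a aM i = s.a aM i ∧ t.a aNB i = s.a aNB i) ∧
      (∀ v < k, t.a aDEG v = s.a aDEG v) ∧ t.time ≤ s.time + 11 * n + 12) s := by
  classical
  have b0 := hV.lt (show 0 ≤ n + 8 by omega)
  have b1 := hV.lt (show 1 ≤ n + 8 by omega)
  have b2 := hV.lt (show 2 ≤ n + 8 by omega)
  have hn := hV.lt (show n ≤ n + 8 by omega)
  have hfV := hV.lt (show f ≤ n + 8 by omega)
  have hfV' := hV.lt (show 1 - f ≤ n + 8 by omega)
  dsimp at *
  simp only [buildRow, wp_block_cons]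
  refine wp_for n (fun _ => 2) (fun j t => (∀ u < j, t.a aM (k * (n + 1) + u) = f) ∧
    ∀ i < k * (n + 1), t.a aM i = s.a aM i) (of_decide_eq_true rfl) hn (by simp) ?_ ?_ ?_
  · intro j hj t hF hI hjt
    have e := hF.reg 0 (of_decide_eq_true rfl)
    simp [e, hN]
  · rintro j hj t hF ⟨h1, h2⟩ hjt
    have e2 := hF.reg 2 (of_decide_eq_true rfl)
    have a0 := hF.arr 0 (of_decide_eq_true rfl)
    simp at h1 h2 hjt ⊢
    simp [e2, hsk, a0, hrow, hjt, hV.row_lt hk.le hj.le, hfV]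
    refine ⟨fun u hu => ?_, fun i hi => ?_⟩
    · by_cases huj : u = j
      · rw [huj, Function.update_self]
      · rw [Function.update_of_ne (by omega)]
        exact h1 u (by omega)
    · rw [Function.update_of_ne (by omega), h2 i hi]
  rintro t₁ hF ⟨h1, h2⟩ ht₁
  have e0 := (hF.reg 0 (of_decide_eq_true rfl)).trans hN
  have e2 := (hF.reg 2 (of_decide_eq_true rfl)).trans hsk
  have a0 := hF.arr 0 (of_decide_eq_true rfl)
  have a2 := hF.arr 2 (of_decide_eq_true rfl)
  have a3 := hF.arr 3 (of_decide_eq_true rfl)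
  clear hF
  have hlen := hA.le_len
  have hstart := hA.start_le k hk
  have hend := hA.end_le k hk
  have hle := hA.le_start k hk
  have hlenV := hA.len_lt
  simp at h1 h2 ht₁
  simp [e2, b1, hV.lt (show k + 1 ≤ n + 8 by omega), show k + 1 < V.len by omega]
  refine wp_loop (fun t => V.inp (k + 1) ≤ t.r rP ∧ t.r rP ≤ V.inp (k + 2) ∧
    (∀ u < n, t.a aM (k * (n + 1) + u) = if ∃ p, V.inp (k + 1) ≤ p ∧ p < t.r rP ∧ V.inp p = u
      then 1 - f else f) ∧ (∀ i < k * (n + 1), t.a aM i = s.a aM i) ∧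
      t.time ≤ s.time + 3 * n + 3 + 3 * (t.r rP - V.inp (k + 1)))
    (fun t => V.inp (k + 2) - t.r rP) ?_ ?_ ?_ ?_
  · simp
    refine ⟨hstart, fun u hu => ?_, h2, by omega⟩
    rw [h1 u hu, if_neg]
    rintro ⟨p, hp, hp', -⟩
    omega
  · rintro t hF -
    have f2 := hF.reg 2 (of_decide_eq_true rfl)
    simp [e2] at f2
    simp [f2, b2, hV.lt (show k + 2 ≤ n + 8 by omega)]
    omega
  · rintro t hF ⟨g1, g2, g3, g4, g5⟩ hlt
    have f2 := hF.reg 2 (of_decide_eq_true rfl)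
    have c0 := hF.arr 0 (of_decide_eq_true rfl)
    simp [e2] at f2
    simp [a0] at c0
    simp [f2] at hlt g1 g2 g3 g4 g5
    have hAp : A k (V.inp (t.r 5)) := (hA.mem_iff k hk _).2 ⟨_, g1, hlt, rfl⟩
    have hpn := hA.lt _ _ hAp
    simp [f2, c0, hrow, hV.row_lt hk.le hpn.le, hfV', b1, show t.r 5 < V.len by omega,
      show t.r 5 + 1 < V.bound by omega]
    refine ⟨⟨by omega, by omega, fun u hu => ?_, fun i hi => ?_, by omega⟩, by omega⟩
    · by_cases huj : u = V.inp (t.r 5)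
      · rw [huj, Function.update_self, if_pos ⟨t.r 5, g1, le_rfl, rfl⟩]
      · rw [Function.update_of_ne (by omega), g3 u hu]
        refine if_congr ⟨?_, ?_⟩ rfl rfl
        · rintro ⟨p, h1, h2, h3⟩
          exact ⟨p, h1, by omega, h3⟩
        · rintro ⟨p, h1, h2, h3⟩
          refine ⟨p, h1, lt_of_le_of_ne h2 ?_, h3⟩
          rintro rfl
          exact huj h3.symm
    · rw [Function.update_of_ne (by omega), g4 i hi]
  rintro t₂ hF ⟨g1, g2, g3, g4, g5⟩ hge
  have f0 := hF.reg 0 (of_decide_eq_true rfl)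
  have f2 := hF.reg 2 (of_decide_eq_true rfl)
  have c0 := hF.arr 0 (of_decide_eq_true rfl)
  have c2 := hF.arr 2 (of_decide_eq_true rfl)
  have c3 := hF.arr 3 (of_decide_eq_true rfl)
  clear hF
  simp [e0, e2] at f0 f2
  simp [a0, a2, a3] at c0 c2 c3
  simp [f2] at hge g1 g2 g3 g4 g5
  obtain hp : t₂.r 5 = V.inp (k + 2) := by omega
  simp only [hp, ← hA.mem_iff k hk] at g3
  simp [f2, c0, hrow, hV.row_lt hk.le hk.le, b0]
  -- While neighbours are collected the diagonal is zero, so that a vertex is not listed as its own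
  -- neighbour; it becomes one only at the end.
  have hm : ∀ u < n, Function.update (t₂.a 1) (k * (n + 1) + k) 0 (k * (n + 1) + u) =
      if Flip n f A k u then 1 else 0 := by
    intro u hu
    by_cases huk : u = k
    · rw [huk, Function.update_self, if_neg fun h => h.2.2.1 rfl]
    · rw [Function.update_of_ne (by omega), g3 u hu]
      simp only [Flip, hk, hu, Ne.symm huk, true_and, ne_eq, not_false_eq_true]
      split_ifs with h5 h6 h6 <;> simp only [h5, true_iff, false_iff] at h6 <;> omega
  have hm' : ∀ i < k * (n + 1), Function.update (t₂.a 1) (k * (n + 1) + k) 0 i = s.a 1 i := by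
    intro i hi
    rw [Function.update_of_ne (by omega), g4 i hi]
  generalize hmat : Function.update (t₂.a 1) (k * (n + 1) + k) 0 = mat at hm hm'
  set t₃ := ((t₂.tick.put 1 (k * (n + 1) + k) 0).assign 6 0) with ht₃
  have k0 : t₃.r 0 = n := by simp [ht₃, f0]
  have k2 : t₃.r 2 = k := by simp [ht₃, f2]
  have k6 : t₃.r 6 = 0 := by simp [ht₃]
  have l0 : t₃.a 0 = s.a 0 := by simp [ht₃, c0]
  have l1 : t₃.a 1 = mat := by simp [ht₃, hmat]
  have l2 : t₃.a 2 = s.a 2 := by simp [ht₃, c2]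
  have l3 : t₃.a 3 = s.a 3 := by simp [ht₃, c3]
  have htime : t₃.time ≤ s.time + 6 * n + 6 := by simp [ht₃]; omega
  clear_value t₃
  refine wp_for n (fun _ => 4) (fun j t => t.r rJ ≤ j ∧
    (∀ i < t.r rJ, t.a aNB (k * (n + 1) + i) < j ∧ Flip n f A k (t.a aNB (k * (n + 1) + i))) ∧
    (∀ i < t.r rJ, ∀ i' < t.r rJ, t.a aNB (k * (n + 1) + i) = t.a aNB (k * (n + 1) + i') → i = i') ∧
    (∀ u < j, Flip n f A k u → ∃ i < t.r rJ, t.a aNB (k * (n + 1) + i) = u) ∧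
    ∀ i < k * (n + 1), t.a aNB i = s.a aNB i) (of_decide_eq_true rfl) hn ?_ ?_ ?_ ?_
  · simp [k6, l3]
  · intro j hj t hF hI hjt
    have e := hF.reg 0 (of_decide_eq_true rfl)
    simp [e, k0]
  · rintro j hj t hF ⟨h1, h2, h3, h4, h5⟩ hjt
    have m2 := (hF.reg 2 (of_decide_eq_true rfl)).trans k2
    have o0 := (hF.arr 0 (of_decide_eq_true rfl)).trans l0
    have o1 := (hF.arr 1 (of_decide_eq_true rfl)).trans l1
    clear hF
    simp at h1 h2 h3 h4 h5 hjt
    obtain ⟨r, hr⟩ : ∃ r, t.r 6 = r := ⟨_, rfl⟩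
    simp only [hr] at h1 h2 h3 h4
    simp [m2, o0, o1, hrow, hjt, hm j hj, hr, b0, b1, hV.row_lt hk.le hj.le,
      hV.row_lt hk.le (show r ≤ n by omega), hV.lt (show r + 1 ≤ n + 8 by omega)]
    by_cases hAj : Flip n f A k j
    · simp [hAj]
      refine ⟨h1, fun i hi => ?_, fun i hi i' hi' => ?_, fun u hu hAu => ?_, fun i hi => ?_⟩
      · by_cases hir : i = r
        · rw [hir, Function.update_self]
          exact ⟨le_rfl, hAj⟩
        · rw [Function.update_of_ne (by omega)]
          have := h2 i (by omega)
          exact ⟨this.1.le, this.2⟩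
      · by_cases hir : i = r <;> by_cases hir' : i' = r
        · omega
        · rw [hir, Function.update_self, Function.update_of_ne (by omega)]
          have := h2 i' (by omega)
          omega
        · rw [hir', Function.update_self, Function.update_of_ne (by omega)]
          have := h2 i (by omega)
          omega
        · rw [Function.update_of_ne (by omega), Function.update_of_ne (by omega)]
          exact h3 i (by omega) i' (by omega)
      · rcases Nat.lt_or_eq_of_le hu with hu | rfl
        · obtain ⟨i, hi, rfl⟩ := h4 u hu hAu
          exact ⟨i, by omega, Function.update_of_ne (by omega) _ _⟩
        · exact ⟨r, le_rfl, Function.update_self _ _ _⟩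
      · rw [Function.update_of_ne (by omega), h5 i hi]
    · simp [hAj]
      refine ⟨by omega, fun i hi => ⟨(h2 i hi).1.le, (h2 i hi).2⟩, h3, fun u hu hAu => ?_, h5⟩
      rcases Nat.lt_or_eq_of_le hu with hu | rfl
      · exact h4 u hu hAu
      · exact absurd hAu hAj
  · rintro t hF ⟨h1, h2, h3, h4, h5⟩ ht
    have m2 := (hF.reg 2 (of_decide_eq_true rfl)).trans k2
    have o0 := (hF.arr 0 (of_decide_eq_true rfl)).trans l0
    have o1 := (hF.arr 1 (of_decide_eq_true rfl)).trans l1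
    have o2 := (hF.arr 2 (of_decide_eq_true rfl)).trans l2
    clear hF
    simp at h1 h2 h3 h4 h5 ht
    obtain ⟨r, hr⟩ : ∃ r, t.r 6 = r := ⟨_, rfl⟩
    simp only [hr] at h1 h2 h3 h4
    simp [m2, o0, o1, o2, hrow, hr, hV.row_lt hk.le hk.le]
    refine ⟨⟨fun u hu h => ?_, fun u hu h => ?_, ?_, ?_, ?_, ?_⟩, fun i hi => ⟨?_, h5 i hi⟩,
      fun v hv => Function.update_of_ne (by omega) _ _, by omega⟩
    · by_cases huk : k = u
      · rw [huk, Function.update_self]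
      · rw [Function.update_of_ne (by omega), hm u hu, if_pos (h.resolve_left huk)]
    · rw [not_or] at h
      rw [Function.update_of_ne (by omega), hm u hu, if_neg h.2]
    · simpa using h1
    · simpa using fun j hj => (h2 j hj).2
    · simpa using fun u hu => h4 u hu.2.1 hu
    · simpa using h3
    · rw [Function.update_of_ne (by omega), hm' i hi]

theorem build_spec {s : St} (hV : V.Large n) (hA : IsInput V n A) (hf : f ≤ 1) :
    wp V (build f) (fun t => (∃ M, t.Rep n (Flip n f A) M) ∧
      t.time ≤ s.time + 20 * ((n + 1) * (n + 1))) s := by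
  have b0 := hV.lt (show 0 ≤ n + 8 by omega)
  have b1 := hV.lt (show 1 ≤ n + 8 by omega)
  have hn := hV.lt (show n ≤ n + 8 by omega)
  have hn1 := hV.lt (show n + 1 ≤ n + 8 by omega)
  have hlen := hA.le_len
  simp only [build]
  simp [hA.size, b0, show 0 < V.len by omega]
  -- Row addresses are obtained by repeated addition, as the machine does not multiply. There are `n
  -- + 1` rows, including the row of ones for the pseudo-vertex.
  refine wp_for (n + 1) (fun _ => 3) (fun j t => t.r rX = j * (n + 1) ∧
    ∀ v < j, t.a aROW v = v * (n + 1)) (of_decide_eq_true rfl) hn1 (by simp) ?_ ?_ ?_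
  · intro j hj t hF hI hjt
    have e := hF.reg 0 (of_decide_eq_true rfl)
    simp at e
    simp [e, b1, hn1]
  · rintro j hj t hF ⟨h1, h2⟩ hjt
    have e := hF.reg 0 (of_decide_eq_true rfl)
    simp at e h1 h2 hjt
    have hb : j * (n + 1) + (n + 1) < V.bound := by
      have := Nat.mul_le_mul_right (n + 1) hj
      unfold Env.Large at hV
      linarith
    simp [e, b1, hn1, h1, hjt, hb]
    refine ⟨by ring, fun v hv => ?_⟩
    by_cases hvj : v = j
    · rw [hvj, Function.update_self]
    · rw [Function.update_of_ne hvj]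
      exact h2 v (by omega)
  rintro t₁ hF ⟨-, hrow⟩ ht₁
  have e0 := hF.reg 0 (of_decide_eq_true rfl)
  clear hF
  simp at e0 hrow ht₁
  refine wp_for n (fun _ => 11 * n + 13) (fun k t => ∀ v < k,
    IsRow n (Flip n f A) (t.a aM) (t.a aDEG) (t.a aNB) v) (of_decide_eq_true rfl) hn (by simp) ?_ ?_ ?_
  · intro j hj t hF hI hjt
    have e := hF.reg 0 (of_decide_eq_true rfl)
    simp at e
    simp [e, e0]
  · intro k hk t hF hI hj
    have f0 := (hF.reg 0 (of_decide_eq_true rfl)).trans e0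
    have a0 := hF.arr 0 (of_decide_eq_true rfl)
    simp at a0
    refine (buildRow_spec (s := t.tick) (f := f) hV hA hf ?_ hk ?_ ?_).mono ?_
    · simpa using f0
    · simpa using hj
    · simpa [a0] using hrow k hk.le
    · rintro u - ⟨h1, h2, h3, h4⟩
      simp at h1 h2 h3 h4 hI ⊢
      refine ⟨fun v hv => ?_, by omega⟩
      rcases Nat.lt_or_eq_of_le hv with hv | rfl
      · have hle : (v + 1) * (n + 1) ≤ k * (n + 1) := Nat.mul_le_mul_right _ hv
        exact (hI v hv).congr (fun i hi => (h2 i (by omega)).1) (h3 v hv)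
          fun i hi => (h2 i (by omega)).2
      · exact h1
  intro t₂ hF hI ht₂
  have f0 := (hF.reg 0 (of_decide_eq_true rfl)).trans e0
  have c0 := hF.arr 0 (of_decide_eq_true rfl)
  clear hF
  simp at hI ht₂ c0
  refine wp_for n (fun _ => 2) (fun j t => (∀ v < n,
    IsRow n (Flip n f A) (t.a aM) (t₂.a aDEG) (t₂.a aNB) v) ∧
    ∀ u < j, t.a aM (n * (n + 1) + u) = 1) (of_decide_eq_true rfl) hn (by simpa using hI) ?_ ?_ ?_
  · intro j hj t hF hI hjt
    have e := hF.reg 0 (of_decide_eq_true rfl)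
    simp at e
    simp [e, f0]
  · rintro j hj t hF ⟨h1, h2⟩ hjt
    have m0 := (hF.reg 0 (of_decide_eq_true rfl)).trans f0
    have o0 := (hF.arr 0 (of_decide_eq_true rfl)).trans c0
    clear hF
    simp at h1 h2 hjt m0 o0
    simp [m0, o0, hrow n le_rfl, hjt, b1, hV.row_lt le_rfl hj.le]
    refine ⟨fun v hv => (h1 v hv).congr (fun i hi => Function.update_of_ne ?_ _ _) rfl
      fun _ _ => rfl, fun u hu => ?_⟩
    · have : (v + 1) * (n + 1) ≤ n * (n + 1) := Nat.mul_le_mul_right _ hv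
      omega
    · by_cases huj : u = j
      · rw [huj, Function.update_self]
      · rw [Function.update_of_ne (by omega)]
        exact h2 u (by omega)
  · rintro t hF ⟨h1, h2⟩ ht
    have m0 := (hF.reg 0 (of_decide_eq_true rfl)).trans f0
    have o0 := (hF.arr 0 (of_decide_eq_true rfl)).trans c0
    have o2 := hF.arr 2 (of_decide_eq_true rfl)
    have o3 := hF.arr 3 (of_decide_eq_true rfl)
    clear hF
    simp at h1 h2 ht m0 o0 o2 o3
    simp [m0, o0, o2, o3]
    refine ⟨⟨_, ⟨hrow, fun v hv => (h1 v hv).mat_one, fun v hv => (h1 v hv).mat_zero, h2,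
      fun v hv => (h1 v hv).deg_le, fun v hv => (h1 v hv).nb_adj,
      fun v u h => (h1 v h.1).nb_surj u h, fun v hv => (h1 v hv).nb_inj, rfl⟩⟩, ?_⟩
    ring_nf at ht ht₁ ht₂ ⊢
    omega

end

/-! ### Correctness and running time for simple graphs -/

section

/-- Decide whether the input graph (if `f` is `0`) or its complement (if `f` is `1`) is a
`(2, 1)`-graph. -/
def solve (f : ℕ) : Cmd := .block [build f, greedy, search]

/-- Adjacency of vertices that are given as natural numbers. -/
def NatAdj {n : ℕ} (G : SimpleGraph (Fin n)) (v u : ℕ) : Prop :=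
  ∃ (hv : v < n) (hu : u < n), G.Adj ⟨v, hv⟩ ⟨u, hu⟩

variable {V : Env} {n f M : ℕ} {A E : ℕ → ℕ → Prop} {G : SimpleGraph (Fin n)}

theorem natAdj_val {v u : Fin n} : NatAdj G v u ↔ G.Adj v u := by
  simp [NatAdj]

theorem isGraph_natAdj (G : SimpleGraph (Fin n)) : IsGraph n (NatAdj G) where
  symm := fun _ _ ⟨hu, hv, h⟩ => ⟨hv, hu, h.symm⟩
  irrefl := fun _ ⟨_, _, h⟩ => G.irrefl h
  lt := fun _ _ ⟨hu, _, _⟩ => hu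

theorem flip_zero (G : SimpleGraph (Fin n)) : Flip n 0 (NatAdj G) = NatAdj G := by
  ext v u
  constructor
  · rintro ⟨-, -, -, h⟩
    exact h.2 rfl
  · intro h
    have ⟨hv, hu, h'⟩ := h
    exact ⟨hv, hu, fun he => h'.ne (Fin.ext he), iff_of_true h rfl⟩

theorem flip_one (G : SimpleGraph (Fin n)) : Flip n 1 (NatAdj G) = NatAdj Gᶜ := by
  ext v u
  constructor
  · rintro ⟨hv, hu, hne, h⟩
    refine ⟨hv, hu, ?_⟩
    rw [SimpleGraph.compl_adj]
    exact ⟨fun he => hne (congrArg Fin.val he), fun ha => one_ne_zero (h.1 ⟨hv, hu, ha⟩)⟩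
  · rintro ⟨hv, hu, h⟩
    rw [SimpleGraph.compl_adj] at h
    exact ⟨hv, hu, fun he => h.1 (Fin.ext he),
      iff_of_false (fun ⟨_, _, h'⟩ => h.2 h') one_ne_zero⟩

/-- The clique part is `C`, and the two independent parts are the colour classes outside `C`. -/
theorem twoOne_natAdj : TwoOne n (NatAdj G) ↔ G.IsKLGraph 2 1 := by
  classical
  constructor
  · rintro ⟨C, hC, col, hcol⟩
    refine ⟨fun v => if C v then .inr 0 else .inl (if col v then 0 else 1), fun i => ?_,
      fun j => ?_⟩
    · intro u hu v hv hne ha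
      simp only [Set.mem_preimage, Set.mem_singleton_iff] at hu hv
      have hCu : ¬ C u := fun h => by simp [h] at hu
      have hCv : ¬ C v := fun h => by simp [h] at hv
      rw [if_neg hCu] at hu
      rw [if_neg hCv] at hv
      refine hcol u v ⟨u.2, hCu⟩ ⟨v.2, hCv⟩ (natAdj_val.2 ha) ?_
      have := Sum.inl_injective (hu.trans hv.symm)
      revert this
      generalize col u = x
      generalize col v = y
      revert x y
      decide
    · intro u hu v hv hne
      simp only [Set.mem_preimage, Set.mem_singleton_iff] at hu hv
      split_ifs at hu with hCu
      split_ifs at hv with hCv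
      exact natAdj_val.1 (hC u v hCu hCv fun he => hne (Fin.ext he))
  · rintro ⟨part, hI, hC⟩
    refine ⟨fun v => ∃ hv : v < n, part ⟨v, hv⟩ = .inr 0, ?_,
      fun v => decide (∃ hv : v < n, part ⟨v, hv⟩ = .inl 0), ?_⟩
    · rintro u v ⟨hu, hu'⟩ ⟨hv, hv'⟩ hne
      exact ⟨hu, hv, hC 0 hu' hv' fun he => hne (congrArg Fin.val he)⟩
    · rintro u v ⟨hu, hu'⟩ ⟨hv, hv'⟩ ⟨_, _, ha⟩ heq
      have key : ∀ w, ∀ hw : w < n, (¬ ∃ hw : w < n, part ⟨w, hw⟩ = .inr 0) →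
          ∃ i, part ⟨w, hw⟩ = .inl i := by
        intro w hw h
        match hp : part ⟨w, hw⟩ with
        | .inl i => exact ⟨i, rfl⟩
        | .inr j => exact absurd ⟨hw, hp.trans (congrArg _ (Subsingleton.elim j 0))⟩ h
      obtain ⟨i, hi⟩ := key u hu hu'
      obtain ⟨j, hj⟩ := key v hv hv'
      have hij : i = j := by
        simp only [hu, hv, hi, hj, exists_true_left, Sum.inl.injEq, decide_eq_decide] at heq
        omega
      subst hij
      exact hI i hi hj ha.ne ha

/-- Complementation exchanges independent sets and cliques; the other direction applies the same to
the complement. -/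
theorem isKLGraph_compl {W : Type*} {k l : ℕ} {H : SimpleGraph W} :
    Hᶜ.IsKLGraph k l ↔ H.IsKLGraph l k := by
  have key : ∀ {k l : ℕ} {H : SimpleGraph W}, H.IsKLGraph k l → Hᶜ.IsKLGraph l k := by
    rintro k l H ⟨part, hI, hC⟩
    have hl : ∀ j, (fun v => (part v).swap) ⁻¹' {Sum.inl j} = part ⁻¹' {Sum.inr j} := by
      intro j
      ext v
      cases h : part v <;> simp [h]
    have hr : ∀ i, (fun v => (part v).swap) ⁻¹' {Sum.inr i} = part ⁻¹' {Sum.inl i} := by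
      intro i
      ext v
      cases h : part v <;> simp [h]
    refine ⟨fun v => (part v).swap, fun j => ?_, fun i => ?_⟩
    · rw [hl, SimpleGraph.isIndepSet_compl]
      exact hC j
    · rw [hr, SimpleGraph.isClique_compl]
      exact hI i
  exact ⟨fun h => compl_compl H ▸ key h, key⟩

/-- The handshake lemma: the list of `v` enumerates its neighbours without repetition, so `deg v` is
the degree. -/
theorem IsRep.eq_two_mul_ncard {row mat deg nb : ℕ → ℕ}
    (h : IsRep n (NatAdj G) M row mat deg nb) : M = 2 * G.edgeSet.ncard := by
  classical
  rw [← h.sum_deg, Set.ncard_eq_toFinset_card', ← SimpleGraph.edgeFinset,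
    ← SimpleGraph.sum_degrees_eq_twice_card_edges, Finset.sum_range]
  refine Finset.sum_congr rfl fun v _ => ?_
  have : (Finset.range (deg v)).image (fun j => nb (v * (n + 1) + j)) =
      (G.neighborFinset v).map Fin.valEmbedding := by
    ext u
    simp only [Finset.mem_image, Finset.mem_range, Finset.mem_map, SimpleGraph.mem_neighborFinset,
      Fin.valEmbedding_apply]
    constructor
    · rintro ⟨j, hj, rfl⟩
      obtain ⟨_, hu, ha⟩ := h.nb_adj v v.2 j hj
      exact ⟨_, ha, rfl⟩
    · rintro ⟨w, ha, rfl⟩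
      exact h.nb_surj v w (natAdj_val.2 ha)
  rw [← SimpleGraph.card_neighborFinset_eq_degree, ← Finset.card_map Fin.valEmbedding, ← this,
    Finset.card_image_of_injOn, Finset.card_range]
  intro i hi j hj
  simp only [Finset.coe_range, Set.mem_Iio] at hi hj
  exact h.nb_inj v v.2 i hi j hj

theorem solve_spec {s : St} {H : SimpleGraph (Fin n)} (hV : V.Large n) (hn : 2 * n + 8 < V.bound)
    (hA : IsInput V n A) (hf : f ≤ 1) (hH : Flip n f A = NatAdj H) (hK : ∀ v, s.a aK v = 0)
    (hans : s.r rANS = 0) (hs : s.time = 0) :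
    wp V (solve f) (fun t => (t.r rANS ≠ 0 ↔ H.IsKLGraph 2 1) ∧
      t.time ≤ 17000 * (n * (n + H.edgeSet.ncard) + 1)) s := by
  have hE := isGraph_natAdj H
  simp only [solve, wp_block_cons, wp_block_nil]
  refine (build_spec hV hA hf).mono ?_
  rintro t₁ hF ⟨⟨M, hR⟩, ht₁⟩
  rw [hH] at hR
  have e1 := hF.reg rANS (of_decide_eq_true rfl)
  have a5 := hF.arr aK (of_decide_eq_true rfl)
  clear hF
  refine (greedy_spec hV hE hR (by rwa [a5])).mono ?_
  rintro t₂ hF ⟨⟨K, hKmax, hInd⟩, ht₂⟩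
  have f0 := hF.reg 0 (by decide)
  have f1 := (hF.reg rANS (by decide)).trans e1
  have c0 := hF.arr 0 (by decide)
  have c1 := hF.arr 1 (by decide)
  have c2 := hF.arr 2 (by decide)
  have c3 := hF.arr 3 (by decide)
  clear hF
  have hM := hR.2.eq_two_mul_ncard
  refine (search_spec (M := M) hV hn hE ?_ hInd hKmax (f1.trans hans)).mono ?_
  · simpa [St.Rep, f0, c0, c1, c2, c3] using hR
  rintro t₃ - ⟨h1, ht₃⟩
  refine ⟨h1.trans twoOne_natAdj, ?_⟩
  -- The bound has no separate term for `M`; it is absorbed into `n * M`, and for `n = 0` there are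
  -- no edges.
  have hMn : M ≤ n * M := by
    rcases n.eq_zero_or_pos with rfl | hpos
    · rw [← hR.2.sum_deg]
      simp
    · exact Nat.le_mul_of_pos_left _ hpos
  have hnn : n ≤ n * n := Nat.le_mul_self n
  rw [hM] at ht₂ ht₃ hMn
  generalize H.edgeSet.ncard = m at *
  nlinarith

/-! ### The layout of the input words -/

theorem listStart_succ (adj : Fin n → List (Fin n)) (v : Fin n) :
    listStart adj (v + 1) = listStart adj v + (adj v).length := by
  have key : ∑ u : Fin n, (if (u : ℕ) < v + 1 then (adj u).length else 0) =
      ∑ u : Fin n, ((if (u : ℕ) < v then (adj u).length else 0) +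
        if u = v then (adj u).length else 0) := by
    refine Finset.sum_congr rfl fun u _ => ?_
    by_cases h : u = v
    · simp [h]
    · have : (u : ℕ) ≠ v := fun he => h (Fin.ext he)
      have : (u : ℕ) < v + 1 ↔ (u : ℕ) < v := by omega
      simp [h, this]
  rw [listStart, listStart, key, Finset.sum_add_distrib, ← add_assoc]
  simp

theorem getD_flatMap_finRange {n : ℕ} (g : Fin n → List ℕ) (v : Fin n) {j : ℕ}
    (hj : j < (g v).length) :
    ((List.finRange n).flatMap g).getD ((∑ u : Fin n, if (u : ℕ) < v then (g u).length else 0) + j) 0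
      = (g v)[j] := by
  induction n with
  | zero => exact v.elim0
  | succ n ih =>
    rw [List.finRange_succ, List.flatMap_cons, List.flatMap_map, Fin.sum_univ_succ]
    cases v using Fin.cases with
    | zero =>
      rw [List.getD_append _ _ _ _ (by simpa using hj), List.getD_eq_getElem _ _ (by simpa using hj)]
      simp
    | succ w =>
      have := ih (fun u => g u.succ) w hj
      rw [← this, add_assoc, List.getD_append_right _ _ _ _ (by simp)]
      simp

theorem length_encode (adj : Fin n → List (Fin n)) : (encode adj).length = listStart adj n := by
  simp [encode, listStart, List.length_flatMap, Fin.sum_univ_def]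
  omega

theorem getD_encode_start (adj : Fin n → List (Fin n)) {v : ℕ} (hv : v ≤ n) :
    (encode adj).getD (v + 1) 0 = listStart adj v := by
  rw [encode, List.getD_cons_succ, List.getD_append _ _ _ _ (by simp; omega),
    List.getD_eq_getElem _ _ (by simp; omega)]
  simp

theorem getD_encode_list (adj : Fin n → List (Fin n)) (v : Fin n) {j : ℕ}
    (hj : j < (adj v).length) : (encode adj).getD (listStart adj v + j) 0 = (adj v)[j] := by
  have := getD_flatMap_finRange (fun u => (adj u).map Fin.val) v (j := j) (by simpa using hj)
  simp only [List.length_map, List.getElem_map] at this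
  rw [← this, listStart, show ∀ a, n + 2 + a + j = (n + 1 + (a + j)) + 1 by intro a; omega, encode,
    List.getD_cons_succ, List.getD_append_right _ _ _ _ (by simp)]
  simp

theorem listStart_add_one_le {adj : Fin n → List (Fin n)} (hnd : ∀ v, (adj v).Nodup) (v : Fin n) :
    listStart adj (v + 1) ≤ listStart adj v + n := by
  rw [listStart_succ]
  have := (hnd v).length_le_card
  simp at this
  omega

theorem listStart_mono (adj : Fin n → List (Fin n)) {v w : ℕ} (h : v ≤ w) :
    listStart adj v ≤ listStart adj w := by
  refine Nat.add_le_add_left (Finset.sum_le_sum fun u _ => ?_) _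
  split_ifs <;> omega

theorem listStart_le {adj : Fin n → List (Fin n)} (hnd : ∀ v, (adj v).Nodup) (v : ℕ) :
    listStart adj v ≤ n + 2 + n * n := by
  refine Nat.add_le_add_left ?_ _
  refine (Finset.sum_le_card_nsmul _ _ n fun u _ => ?_).trans (by simp)
  have := (hnd u).length_le_card
  simp at this
  split_ifs <;> omega

/-- The environment given by the input words. -/
def inputEnv (adj : Fin n → List (Fin n)) : Env where
  inp := fun i => (encode adj).getD i 0
  len := (encode adj).length
  bound := (n + 2) ^ 4

/-- The exponent `4` is dictated by small `n`: for `n = 0` the cube would be only `8`. -/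
theorem bound_large (n : ℕ) : n * n + 4 * n + 10 < (n + 2) ^ 4 := by
  have : (n + 2) ^ 4 = n ^ 4 + 8 * n ^ 3 + 24 * n ^ 2 + 32 * n + 16 := by ring
  rw [this]
  nlinarith [Nat.zero_le (n ^ 4), Nat.zero_le (n ^ 3)]

theorem isInput_encode {adj : Fin n → List (Fin n)} (h : IsAdjLists G adj) :
    IsInput (inputEnv adj) n (NatAdj G) := by
  have hnd : ∀ v, (adj v).Nodup := fun v => (h v).1
  have hs : ∀ v ≤ n, (inputEnv adj).inp (v + 1) = listStart adj v := fun v hv =>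
    getD_encode_start adj hv
  have hlen : (inputEnv adj).len = listStart adj n := length_encode adj
  constructor
  · simp [inputEnv, encode]
  · rw [hlen]
    exact Nat.le_add_right _ _
  · intro v hv
    rw [hs (v + 1) hv, hlen]
    exact listStart_mono adj hv
  · intro v hv
    rw [hs (v + 1) hv, hs v hv.le]
    exact listStart_mono adj (Nat.le_succ v)
  · intro v hv
    rw [hs (v + 1) hv, hs v hv.le]
    exact listStart_add_one_le hnd ⟨v, hv⟩
  · intro v hv u
    rw [hs (v + 1) hv, hs v hv.le, listStart_succ adj ⟨v, hv⟩]
    constructor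
    · rintro ⟨_, hu, ha⟩
      obtain ⟨j, hj, he⟩ := List.getElem_of_mem (((h ⟨v, hv⟩).2 ⟨u, hu⟩).2 ha)
      refine ⟨_, Nat.le_add_right _ j, Nat.add_lt_add_left hj _,
        (getD_encode_list adj ⟨v, hv⟩ hj).trans ?_⟩
      rw [he]
    · rintro ⟨p, hp, hp', rfl⟩
      obtain ⟨j, rfl⟩ := Nat.exists_eq_add_of_le hp
      have hj : j < (adj ⟨v, hv⟩).length := Nat.lt_of_add_lt_add_left hp'
      have := getD_encode_list adj ⟨v, hv⟩ hj
      rw [show (inputEnv adj).inp (listStart adj v + j) = (adj ⟨v, hv⟩)[j] from this]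
      exact (natAdj_val (v := ⟨v, hv⟩)).2 (((h ⟨v, hv⟩).2 _).1 (List.getElem_mem hj))
  · exact fun v u ⟨_, hu, _⟩ => hu
  · have h1 := listStart_le hnd n
    have h2 := bound_large n
    rw [hlen]
    change _ < (n + 2) ^ 4
    omega

theorem getD_encode_lt {adj : Fin n → List (Fin n)} (h : IsAdjLists G adj) (i : ℕ) :
    (encode adj).getD i 0 < (n + 2) ^ 4 := by
  have h2 := bound_large n
  have hmem : ∀ x ∈ encode adj, x ≤ n + 2 + n * n := by
    intro x hx
    simp only [encode, List.mem_cons, List.mem_append, List.mem_map, List.mem_flatMap] at hx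
    rcases hx with rfl | ⟨v, -, rfl⟩ | ⟨v, -, u, -, rfl⟩
    · omega
    · exact listStart_le (fun v => (h v).1) v
    · omega
  by_cases hi : i < (encode adj).length
  · rw [List.getD_eq_getElem _ _ hi]
    have := hmem _ (List.getElem_mem hi)
    omega
  · rw [List.getD_eq_default _ _ (not_lt.1 hi)]
    positivity

/-- The reduction common to both problems: whatever graph `H G` the flag `f` makes the program
build, it is `H G` that is tested for being a $(2,1)$-graph, in time measured by the edges of `H G`.
-/
theorem decidableInTime_solve (hf : f ≤ 1) (hwf : (solve f).wf = true)
    (H : ∀ {n : ℕ}, SimpleGraph (Fin n) → SimpleGraph (Fin n))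
    (hH : ∀ {n : ℕ} (G : SimpleGraph (Fin n)), Flip n f (NatAdj G) = NatAdj (H G)) :
    DecidableInTime (fun {_} G => (H G).IsKLGraph 2 1)
      (fun {n} G => n * (n + (H G).edgeSet.ncard)) := by
  refine ⟨(solve f).program rANS, ((solve f).code 4).length * 17000 + 7, 9, fun n G adj h => ?_⟩
  have hA := isInput_encode h
  have hb := bound_large n
  have hV : (inputEnv adj).Large n := by
    change (n + 1) * (n + 1) + n + 8 < (n + 2) ^ 4
    nlinarith
  have hn : 2 * n + 8 < (inputEnv adj).bound := by
    change 2 * n + 8 < (n + 2) ^ 4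
    nlinarith
  obtain ⟨t, hrun, hans, htime⟩ := solve_spec (s := ⟨fun _ => 0, fun _ _ => 0, 0⟩) hV hn hA hf
    (hH G) (fun _ => rfl) rfl rfl
  refine ⟨decide (0 < t.r rANS), exec_mono (Cmd.exec_program (V := inputEnv adj) ?_ hwf rfl
    (fun _ => rfl) (fun i => getD_encode_lt h i) (by omega) ?_ hrun) ?_, ?_⟩
  · have h1 := hA.len_lt
    change (encode adj).length + 16 * (n + 2) ^ 4 + 16 ≤ _
    change (encode adj).length < (n + 2) ^ 4 at h1
    -- Addresses stay below `32 * (n + 2) ^ 4`, and `32 ≤ (n + 2) ^ 5`, whence the exponent `9 = 4 +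
    -- 5`.
    have h3 : 2 ^ 5 ≤ (n + 2) ^ 5 := Nat.pow_le_pow_left (by omega) 5
    have h4 : (n + 2) ^ 9 = (n + 2) ^ 4 * (n + 2) ^ 5 := by ring
    rw [h4]
    have := Nat.mul_le_mul_left ((n + 2) ^ 4) h3
    omega
  · rw [hA.size]
    exact (getD_encode_start adj le_rfl).trans (length_encode adj).symm
  · have := Nat.mul_le_mul_left ((solve f).code 4).length htime
    rw [add_mul]
    refine Nat.add_le_add (this.trans_eq (mul_assoc _ _ _).symm) (Nat.le_mul_of_pos_right 7 ?_)
    exact Nat.succ_pos _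
  · rw [decide_eq_true_iff, Nat.pos_iff_ne_zero]
    exact hans

end

end WordRAM

theorem mainTheorem1 :
    WordRAM.DecidableInTime
      (fun {_n} G => G.IsKLGraph 2 1)
      (fun {n} G => n * (n + G.edgeSet.ncard)) ∧
    WordRAM.DecidableInTime
      (fun {_n} G => G.IsKLGraph 1 2)
      (fun {n} G => n * (n + Gᶜ.edgeSet.ncard)) := by
  refine ⟨WordRAM.decidableInTime_solve (f := 0) zero_le_one (by decide) (fun G => G)
    WordRAM.flip_zero, ?_⟩
  -- A graph is a $(1,2)$-graph exactly if its complement is a $(2,1)$-graph, so the time is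
  -- governed by the edges of the complement.
  have := WordRAM.decidableInTime_solve (f := 1) le_rfl (by decide) (fun G => Gᶜ) WordRAM.flip_one
  simpa only [WordRAM.isKLGraph_compl] using this
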